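/- Write $V=\mathbb R^3$, $\mu(v)=e^{-|v|^2}$, and let $\phi^{ij}(v)=\frac1{8\pi}\big(\delta_{ij}-\frac{v_iv_j}{|v|^2}\big)\frac1{|v|}$ be the Coulomb kernel; repeated indices $i,j\in\{1,2,3\}$ are summed. For $R\in(0,\infty]$ (with $\{|v|\le\infty\}=\mathbb R^3$) put $$\sigma_R^{ij}(v)=\int_{|\tilde v|\le R}\phi^{ij}(v-\tilde v)\,\mu(\tilde v)\,d\tilde v,\qquad |p|_{\sigma,R}^2=\int_{|v|\le R}\sigma_R^{ij}\big(\partial_ip\,\partial_jp+v_iv_j\,p^2\big)\,dv,$$ $$Q(f,R)=\frac12\iint_{|v|,|\tilde v|\le R}\mu(v)\mu(\tilde v)\,\phi^{ij}(v-\tilde v)\,\big(F_i(v)-F_i(\tilde v)\big)\big(F_j(v)-F_j(\tilde v)\big)\,dv\,d\tilde v,\qquad F_i=\partial_i(f\mu^{-1}),$$ and $$\Pi_0(R)p=\sum_{j=1}^5 e_j\int_{|v|\le R}p\,e_j\,dv,$$ where $e_1,\dots,e_5$ is an $L^2$-orthonormal basis of the span of $\mu^{1/2}\mathbf 1_{|v|\le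 R}$, $v_i\mu^{1/2}\mathbf 1_{|v|\le R}$ $(i=1,2,3)$ and $|v|^2\mu^{1/2}\mathbf 1_{|v|\le R}$. Derivatives are weak derivatives on the open ball $\{|v|<R\}$. Let $\mathcal X_R$ be the set of radially symmetric $f:\mathbb R^3\to\mathbb R$ that are weakly differentiable on $\{|v|<R\}$ (that is, in $W^{1,1}_{\rm loc}$) and satisfy $|f\mu^{-1/2}|_{\sigma,R}<\infty$. Say that the coercive estimate holds at $R$ with constant $\delta$ if $$Q(f,R)\ \ge\ \delta\,\big|(I-\Pi_0(R))(f\mu^{-1/2})\big|_{\sigma,R}^2\qquad\text{for all } f\in\mathcal X_R .$$ Then there are constants $\delta_n>0$ $(n=1,2,3,\dots)$ such that, for every integer $n\ge1$, the coercive estimate holds at $R=n$ with constant $\delta_n$. The coercive estimate also holds at $R=\infty$ with some positive constant, and for every $\delta_\infty>0$ with which it holds at $R=\infty$, $$\liminf_{n\to\infty}\delta_n\ \ge\ \min(1,\delta_\infty).$$ Moreover there is $\delta_*>0$ with $\delta_n\ge\delta_*$ for all $n\ge1$. -/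

import Mathlib

open MeasureTheory Filter Topology
open scoped ENNReal

noncomputable section

namespace Landau

/-- The velocity space `ℝ³` with its Euclidean norm. -/
abbrev V : Type := EuclideanSpace ℝ (Fin 3)

/-- The closed ball `{|v| ≤ R}`; the radius may be `∞`, and then it is the whole space. -/
def cball (R : ℝ≥0∞) : Set V := {v | ‖v‖ₑ ≤ R}

/-- The open ball `{|v| < R}`; for `R = ∞` it is the whole space. -/
def oball (R : ℝ≥0∞) : Set V := {v | ‖v‖ₑ < R}

/-- The Maxwellian `μ(v) = exp(-|v|²)`. -/
def maxwellian (v : V) : ℝ := Real.exp (-‖v‖ ^ 2)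

/-- The Coulomb kernel `φ^{ij}(v) = (1 / 8π) (δ_{ij} - v_i v_j / |v|²) / |v|`. -/
def coulomb (i j : Fin 3) (v : V) : ℝ :=
  1 / (8 * Real.pi) * ((if i = j then 1 else 0) - v i * v j / ‖v‖ ^ 2) * (1 / ‖v‖)

/-- The localized coefficient `σ_R^{ij}(v) = ∫_{|w| ≤ R} φ^{ij}(v - w) μ(w) dw`. -/
def sigmaCoeff (R : ℝ≥0∞) (i j : Fin 3) (v : V) : ℝ :=
  ∫ w in cball R, coulomb i j (v - w) * maxwellian w

/-- `G` is the weak gradient of the scalar function `f` on the open set `U`. -/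
structure HasWeakGradOn (U : Set V) (f : V → ℝ) (G : V → V) : Prop where
  locallyIntegrable : LocallyIntegrableOn f U volume
  grad_locallyIntegrable : LocallyIntegrableOn G U volume
  integral_eq : ∀ ψ : V → ℝ, ContDiff ℝ ((⊤ : ℕ∞) : WithTop ℕ∞) ψ → HasCompactSupport ψ → tsupport ψ ⊆ U →
    ∀ i : Fin 3,
      ∫ v, f v * fderiv ℝ ψ v (EuclideanSpace.single i 1) = -∫ v, G v i * ψ v

/-- `f` is weakly differentiable on `U`, that is, `f ∈ W^{1,1}_loc(U)`. -/
def WeaklyDifferentiableOn (U : Set V) (f : V → ℝ) : Prop :=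
  ∃ G : V → V, HasWeakGradOn U f G

open Classical in
/-- The weak gradient of `f` on `U`. It is unique up to null subsets of `U`
(and is set to `0` when `f` is not weakly differentiable on `U`). -/
def weakGrad (U : Set V) (f : V → ℝ) : V → V :=
  if h : WeaklyDifferentiableOn U f then h.choose else 0

/-- The square of the localized norm,
`|p|²_{σ,R} = ∫_{|v| ≤ R} σ_R^{ij} (∂_i p ∂_j p + v_i v_j p²) dv`, as a number in `[0, ∞]`
(the integrand is nonnegative because the matrix `σ_R` is positive semidefinite). -/
def sigmaNormSq (R : ℝ≥0∞) (p : V → ℝ) : ℝ≥0∞ :=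
  ∫⁻ v in cball R, ENNReal.ofReal
    (∑ i, ∑ j, sigmaCoeff R i j v *
      (weakGrad (oball R) p v i * weakGrad (oball R) p v j + v i * v j * p v ^ 2))

/-- The localized quadratic form
`Q(f,R) = ½ ∬_{|v|,|w| ≤ R} μ(v) μ(w) φ^{ij}(v-w) (F_i(v) - F_i(w)) (F_j(v) - F_j(w)) dv dw`
with `F_i = ∂_i (f μ⁻¹)`, as a number in `[0, ∞]` (the integrand is nonnegative because the
matrix `φ` is positive semidefinite). -/
def quadForm (R : ℝ≥0∞) (f : V → ℝ) : ℝ≥0∞ :=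
  let F : V → V := weakGrad (oball R) (fun v => f v * (maxwellian v)⁻¹)
  2⁻¹ * ∫⁻ v in cball R, ∫⁻ w in cball R, ENNReal.ofReal
    (maxwellian v * maxwellian w *
      ∑ i, ∑ j, coulomb i j (v - w) * (F v i - F w i) * (F v j - F w j))

/-- The linear span of `μ^{1/2} 1_{|v| ≤ R}`, `v_i μ^{1/2} 1_{|v| ≤ R}` (`i = 1, 2, 3`) and
`|v|² μ^{1/2} 1_{|v| ≤ R}`. -/
def kernelSpan (R : ℝ≥0∞) : Submodule ℝ (V → ℝ) :=
  Submodule.span ℝ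
    ((fun h : V → ℝ => (cball R).indicator (fun v => h v * maxwellian v ^ (1 / 2 : ℝ))) ''
      ({(fun _ => 1), (fun v => ‖v‖ ^ 2)} ∪ Set.range (fun (i : Fin 3) (v : V) => v i)))

/-- `e_1, …, e_5` is an `L²` orthonormal basis of `kernelSpan R`. -/
structure IsKernelBasis (R : ℝ≥0∞) (e : Fin 5 → V → ℝ) : Prop where
  orthonormal : ∀ j k, ∫ v in cball R, e j v * e k v = if j = k then 1 else 0
  span_eq : Submodule.span ℝ (Set.range e) = kernelSpan R

/-- The `L²` projection `Π₀(R) p = ∑_j e_j ∫_{|v| ≤ R} p e_j dv`. It does not depend on the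
orthonormal basis `e` of `kernelSpan R` that is used to write it. -/
def proj (R : ℝ≥0∞) (e : Fin 5 → V → ℝ) (p : V → ℝ) : V → ℝ :=
  fun v => ∑ j, e j v * ∫ w in cball R, p w * e j w

/-- `f` is radially symmetric. -/
def Radial (f : V → ℝ) : Prop := ∃ F : ℝ → ℝ, ∀ v, f v = F ‖v‖

/-- `p = f μ^{-1/2}`. -/
def divSqrtMaxwellian (f : V → ℝ) : V → ℝ := fun v => f v * maxwellian v ^ (-(1 / 2) : ℝ)

/-- The radially symmetric functions of finite energy on `{|v| ≤ R}`: weakly differentiable on the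
open ball, with `|f μ^{-1/2}|_{σ,R} < ∞`. -/
structure RadialFiniteEnergy (R : ℝ≥0∞) (f : V → ℝ) : Prop where
  radial : Radial f
  weaklyDifferentiable : WeaklyDifferentiableOn (oball R) f
  finite : sigmaNormSq R (divSqrtMaxwellian f) < ∞

/-- The coercive estimate `Q(f,R) ≥ δ |(I - Π₀(R)) (f μ^{-1/2})|²_{σ,R}` with constant `δ`, for all
radially symmetric `f` of finite energy on `{|v| ≤ R}`. -/
def CoerciveAt (R : ℝ≥0∞) (δ : ℝ) : Prop :=
  ∀ e : Fin 5 → V → ℝ, IsKernelBasis R e → ∀ f : V → ℝ, RadialFiniteEnergy R f →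
    ENNReal.ofReal δ * sigmaNormSq R (divSqrtMaxwellian f - proj R e (divSqrtMaxwellian f)) ≤ quadForm R f

end Landau

end

/-! On radial functions the estimate is one-dimensional. Write f = u(|v|) μ with u' = r H, so that
∇(f μ⁻¹) = H(|v|) v. The Coulomb kernel φ(v - w) annihilates v - w, so its contraction with H(|v|) v
- H(|w|) w is κ(v,w) (H(|v|) - H(|w|))², where κ = |v × w|² / (8π |v - w|³). Put λ_R = σ_R^{ij} v_i
v_j = ∫_{|w| ≤ R} κ μ. Then Q = ½ ∬ μ μ κ (H(|v|) - H(|w|))² (`quadForm_eq_qform`), while the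
squared norm of u μ^{1/2} is ∫ λ_R ((H - u)² + u²) μ (`sigmaNormSq_eq_energy`). The functions u = a
+ c r² are those with H constant, and the projection of a radial function has no linear component
(`exists_proj_radial`). It remains to bound the energy by Q for u orthogonal to 1 and r² in L²(μ).

Coercivity uniform in R ≥ 1. The weight λ_R is comparable to r²/(1+r)³, uniformly in R
(`exists_lam_le`, `exists_le_lam`). Averaging κ over a fixed shell yields a Poincaré inequality: the
weighted norm of H - H(s) is at most C Q for some radius s (`exists_poincare`). After subtraction of
a kernel function, H becomes H - H(s) and u vanishes at 1/2, and a Hardy inequality bounds u by H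
(`IsProfile.hardy`). The subtracted kernel function is controlled by the remainder, because the
original u is orthogonal to it. This gives `exists_coerciveAt`, hence one positive constant for
every n and for R = ∞.

Sharp constant for large n. Let δ ≤ 1 be admissible at R = ∞. Extend an orthogonal profile from the
ball of radius n by H = 0, so that u is constant outside. Two errors appear, both bounded by o(1)
times the energy in the ball. The form on the whole space exceeds Q by ∫ (λ_∞ - λ_n) H² μ
(`qform_top_extGrad_eq`), where the Gaussian tail beats the polynomial loss in λ_n. The kernel
component of the extension involves only its values outside the ball, thus a tail of a convergent
integral (`exists_extension_kernel_le`). So δ - τ_n is admissible at n, with τ_n → 0 independent of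
δ (`exists_transfer`). Taking for δ the supremum of the admissible constants up to 1, less 1/(n+1),
and never going below the uniform constant, gives all the claims. -/

noncomputable section
namespace Landau

/-! ### The Coulomb kernel contracted with radial fields -/

/-- The contraction `φ^{ij}(v - w) v_i v_j` of the Coulomb kernel. -/
def kappa (v w : V) : ℝ :=
  (‖v‖ ^ 2 * ‖w‖ ^ 2 - inner ℝ v w ^ 2) / (8 * Real.pi * ‖v - w‖ ^ 3)

/-- The radial entry `σ_R^{ij} v_i v_j` of the localized coefficient. -/
def lam (R : ℝ≥0∞) (v : V) : ℝ := ∫ w in cball R, kappa v w * maxwellian w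

lemma norm_sq_eq_coords (v : V) : ‖v‖ ^ 2 = v 0 ^ 2 + v 1 ^ 2 + v 2 ^ 2 := by
  rw [EuclideanSpace.norm_sq_eq]; simp [Fin.sum_univ_three]

lemma inner_eq_coords (v w : V) : inner ℝ v w = v 0 * w 0 + v 1 * w 1 + v 2 * w 2 := by
  rw [PiLp.inner_apply]; simp [Fin.sum_univ_three]; ring

lemma sum_coulomb (z X : V) :
    ∑ i, ∑ j, coulomb i j z * X i * X j
      = (‖z‖ ^ 2 * ‖X‖ ^ 2 - inner ℝ z X ^ 2) / (8 * Real.pi * ‖z‖ ^ 3) := by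
  -- At z = 0 both sides vanish, division by zero being zero.
  by_cases hz : ‖z‖ = 0
  · simp [coulomb, hz]
  have hpi := Real.pi_ne_zero
  rw [norm_sq_eq_coords X, inner_eq_coords]
  simp only [coulomb, Fin.sum_univ_three]
  simp
  field_simp
  ring

/-- Since a v - b w = (a - b) v + b (v - w) and the kernel annihilates v - w, only (a - b) v
contributes. This makes the quadratic form a weighted difference form in the scalar H. -/
lemma sum_coulomb_sub (v w : V) (a b : ℝ) :
    ∑ i, ∑ j, coulomb i j (v - w) * (a * v i - b * w i) * (a * v j - b * w j)
      = kappa v w * (a - b) ^ 2 := by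
  have h := sum_coulomb (v - w) (a • v - b • w)
  simp only [PiLp.sub_apply, PiLp.smul_apply, smul_eq_mul] at h ⊢
  rw [h, kappa, div_mul_eq_mul_div]
  congr 1
  rw [norm_sq_eq_coords, norm_sq_eq_coords, norm_sq_eq_coords, norm_sq_eq_coords, inner_eq_coords,
    inner_eq_coords]
  simp
  ring

lemma sum_coulomb_self (v w : V) :
    ∑ i, ∑ j, coulomb i j (v - w) * v i * v j = kappa v w := by
  have := sum_coulomb_sub v w 1 0
  simpa using this

lemma cross_nonneg (v w : V) : 0 ≤ ‖v‖ ^ 2 * ‖w‖ ^ 2 - inner ℝ v w ^ 2 := by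
  have h := abs_real_inner_le_norm v w
  have : inner ℝ v w ^ 2 ≤ (‖v‖ * ‖w‖) ^ 2 := sq_le_sq' (by linarith [abs_le.1 h]) (abs_le.1 h).2
  nlinarith

lemma kappa_nonneg (v w : V) : 0 ≤ kappa v w :=
  div_nonneg (cross_nonneg v w) (by positivity)

lemma kappa_symm (v w : V) : kappa v w = kappa w v := by
  rw [kappa, kappa, real_inner_comm, norm_sub_rev, mul_comm (‖v‖ ^ 2)]

/-- The numerator is |v × w|² = |v × (v - w)|² ≤ |v|² |v - w|². The symmetric form `kappa_le'` is
the one that gives decay for large v. -/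
lemma kappa_le (v w : V) : kappa v w ≤ ‖v‖ ^ 2 / ‖v - w‖ := by
  by_cases hz : ‖v - w‖ = 0
  · simp [kappa, hz]
  have hpos : 0 < ‖v - w‖ := lt_of_le_of_ne (norm_nonneg _) (Ne.symm hz)
  have h1 : ‖v‖ ^ 2 * ‖w‖ ^ 2 - inner ℝ v w ^ 2 ≤ ‖v‖ ^ 2 * ‖v - w‖ ^ 2 := by
    have : ‖v‖ ^ 2 * ‖v - w‖ ^ 2 - (‖v‖ ^ 2 * ‖w‖ ^ 2 - inner ℝ v w ^ 2)
        = (‖v‖ ^ 2 - inner ℝ v w) ^ 2 := by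
      rw [norm_sub_sq_real]; ring
    nlinarith [sq_nonneg (‖v‖ ^ 2 - inner ℝ v w)]
  rw [kappa, div_le_div_iff₀ (by positivity) hpos]
  have hpi : 1 ≤ 8 * Real.pi := by linarith [Real.pi_gt_three]
  calc _ ≤ ‖v‖ ^ 2 * ‖v - w‖ ^ 2 * ‖v - w‖ := by gcongr
    _ = 1 * (‖v‖ ^ 2 * ‖v - w‖ ^ 3) := by ring
    _ ≤ 8 * Real.pi * (‖v‖ ^ 2 * ‖v - w‖ ^ 3) := by gcongr
    _ = _ := by ring

lemma kappa_le' (v w : V) : kappa v w ≤ ‖w‖ ^ 2 / ‖v - w‖ := by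
  rw [kappa_symm, norm_sub_rev]; exact kappa_le w v

/-- Once |v - w| is replaced by |v| + |w|, the only angular dependence left is |v × w|², whose
spherical averages are explicit. -/
lemma le_kappa (v w : V) :
    (‖v‖ ^ 2 * ‖w‖ ^ 2 - inner ℝ v w ^ 2) / (8 * Real.pi * (‖v‖ + ‖w‖) ^ 3) ≤ kappa v w := by
  by_cases hz : ‖v - w‖ = 0
  · have : v = w := by simpa [sub_eq_zero] using hz
    subst this
    simp [kappa]
    ring_nf; simp
  have hpos : 0 < ‖v - w‖ := lt_of_le_of_ne (norm_nonneg _) (Ne.symm hz)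
  rw [kappa]
  have := norm_sub_le v w
  have := Real.pi_pos
  apply div_le_div_of_nonneg_left (cross_nonneg v w) (by positivity)
  gcongr

/-! ### Measurability, and Riesz potentials of Gaussians -/

@[fun_prop]
lemma measurable_kappa : Measurable (fun p : V × V => kappa p.1 p.2) := by
  unfold kappa; fun_prop

@[fun_prop]
lemma continuous_maxwellian : Continuous maxwellian := by
  unfold maxwellian; fun_prop

@[fun_prop]
lemma measurable_maxwellian : Measurable maxwellian := continuous_maxwellian.measurable

lemma maxwellian_pos (v : V) : 0 < maxwellian v := Real.exp_pos _

lemma measurableSet_cball (R : ℝ≥0∞) : MeasurableSet (cball R) :=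
  measurableSet_le (by fun_prop) measurable_const

lemma isOpen_oball (R : ℝ≥0∞) : IsOpen (oball R) :=
  isOpen_lt (by fun_prop) continuous_const

lemma integrable_pow_mul_exp (k : ℕ) {b : ℝ} (hb : 0 < b) :
    Integrable (fun w : V => ‖w‖ ^ k * Real.exp (-b * ‖w‖ ^ 2)) := by
  have := integrable_rpow_mul_exp_neg_mul_sq hb (s := (k + 2 : ℕ)) (by
    have : (0 : ℝ) ≤ ((k + 2 : ℕ) : ℝ) := by positivity
    linarith)
  have h := (integrable_fun_norm_addHaar (μ := (volume : Measure V))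
    (f := fun r : ℝ => r ^ k * Real.exp (-b * r ^ 2))).2
  apply h
  refine this.integrableOn.congr_fun (fun r hr => ?_) measurableSet_Ioi
  simp only [Real.rpow_natCast, finrank_euclideanSpace, Fintype.card_fin, smul_eq_mul]
  ring

lemma integrable_pow_mul_maxwellian (k : ℕ) : Integrable (fun w : V => ‖w‖ ^ k * maxwellian w) := by
  simpa [maxwellian] using integrable_pow_mul_exp k one_pos

lemma lintegral_inv_norm_ball_lt_top :
    ∫⁻ z in Metric.ball (0 : V) 1, ENNReal.ofReal (1 / ‖z‖) < ∞ := by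
  have h : IntegrableOn (fun z : V => 1 / ‖z‖) (Metric.ball 0 1) := by
    rw [integrableOn_fun_norm_addHaar (μ := (volume : Measure V)) (f := fun r : ℝ => 1 / r)]
    have : IntegrableOn (fun y : ℝ => y) (Set.Ioo 0 1) :=
      (continuous_id.integrableOn_Icc (a := (0 : ℝ)) (b := 1)).mono_set Set.Ioo_subset_Icc_self
    refine this.congr_fun (fun r hr => ?_) measurableSet_Ioo
    have := hr.1.ne'
    simp; field_simp
  have := h.2
  refine lt_of_le_of_lt (lintegral_mono fun z => ?_) this
  rw [Real.enorm_eq_ofReal (by positivity)]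

/-- Where |v - w| < 1 the density is bounded and 1/|z| is locally integrable; elsewhere 1/|v - w| ≤
1. Translation invariance makes the bound independent of v. -/
lemma lintegral_div_norm_sub_le (ρ : V → ℝ) (hρ : ∀ w, 0 ≤ ρ w) (hm : Measurable ρ) (M : ℝ)
    (hM : ∀ w, ρ w ≤ M) (v : V) :
    ∫⁻ w, ENNReal.ofReal (ρ w / ‖v - w‖) ≤
      ENNReal.ofReal M * (∫⁻ z in Metric.ball (0 : V) 1, ENNReal.ofReal (1 / ‖z‖))
        + ∫⁻ w, ENNReal.ofReal (ρ w) := by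
  have h1 : ∀ w, ENNReal.ofReal (ρ w / ‖v - w‖) ≤
      ENNReal.ofReal M * (Metric.ball (0 : V) 1).indicator (fun z => ENNReal.ofReal (1 / ‖z‖)) (v - w)
        + ENNReal.ofReal (ρ w) := by
    intro w
    by_cases hw : v - w ∈ Metric.ball (0 : V) 1
    · rw [Set.indicator_of_mem hw, ← ENNReal.ofReal_mul ((hρ w).trans (hM w))]
      refine le_add_right (ENNReal.ofReal_le_ofReal ?_)
      rw [div_eq_mul_one_div]
      exact mul_le_mul_of_nonneg_right (hM w) (by positivity)
    · rw [Set.indicator_of_notMem hw, mul_zero, zero_add]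
      apply ENNReal.ofReal_le_ofReal
      have : 1 ≤ ‖v - w‖ := by simpa using hw
      exact div_le_self (hρ w) this
  refine (lintegral_mono h1).trans ?_
  rw [lintegral_add_right _ (by fun_prop), lintegral_const_mul' _ _ ENNReal.ofReal_ne_top,
    lintegral_sub_left_eq_self (μ := (volume : Measure V))
      ((Metric.ball (0 : V) 1).indicator (fun z => ENNReal.ofReal (1 / ‖z‖))) v,
    lintegral_indicator Metric.isOpen_ball.measurableSet]

/-- Riesz potentials of Gaussians are bounded. -/
lemma exists_riesz_bound (k : ℕ) {b : ℝ} (hb : 0 < b) :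
    ∃ C : ℝ, 0 < C ∧ ∀ v : V,
      ∫⁻ w, ENNReal.ofReal (‖w‖ ^ k * Real.exp (-b * ‖w‖ ^ 2) / ‖v - w‖) ≤ ENNReal.ofReal C := by
  have hbd : ∃ M : ℝ, ∀ w : V, ‖w‖ ^ k * Real.exp (-b * ‖w‖ ^ 2) ≤ M := by
    have hcont : Continuous fun r : ℝ => r ^ k * Real.exp (-b * r ^ 2) := by fun_prop
    have ht : Tendsto (fun r : ℝ => r ^ k * Real.exp (-b * r ^ 2)) atTop (𝓝 0) := by
      have := (rpow_mul_exp_neg_mul_sq_isLittleO_exp_neg hb (k : ℝ)).isBigO.trans_tendsto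
        (Real.tendsto_exp_atBot.comp
          (Filter.tendsto_id.const_mul_atTop_of_neg (show -(1 / 2 : ℝ) < 0 by norm_num)))
      simpa using this
    obtain ⟨N, hN⟩ := ((ht.eventually (gt_mem_nhds one_pos)).and (eventually_ge_atTop 0)).exists_forall_of_atTop
    obtain ⟨M, hM⟩ := (isCompact_Icc (a := (0 : ℝ)) (b := N)).bddAbove_image hcont.continuousOn
    refine ⟨max M 1, fun w => ?_⟩
    by_cases h : ‖w‖ ≤ N
    · exact (hM ⟨‖w‖, ⟨norm_nonneg _, h⟩, rfl⟩).trans (le_max_left _ _)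
    · exact (hN _ (le_of_not_ge h)).1.le.trans (le_max_right _ _)
  obtain ⟨M, hM⟩ := hbd
  have hint := integrable_pow_mul_exp k hb
  have hfin : ENNReal.ofReal M * (∫⁻ z in Metric.ball (0 : V) 1, ENNReal.ofReal (1 / ‖z‖))
        + ∫⁻ w : V, ENNReal.ofReal (‖w‖ ^ k * Real.exp (-b * ‖w‖ ^ 2)) ≠ ∞ := by
    refine ENNReal.add_ne_top.2 ⟨ENNReal.mul_ne_top ENNReal.ofReal_ne_top
      lintegral_inv_norm_ball_lt_top.ne, ?_⟩
    exact (hint.lintegral_lt_top).ne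
  set K := ENNReal.ofReal M * (∫⁻ z in Metric.ball (0 : V) 1, ENNReal.ofReal (1 / ‖z‖))
        + ∫⁻ w : V, ENNReal.ofReal (‖w‖ ^ k * Real.exp (-b * ‖w‖ ^ 2))
  refine ⟨K.toReal + 1, by positivity, fun v =>
    (lintegral_div_norm_sub_le _ (fun w => by positivity) (by fun_prop) M hM v).trans ?_⟩
  exact (ENNReal.ofReal_toReal hfin).ge.trans (ENNReal.ofReal_le_ofReal (by linarith))

@[fun_prop]
lemma measurable_kappa_right (v : V) : Measurable (fun w : V => kappa v w) := by
  unfold kappa; fun_prop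

@[fun_prop]
lemma measurable_coulomb (i j : Fin 3) : Measurable (coulomb i j) := by
  unfold coulomb; fun_prop

lemma abs_coulomb_le (i j : Fin 3) (z : V) : |coulomb i j z| ≤ 2 / ‖z‖ := by
  by_cases hz : ‖z‖ = 0
  · simp [coulomb, hz]
  have hpos : 0 < ‖z‖ := lt_of_le_of_ne (norm_nonneg _) (Ne.symm hz)
  have h1 : |z i * z j / ‖z‖ ^ 2| ≤ 1 := by
    rw [abs_div, abs_mul, abs_of_pos (by positivity : 0 < ‖z‖ ^ 2), div_le_one (by positivity), sq]
    exact mul_le_mul (PiLp.norm_apply_le z i) (PiLp.norm_apply_le z j) (abs_nonneg _) hpos.le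
  have h2 : |(if i = j then 1 else 0) - z i * z j / ‖z‖ ^ 2| ≤ 2 := by
    refine (abs_sub _ _).trans ?_
    split_ifs <;> simp <;> linarith
  have h3 : |1 / (8 * Real.pi)| ≤ 1 := by
    rw [abs_of_pos (by positivity), div_le_one (by positivity)]; linarith [Real.pi_gt_three]
  rw [coulomb, abs_mul, abs_mul, abs_of_pos (by positivity : 0 < 1 / ‖z‖)]
  calc _ ≤ 1 * 2 * (1 / ‖z‖) := by gcongr
    _ = _ := by ring

lemma integrable_maxwellian_div (v : V) : Integrable fun w : V => maxwellian w / ‖v - w‖ := by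
  obtain ⟨C, -, hC⟩ := exists_riesz_bound 0 one_pos
  refine ⟨Measurable.aestronglyMeasurable (by fun_prop), ?_⟩
  refine lt_of_le_of_lt (lintegral_mono fun w => ?_) ((hC v).trans_lt ENNReal.ofReal_lt_top)
  rw [Real.enorm_eq_ofReal (div_nonneg (maxwellian_pos w).le (norm_nonneg _))]
  simp [maxwellian]

lemma integrable_coulomb (i j : Fin 3) (v : V) :
    Integrable fun w : V => coulomb i j (v - w) * maxwellian w := by
  refine ((integrable_maxwellian_div v).const_mul 2).mono' (by fun_prop) (ae_of_all _ fun w => ?_)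
  rw [Real.norm_eq_abs, abs_mul, abs_of_pos (maxwellian_pos w)]
  calc _ ≤ 2 / ‖v - w‖ * maxwellian w :=
        mul_le_mul_of_nonneg_right (abs_coulomb_le i j _) (maxwellian_pos w).le
    _ = _ := by ring

lemma integrable_kappa (v : V) : Integrable fun w : V => kappa v w * maxwellian w := by
  refine ((integrable_maxwellian_div v).const_mul (‖v‖ ^ 2)).mono' (by fun_prop)
    (ae_of_all _ fun w => ?_)
  rw [Real.norm_eq_abs, abs_mul, abs_of_pos (maxwellian_pos w), abs_of_nonneg (kappa_nonneg v w)]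
  calc _ ≤ ‖v‖ ^ 2 / ‖v - w‖ * maxwellian w :=
        mul_le_mul_of_nonneg_right (kappa_le v w) (maxwellian_pos w).le
    _ = _ := by ring

/-! ### The radial entry of the coefficient matrix and its upper bound -/

lemma sum_sigmaCoeff (R : ℝ≥0∞) (v : V) :
    ∑ i, ∑ j, sigmaCoeff R i j v * (v i * v j) = lam R v := by
  have h : ∀ i j, sigmaCoeff R i j v * (v i * v j)
      = ∫ w in cball R, coulomb i j (v - w) * maxwellian w * (v i * v j) := fun i j => by
    rw [sigmaCoeff, integral_mul_const]
  simp_rw [h]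
  have hi : ∀ i j, Integrable (fun w => coulomb i j (v - w) * maxwellian w * (v i * v j))
      (volume.restrict (cball R)) := fun i j => ((integrable_coulomb i j v).mul_const _).restrict
  rw [lam]
  simp_rw [← integral_finsetSum Finset.univ (fun j _ => hi _ j)]
  rw [← integral_finsetSum _ (fun i _ => integrable_finsetSum _ (fun j _ => hi i j))]
  refine integral_congr_ae (ae_of_all _ fun w => ?_)
  simp only
  rw [← sum_coulomb_self, Finset.sum_mul]
  refine Finset.sum_congr rfl fun i _ => ?_
  rw [Finset.sum_mul]
  exact Finset.sum_congr rfl fun j _ => by ring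

lemma lam_nonneg (R : ℝ≥0∞) (v : V) : 0 ≤ lam R v :=
  integral_nonneg fun w => mul_nonneg (kappa_nonneg v w) (maxwellian_pos w).le

lemma ofReal_lam (R : ℝ≥0∞) (v : V) :
    ENNReal.ofReal (lam R v) = ∫⁻ w in cball R, ENNReal.ofReal (kappa v w * maxwellian w) :=
  ofReal_integral_eq_lintegral_ofReal (integrable_kappa v).restrict
    (ae_of_all _ fun w => mul_nonneg (kappa_nonneg v w) (maxwellian_pos w).le)

@[fun_prop]
lemma measurable_lam (R : ℝ≥0∞) : Measurable (lam R) := by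
  have : lam R = fun v => (∫⁻ w in cball R, ENNReal.ofReal (kappa v w * maxwellian w)).toReal := by
    ext v; rw [← ofReal_lam, ENNReal.toReal_ofReal (lam_nonneg R v)]
  rw [this]
  refine (Measurable.lintegral_prod_right' (f := fun p : V × V =>
    ENNReal.ofReal (kappa p.1 p.2 * maxwellian p.2)) ?_).ennreal_toReal
  fun_prop

lemma lam_mono {R R' : ℝ≥0∞} (h : R ≤ R') (v : V) : lam R v ≤ lam R' v :=
  setIntegral_mono_set (integrable_kappa v).integrableOn
    (ae_of_all _ fun w => mul_nonneg (kappa_nonneg v w) (maxwellian_pos w).le)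
    (Eventually.of_forall fun _ hw => le_trans hw h)

/-- The size of `lam`, up to constants. -/
def wt (r : ℝ) : ℝ := r ^ 2 / (1 + r) ^ 3

@[fun_prop]
lemma measurable_wt : Measurable wt := by unfold wt; fun_prop

lemma wt_nonneg {r : ℝ} (hr : 0 ≤ r) : 0 ≤ wt r := by unfold wt; positivity

lemma exists_lam_le : ∃ C : ℝ, 0 < C ∧ ∀ R v, lam R v ≤ C * wt ‖v‖ := by
  obtain ⟨C0, hC0, h0⟩ := exists_riesz_bound 0 one_pos
  obtain ⟨C3, hC3, h3⟩ := exists_riesz_bound 3 one_pos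
  have hI2 : 0 ≤ ∫ w : V, ‖w‖ ^ 2 * maxwellian w :=
    integral_nonneg fun w => mul_nonneg (by positivity) (maxwellian_pos w).le
  set I2 := ∫ w : V, ‖w‖ ^ 2 * maxwellian w with hI2def
  -- The bound for small v.
  have ha : ∀ R v, lam R v ≤ ‖v‖ ^ 2 * C0 := by
    intro R v
    rw [← ENNReal.ofReal_le_ofReal_iff (by positivity), ofReal_lam, ENNReal.ofReal_mul (by positivity)]
    refine (setLIntegral_le_lintegral _ _).trans (le_trans ?_ (mul_le_mul_right (h0 v) _))
    rw [← lintegral_const_mul' _ _ ENNReal.ofReal_ne_top]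
    refine lintegral_mono fun w => ?_
    rw [← ENNReal.ofReal_mul (by positivity)]
    apply ENNReal.ofReal_le_ofReal
    calc _ ≤ ‖v‖ ^ 2 / ‖v - w‖ * maxwellian w :=
          mul_le_mul_of_nonneg_right (kappa_le v w) (maxwellian_pos w).le
      _ = _ := by simp [maxwellian]; ring
  -- The bound for large v: κ ≤ |w|²/|v - w| and |v| ≤ |v - w| + |w|, so the extra factor |v| either
  -- cancels the singularity or becomes a power of |w|, which the Gaussian absorbs.
  have hb : ∀ R v, ‖v‖ * lam R v ≤ I2 + C3 := by
    intro R v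
    rw [← ENNReal.ofReal_le_ofReal_iff (by positivity), ENNReal.ofReal_mul (by positivity), ofReal_lam,
      ENNReal.ofReal_add hI2 hC3.le]
    refine (mul_le_mul_right (setLIntegral_le_lintegral _ _) _).trans
      (le_trans ?_ (add_le_add_right (h3 v) _))
    rw [hI2def, ofReal_integral_eq_lintegral_ofReal (integrable_pow_mul_maxwellian 2)
      (ae_of_all _ fun w => mul_nonneg (by positivity) (maxwellian_pos w).le),
      ← lintegral_const_mul' _ _ ENNReal.ofReal_ne_top, ← lintegral_add_left (by fun_prop)]
    refine lintegral_mono fun w => ?_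
    rw [← ENNReal.ofReal_mul (by positivity),
      ← ENNReal.ofReal_add (mul_nonneg (by positivity) (maxwellian_pos w).le) (by positivity)]
    apply ENNReal.ofReal_le_ofReal
    have hm := (maxwellian_pos w).le
    by_cases hz : ‖v - w‖ = 0
    · have : kappa v w = 0 := by simp [kappa, hz]
      rw [this]; simp; positivity
    have hpos : 0 < ‖v - w‖ := lt_of_le_of_ne (norm_nonneg _) (Ne.symm hz)
    have htri : ‖v‖ ≤ ‖v - w‖ + ‖w‖ := by simpa using norm_add_le (v - w) w
    calc ‖v‖ * (kappa v w * maxwellian w)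
        ≤ (‖v - w‖ + ‖w‖) * (‖w‖ ^ 2 / ‖v - w‖ * maxwellian w) := by
          have := kappa_nonneg v w
          gcongr
          exact kappa_le' v w
      _ = _ := by rw [show maxwellian w = Real.exp (-1 * ‖w‖ ^ 2) by simp [maxwellian]]; field_simp
  -- The factor 8 is 2³: (1 + r)³ is at most 8 for r ≤ 1 and at most 8 r³ for r ≥ 1.
  refine ⟨8 * (C0 + I2 + C3), by positivity, fun R v => ?_⟩
  have h1 := ha R v
  have h2 := hb R v
  have hr := norm_nonneg v
  have hl := lam_nonneg R v
  generalize ‖v‖ = r at *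
  unfold wt
  rw [mul_div_assoc', le_div_iff₀ (by positivity)]
  rcases le_total r 1 with h | h
  · have : (1 + r) ^ 3 ≤ 8 := by
      calc (1 + r) ^ 3 ≤ (1 + 1) ^ 3 := by gcongr
        _ = 8 := by norm_num
    calc lam R v * (1 + r) ^ 3 ≤ r ^ 2 * C0 * 8 := by gcongr
      _ ≤ r ^ 2 * C0 * 8 + r ^ 2 * (I2 + C3) * 8 := by
        have : 0 ≤ r ^ 2 * (I2 + C3) * 8 := by positivity
        linarith
      _ = _ := by ring
  · have : (1 + r) ^ 3 ≤ 8 * r ^ 3 := by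
      calc (1 + r) ^ 3 ≤ (r + r) ^ 3 := by gcongr
        _ = 8 * r ^ 3 := by ring
    calc lam R v * (1 + r) ^ 3 ≤ lam R v * (8 * r ^ 3) := by gcongr
      _ = 8 * r ^ 2 * (r * lam R v) := by ring
      _ ≤ 8 * r ^ 2 * (I2 + C3) := by gcongr
      _ ≤ 8 * r ^ 2 * (I2 + C3) + 8 * r ^ 2 * C0 := by
        have : 0 ≤ 8 * r ^ 2 * C0 := by positivity
        linarith
      _ = _ := by ring

/-! ### Angular averages and the lower bound for the radial entry -/

/-- The linear isometry that permutes the coordinates. -/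
abbrev permIso (σ : Equiv.Perm (Fin 3)) : V ≃ₗᵢ[ℝ] V := LinearIsometryEquiv.piLpCongrLeft 2 ℝ ℝ σ

/-- The linear isometry that changes the sign of the `i`-th coordinate. -/
def signIso (i : Fin 3) : V ≃ₗᵢ[ℝ] V :=
  LinearIsometryEquiv.piLpCongrRight 2
    (fun j => if j = i then LinearIsometryEquiv.neg ℝ else LinearIsometryEquiv.refl ℝ ℝ)

lemma signIso_apply (i j : Fin 3) (v : V) : signIso i v j = if j = i then -v j else v j := by
  by_cases h : j = i <;> simp [signIso, h]

lemma lintegral_comp_iso (A : V ≃ₗᵢ[ℝ] V) (f : V → ℝ≥0∞) : ∫⁻ v, f (A v) = ∫⁻ v, f v :=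
  A.measurePreserving.lintegral_comp_emb A.toHomeomorph.measurableEmbedding f

lemma integral_comp_iso (A : V ≃ₗᵢ[ℝ] V) (f : V → ℝ) : ∫ v, f (A v) = ∫ v, f v :=
  A.measurePreserving.integral_comp A.toHomeomorph.measurableEmbedding f

lemma lintegral_coord_sq (ρ : ℝ → ℝ≥0∞) (hρ : Measurable ρ) (i : Fin 3) :
    3 * ∫⁻ w : V, ENNReal.ofReal (w i ^ 2) * ρ ‖w‖ = ∫⁻ w : V, ENNReal.ofReal (‖w‖ ^ 2) * ρ ‖w‖ := by
  have h : ∀ j, ∫⁻ w : V, ENNReal.ofReal (w j ^ 2) * ρ ‖w‖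
      = ∫⁻ w : V, ENNReal.ofReal (w i ^ 2) * ρ ‖w‖ := by
    intro j
    rw [← lintegral_comp_iso (permIso (Equiv.swap i j))]
    simp [permIso, LinearIsometryEquiv.piLpCongrLeft_apply, Equiv.piCongrLeft']
  have h3 : ∀ w : V, ENNReal.ofReal (‖w‖ ^ 2) * ρ ‖w‖ = ENNReal.ofReal (w 0 ^ 2) * ρ ‖w‖
      + ENNReal.ofReal (w 1 ^ 2) * ρ ‖w‖ + ENNReal.ofReal (w 2 ^ 2) * ρ ‖w‖ := by
    intro w
    rw [norm_sq_eq_coords, ENNReal.ofReal_add (by positivity) (by positivity),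
      ENNReal.ofReal_add (by positivity) (by positivity), add_mul, add_mul]
  simp_rw [h3]
  rw [lintegral_add_left (by fun_prop), lintegral_add_left (by fun_prop), h 0, h 1, h 2]
  ring

/-- Reflecting the i-th coordinate flips the sign of the mixed term, so the integrals with minus and
with plus agree. Adding the two cancels the mixed term without any subtraction of possibly infinite
integrals. -/
lemma lintegral_cross_term (ρ : ℝ → ℝ≥0∞) (hρ : Measurable ρ) (a b : ℝ) {i j : Fin 3} (hij : i ≠ j) :
    ∫⁻ w : V, ENNReal.ofReal ((a * w j - b * w i) ^ 2) * ρ ‖w‖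
      = ENNReal.ofReal (a ^ 2) * (∫⁻ w : V, ENNReal.ofReal (w j ^ 2) * ρ ‖w‖)
        + ENNReal.ofReal (b ^ 2) * (∫⁻ w : V, ENNReal.ofReal (w i ^ 2) * ρ ‖w‖) := by
  have h1 : ∫⁻ w : V, ENNReal.ofReal ((a * w j - b * w i) ^ 2) * ρ ‖w‖
      = ∫⁻ w : V, ENNReal.ofReal ((a * w j + b * w i) ^ 2) * ρ ‖w‖ := by
    rw [← lintegral_comp_iso (signIso i)]
    simp [signIso_apply, hij.symm]
  have h2 : 2 * ∫⁻ w : V, ENNReal.ofReal ((a * w j - b * w i) ^ 2) * ρ ‖w‖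
      = 2 * (ENNReal.ofReal (a ^ 2) * (∫⁻ w : V, ENNReal.ofReal (w j ^ 2) * ρ ‖w‖)
        + ENNReal.ofReal (b ^ 2) * (∫⁻ w : V, ENNReal.ofReal (w i ^ 2) * ρ ‖w‖)) := by
    nth_rewrite 1 [two_mul]
    nth_rewrite 2 [h1]
    rw [← lintegral_add_left (by fun_prop), ← lintegral_const_mul _ (by fun_prop),
      ← lintegral_const_mul _ (by fun_prop), ← lintegral_add_left (by fun_prop),
      ← lintegral_const_mul _ (by fun_prop)]
    refine lintegral_congr fun w => ?_
    have h3 : ∀ x : ℝ, ENNReal.ofReal (2 * x) = 2 * ENNReal.ofReal x := fun x => by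
      rw [ENNReal.ofReal_mul (by norm_num)]; simp
    rw [← add_mul, ← mul_assoc, ← mul_assoc, ← add_mul, ← mul_assoc,
      ← ENNReal.ofReal_add (by positivity) (by positivity), ← ENNReal.ofReal_mul (by positivity),
      ← ENNReal.ofReal_mul (by positivity), ← ENNReal.ofReal_add (by positivity) (by positivity),
      ← h3]
    ring_nf
  exact (ENNReal.mul_right_inj (by simp) (by simp)).1 h2

/-- Spherical average of `|v × w|²`. -/
lemma lintegral_cross (ρ : ℝ → ℝ≥0∞) (hρ : Measurable ρ) (v : V) :
    ∫⁻ w : V, ENNReal.ofReal (‖v‖ ^ 2 * ‖w‖ ^ 2 - inner ℝ v w ^ 2) * ρ ‖w‖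
      = ENNReal.ofReal (2 / 3 * ‖v‖ ^ 2) * ∫⁻ w : V, ENNReal.ofReal (‖w‖ ^ 2) * ρ ‖w‖ := by
  have h0 : ∀ w : V, ENNReal.ofReal (‖v‖ ^ 2 * ‖w‖ ^ 2 - inner ℝ v w ^ 2) * ρ ‖w‖
      = ENNReal.ofReal ((v 0 * w 1 - v 1 * w 0) ^ 2) * ρ ‖w‖
        + ENNReal.ofReal ((v 1 * w 2 - v 2 * w 1) ^ 2) * ρ ‖w‖
        + ENNReal.ofReal ((v 2 * w 0 - v 0 * w 2) ^ 2) * ρ ‖w‖ := by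
    intro w
    rw [← add_mul, ← add_mul, ← ENNReal.ofReal_add (by positivity) (by positivity),
      ← ENNReal.ofReal_add (by positivity) (by positivity), norm_sq_eq_coords, norm_sq_eq_coords,
      inner_eq_coords]
    ring_nf
  simp_rw [h0]
  rw [lintegral_add_left (by fun_prop), lintegral_add_left (by fun_prop),
    lintegral_cross_term ρ hρ _ _ (by decide), lintegral_cross_term ρ hρ _ _ (by decide),
    lintegral_cross_term ρ hρ _ _ (by decide)]
  have hc : ∀ i, ∫⁻ w : V, ENNReal.ofReal (w i ^ 2) * ρ ‖w‖ =
      ENNReal.ofReal (1 / 3) * ∫⁻ w : V, ENNReal.ofReal (‖w‖ ^ 2) * ρ ‖w‖ := by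
    intro i
    rw [← lintegral_coord_sq ρ hρ i, ← mul_assoc, show (3 : ℝ≥0∞) = ENNReal.ofReal 3 by simp,
      ← ENNReal.ofReal_mul (by positivity)]
    norm_num
  rw [hc, hc, hc, norm_sq_eq_coords v]
  simp_rw [← mul_assoc, ← ENNReal.ofReal_mul (sq_nonneg _)]
  rw [← add_mul, ← add_mul, ← add_mul, ← add_mul, ← add_mul]
  congr 1
  repeat rw [← ENNReal.ofReal_add (by positivity) (by positivity)]
  ring_nf

/-- Lower bound for the angular average of `kappa` over a shell inside the unit ball. -/
lemma lintegral_kappa_ge (ρ : ℝ → ℝ≥0∞) (hρ : Measurable ρ) (hs : ∀ r, 1 < r → ρ r = 0) (v : V) :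
    ENNReal.ofReal (wt ‖v‖ / (12 * Real.pi)) * ∫⁻ w : V, ENNReal.ofReal (‖w‖ ^ 2) * ρ ‖w‖
      ≤ ∫⁻ w : V, ENNReal.ofReal (kappa v w) * ρ ‖w‖ := by
  have hp := Real.pi_pos
  -- The constant is (2/3)/(8π): the spherical average of |v × w|² divided by the normalization of
  -- κ, with |v| + |w| ≤ 1 + |v|.
  have e : ENNReal.ofReal (wt ‖v‖ / (12 * Real.pi))
      = ENNReal.ofReal (1 / (8 * Real.pi * (1 + ‖v‖) ^ 3)) * ENNReal.ofReal (2 / 3 * ‖v‖ ^ 2) := by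
    rw [← ENNReal.ofReal_mul (by positivity), wt]
    congr 1
    have : 1 + ‖v‖ ≠ 0 := by positivity
    field_simp
    ring
  rw [e, mul_assoc, ← lintegral_cross ρ hρ v, ← lintegral_const_mul' _ _ ENNReal.ofReal_ne_top]
  refine lintegral_mono fun w => ?_
  rw [← mul_assoc, ← ENNReal.ofReal_mul (by positivity)]
  by_cases hw : 1 < ‖w‖
  · simp [hs _ hw]
  · gcongr
    refine le_trans ?_ (le_kappa v w)
    rw [one_div_mul_eq_div]
    by_cases h0 : ‖v‖ + ‖w‖ = 0
    · have : ‖v‖ = 0 := by linarith [norm_nonneg v, norm_nonneg w]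
      have : v = 0 := by simpa using this
      simp [this]
    apply div_le_div_of_nonneg_left (cross_nonneg v w) (by positivity)
    gcongr _ * ?_ ^ 3
    linarith

/-- The unit ball alone suffices for the bound, and `lam` increases with the radius, so one constant
serves all R ≥ 1. -/
lemma exists_le_lam : ∃ c : ℝ, 0 < c ∧ ∀ R : ℝ≥0∞, 1 ≤ R → ∀ v, c * wt ‖v‖ ≤ lam R v := by
  set J : ℝ := ∫ w in cball 1, ‖w‖ ^ 2 * maxwellian w with hJ
  have hJpos : 0 < J := by
    rw [hJ, setIntegral_pos_iff_support_of_nonneg_ae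
      (ae_of_all _ fun w => mul_nonneg (by positivity) (maxwellian_pos w).le)
      (integrable_pow_mul_maxwellian 2).integrableOn]
    have : Metric.ball (EuclideanSpace.single 0 (1 / 2) : V) (1 / 4) ⊆
        Function.support (fun w : V => ‖w‖ ^ 2 * maxwellian w) ∩ cball 1 := by
      intro w hw
      rw [mem_ball_iff_norm] at hw
      have h1 : ‖(EuclideanSpace.single 0 (1 / 2) : V)‖ = 1 / 2 := by simp
      have h2 := norm_sub_norm_le (EuclideanSpace.single 0 (1 / 2) : V) w
      have h3 := norm_sub_norm_le w (EuclideanSpace.single 0 (1 / 2) : V)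
      rw [norm_sub_rev] at h2
      refine ⟨?_, ?_⟩
      · have : ‖w‖ ≠ 0 := by linarith
        exact mul_ne_zero (pow_ne_zero 2 this) (maxwellian_pos w).ne'
      · simp only [cball, Set.mem_ofPred_eq]
        rw [← ofReal_norm, ← ENNReal.ofReal_one]
        exact ENNReal.ofReal_le_ofReal (by linarith)
    exact lt_of_lt_of_le (Metric.measure_ball_pos _ _ (by norm_num)) (measure_mono this)
  refine ⟨J / (12 * Real.pi), by positivity, fun R hR v => le_trans ?_ (lam_mono hR v)⟩
  rw [← ENNReal.ofReal_le_ofReal_iff (lam_nonneg _ _), ofReal_lam]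
  have h := lintegral_kappa_ge (fun r => (Set.Iic 1).indicator
    (fun r => ENNReal.ofReal (Real.exp (-r ^ 2))) r)
    (Measurable.indicator (by fun_prop) measurableSet_Iic) (fun r hr => by simp [hr]) v
  have hset : ∀ w : V, w ∈ cball 1 ↔ ‖w‖ ∈ Set.Iic (1 : ℝ) := by
    intro w
    simp only [cball, Set.mem_ofPred_eq, Set.mem_Iic]
    rw [← ofReal_norm, ← ENNReal.ofReal_one, ENNReal.ofReal_le_ofReal_iff (by norm_num)]
  have e1 : ∫⁻ w : V, ENNReal.ofReal (‖w‖ ^ 2) * (Set.Iic 1).indicator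
      (fun r => ENNReal.ofReal (Real.exp (-r ^ 2))) ‖w‖ = ENNReal.ofReal J := by
    rw [hJ, ofReal_integral_eq_lintegral_ofReal (integrable_pow_mul_maxwellian 2).integrableOn
      (ae_of_all _ fun w => mul_nonneg (by positivity) (maxwellian_pos w).le),
      ← lintegral_indicator (measurableSet_cball 1)]
    refine lintegral_congr fun w => ?_
    by_cases hw : w ∈ cball 1
    · rw [Set.indicator_of_mem hw, Set.indicator_of_mem ((hset w).1 hw),
        ENNReal.ofReal_mul (by positivity), maxwellian]
    · rw [Set.indicator_of_notMem hw, Set.indicator_of_notMem (fun h => hw ((hset w).2 h)), mul_zero]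
  have e2 : ∫⁻ w : V, ENNReal.ofReal (kappa v w) * (Set.Iic 1).indicator
      (fun r => ENNReal.ofReal (Real.exp (-r ^ 2))) ‖w‖
      = ∫⁻ w in cball 1, ENNReal.ofReal (kappa v w * maxwellian w) := by
    rw [← lintegral_indicator (measurableSet_cball 1)]
    refine lintegral_congr fun w => ?_
    by_cases hw : w ∈ cball 1
    · rw [Set.indicator_of_mem hw, Set.indicator_of_mem ((hset w).1 hw),
        ENNReal.ofReal_mul (kappa_nonneg v w), maxwellian]
    · rw [Set.indicator_of_notMem hw, Set.indicator_of_notMem (fun h => hw ((hset w).2 h)), mul_zero]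
  rw [e1, e2, ← ENNReal.ofReal_mul (div_nonneg (wt_nonneg (norm_nonneg v)) (by positivity))] at h
  refine le_trans (le_of_eq ?_) h
  congr 1
  ring

/-- For |w| > R, μ(w) ≤ e^{-R²/2} e^{-|w|²/2}: half of the Gaussian gives the smallness, the other
half keeps the Riesz potential bounded. -/
lemma exists_lam_top_sub_le : ∃ C : ℝ, 0 < C ∧ ∀ (R : ℝ), 0 ≤ R → ∀ v,
    lam ∞ v - lam (ENNReal.ofReal R) v ≤ C * Real.exp (-R ^ 2 / 2) * ‖v‖ ^ 2 := by
  obtain ⟨C, hC, h⟩ := exists_riesz_bound 0 (b := 1 / 2) (by norm_num)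
  refine ⟨C, hC, fun R hR v => ?_⟩
  have htop : cball ∞ = Set.univ := by ext; simp [cball]
  have e : lam ∞ v - lam (ENNReal.ofReal R) v
      = ∫ w in (cball (ENNReal.ofReal R))ᶜ, kappa v w * maxwellian w := by
    rw [lam, lam, htop, setIntegral_univ, ← integral_add_compl (measurableSet_cball _) (integrable_kappa v)]
    ring
  rw [e, ← ENNReal.ofReal_le_ofReal_iff (by positivity),
    ofReal_integral_eq_lintegral_ofReal (integrable_kappa v).restrict
    (ae_of_all _ fun w => mul_nonneg (kappa_nonneg v w) (maxwellian_pos w).le)]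
  calc ∫⁻ w in (cball (ENNReal.ofReal R))ᶜ, ENNReal.ofReal (kappa v w * maxwellian w)
      ≤ ∫⁻ w in (cball (ENNReal.ofReal R))ᶜ, ENNReal.ofReal (‖v‖ ^ 2 * Real.exp (-R ^ 2 / 2)) *
          ENNReal.ofReal (‖w‖ ^ 0 * Real.exp (-(1 / 2) * ‖w‖ ^ 2) / ‖v - w‖) := by
        refine setLIntegral_mono' (measurableSet_cball _).compl fun w hw => ?_
        rw [← ENNReal.ofReal_mul (by positivity)]
        apply ENNReal.ofReal_le_ofReal
        have hw' : R < ‖w‖ := by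
          simp only [cball, Set.mem_compl_iff, Set.mem_ofPred_eq, not_le] at hw
          rw [← ofReal_norm] at hw
          exact (ENNReal.ofReal_lt_ofReal_iff_of_nonneg hR).1 hw
        have hexp : maxwellian w ≤ Real.exp (-R ^ 2 / 2) * Real.exp (-(1 / 2) * ‖w‖ ^ 2) := by
          rw [maxwellian, ← Real.exp_add]
          apply Real.exp_le_exp.2
          nlinarith
        calc kappa v w * maxwellian w ≤ ‖v‖ ^ 2 / ‖v - w‖ *
              (Real.exp (-R ^ 2 / 2) * Real.exp (-(1 / 2) * ‖w‖ ^ 2)) := by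
              gcongr
              · exact (maxwellian_pos w).le
              · exact kappa_le v w
          _ = _ := by ring
    _ ≤ ENNReal.ofReal (‖v‖ ^ 2 * Real.exp (-R ^ 2 / 2)) * ENNReal.ofReal C := by
        rw [lintegral_const_mul' _ _ ENNReal.ofReal_ne_top]
        gcongr
        exact (setLIntegral_le_lintegral _ _).trans (h v)
    _ = _ := by rw [← ENNReal.ofReal_mul (by positivity)]; congr 1; ring

/-! ### Calculus of weak gradients -/

lemma integrable_mul_of_locallyIntegrableOn {U : Set V} {f φ : V → ℝ}
    (hf : LocallyIntegrableOn f U) (hφ : Continuous φ) (hc : HasCompactSupport φ)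
    (hs : tsupport φ ⊆ U) : Integrable (fun v => f v * φ v) := by
  have h1 : IntegrableOn (fun v => f v * φ v) (tsupport φ) :=
    (hf.integrableOn_compact_subset hs hc).mul_continuousOn hφ.continuousOn hc
  refine (integrableOn_iff_integrable_of_support_subset fun v hv => ?_).1 h1
  apply subset_tsupport
  intro h
  exact hv (by simp [h])

lemma LocallyIntegrableOn.coord {U : Set V} {G : V → V} (hG : LocallyIntegrableOn G U) (i : Fin 3) :
    LocallyIntegrableOn (fun v => G v i) U :=
  (EuclideanSpace.proj (𝕜 := ℝ) i : V →L[ℝ] ℝ).locallyIntegrableOn_comp hG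

lemma HasWeakGradOn.congr {U : Set V} (hU : MeasurableSet U) {f f' : V → ℝ} {G G' : V → V}
    (h : HasWeakGradOn U f G) (hf : f =ᵐ[volume.restrict U] f')
    (hG : G =ᵐ[volume.restrict U] G') : HasWeakGradOn U f' G' := by
  refine ⟨h.locallyIntegrable.congr hf, h.grad_locallyIntegrable.congr hG,
    fun ψ hψ hc hs i => ?_⟩
  have e1 : ∀ v, v ∉ U → ψ v = 0 := fun v hv => image_eq_zero_of_notMem_tsupport fun h => hv (hs h)
  have e2 : ∀ v, v ∉ U → fderiv ℝ ψ v (EuclideanSpace.single i 1) = 0 := fun v hv => by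
    rw [fderiv_of_notMem_tsupport ℝ (fun h => hv (hs h))]; rfl
  have a1 : ∫ v, f v * fderiv ℝ ψ v (EuclideanSpace.single i 1)
      = ∫ v, f' v * fderiv ℝ ψ v (EuclideanSpace.single i 1) := by
    apply integral_congr_ae
    filter_upwards [(ae_restrict_iff' hU).1 hf] with v hv
    by_cases hvU : v ∈ U
    · rw [hv hvU]
    · rw [e2 v hvU]; simp
  have a2 : ∫ v, G v i * ψ v = ∫ v, G' v i * ψ v := by
    apply integral_congr_ae
    filter_upwards [(ae_restrict_iff' hU).1 hG] with v hv
    by_cases hvU : v ∈ U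
    · rw [hv hvU]
    · rw [e1 v hvU]; simp
  rw [← a1, ← a2]
  exact h.integral_eq ψ hψ hc hs i

lemma HasWeakGradOn.unique {U : Set V} (hU : IsOpen U) {f : V → ℝ} {G G' : V → V}
    (h : HasWeakGradOn U f G) (h' : HasWeakGradOn U f G') : G =ᵐ[volume.restrict U] G' := by
  have key : ∀ i : Fin 3, ∀ᵐ v, v ∈ U → G v i - G' v i = 0 := by
    intro i
    have hl := (LocallyIntegrableOn.coord h.grad_locallyIntegrable i)
    have hl' := (LocallyIntegrableOn.coord h'.grad_locallyIntegrable i)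
    refine hU.ae_eq_zero_of_integral_contDiff_smul_eq_zero (hl.sub hl') fun ψ hψ hc hs => ?_
    have e := h.integral_eq ψ hψ hc hs i
    have e' := h'.integral_eq ψ hψ hc hs i
    have i1 := integrable_mul_of_locallyIntegrableOn hl hψ.continuous hc hs
    have i2 := integrable_mul_of_locallyIntegrableOn hl' hψ.continuous hc hs
    have : ∀ v, ψ v • (G v i - G' v i) = G v i * ψ v - G' v i * ψ v := fun v => by
      simp only [smul_eq_mul]; ring
    change ∫ v, ψ v • (G v i - G' v i) = 0
    simp_rw [this]
    rw [integral_sub i1 i2]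
    linarith
  rw [EventuallyEq, ae_restrict_iff' hU.measurableSet]
  filter_upwards [ae_all_iff.2 key] with v hv hvU
  ext i
  linarith [hv i hvU]

/-- `weakGrad` is made by choice; uniqueness lets any explicit weak gradient, of any almost
everywhere equal function, take its place in the integrals. -/
lemma weakGrad_ae_eq {U : Set V} (hU : IsOpen U) {f f' : V → ℝ} {G : V → V}
    (h : HasWeakGradOn U f' G) (hf : f' =ᵐ[volume.restrict U] f) :
    weakGrad U f =ᵐ[volume.restrict U] G := by
  have h1 : HasWeakGradOn U f G := h.congr hU.measurableSet hf (ae_eq_refl _)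
  have h2 : WeaklyDifferentiableOn U f := ⟨G, h1⟩
  rw [weakGrad, dif_pos h2]
  exact h2.choose_spec.unique hU h1

/-- Test the weak gradient of f with s ψ and expand the derivative of the product. -/
lemma HasWeakGradOn.mul_smooth {U : Set V} (hU : IsOpen U) {f s : V → ℝ} {G gs : V → V}
    (h : HasWeakGradOn U f G) (hs : ContDiff ℝ ((⊤ : ℕ∞) : WithTop ℕ∞) s) (hgs : Continuous gs)
    (hds : ∀ v i, fderiv ℝ s v (EuclideanSpace.single i 1) = gs v i) :
    HasWeakGradOn U (fun v => f v * s v) (fun v => s v • G v + f v • gs v) := by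
  have hU' : IsLocallyClosed U := hU.isLocallyClosed
  refine ⟨h.locallyIntegrable.mul_continuousOn hs.continuous.continuousOn hU', ?_, ?_⟩
  · exact (h.grad_locallyIntegrable.continuousOn_smul hU' hs.continuous.continuousOn).add
      (h.locallyIntegrable.smul_continuousOn hU' hgs.continuousOn)
  intro ψ hψ hc hsup i
  have hd : ∀ v, fderiv ℝ (fun v => s v * ψ v) v (EuclideanSpace.single i 1)
      = s v * fderiv ℝ ψ v (EuclideanSpace.single i 1) + ψ v * gs v i := by
    intro v
    rw [fderiv_fun_mul (hs.differentiable (by simp) v) (hψ.differentiable (by simp) v)]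
    simp [hds]
  have hsup' : tsupport (fun v => s v * ψ v) ⊆ U := (tsupport_mul_subset_right).trans hsup
  have e := h.integral_eq (fun v => s v * ψ v) (hs.mul hψ) hc.mul_left hsup' i
  simp_rw [hd] at e
  have hdψ : Continuous fun v => fderiv ℝ ψ v (EuclideanSpace.single i 1) :=
    (hψ.continuous_fderiv (by simp)).clm_apply continuous_const
  have hcs : HasCompactSupport fun v => fderiv ℝ ψ v (EuclideanSpace.single i 1) :=
    (hc.fderiv (𝕜 := ℝ)).comp_left (g := fun L : V →L[ℝ] ℝ => L (EuclideanSpace.single i 1)) rfl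
  have hss : tsupport (fun v => fderiv ℝ ψ v (EuclideanSpace.single i 1)) ⊆ U := by
    refine (closure_mono ?_).trans ((tsupport_fderiv_subset ℝ (f := ψ)).trans hsup)
    intro v hv h0
    exact hv (by simp [h0])
  have i1 : Integrable fun v => f v * (s v * fderiv ℝ ψ v (EuclideanSpace.single i 1)) :=
    integrable_mul_of_locallyIntegrableOn h.locallyIntegrable (hs.continuous.mul hdψ) hcs.mul_left
      (tsupport_mul_subset_right.trans hss)
  have hgi : Continuous fun v => gs v i := (EuclideanSpace.proj (𝕜 := ℝ) i).continuous.comp hgs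
  have i2 : Integrable fun v => f v * (ψ v * gs v i) :=
    integrable_mul_of_locallyIntegrableOn h.locallyIntegrable (hψ.continuous.mul hgi) hc.mul_right
      (tsupport_mul_subset_left.trans hsup)
  have i3 : Integrable fun v => G v i * (s v * ψ v) :=
    integrable_mul_of_locallyIntegrableOn (LocallyIntegrableOn.coord h.grad_locallyIntegrable i)
      (hs.continuous.mul hψ.continuous) hc.mul_left hsup'
  have e2 : ∫ v, (f v * (s v * fderiv ℝ ψ v (EuclideanSpace.single i 1)) + f v * (ψ v * gs v i))
      = -∫ v, G v i * (s v * ψ v) := by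
    rw [← e]; congr 1; ext v; ring
  rw [integral_add i1 i2] at e2
  have e3 : ∫ v, (s v • G v + f v • gs v) i * ψ v
      = (∫ v, G v i * (s v * ψ v)) + ∫ v, f v * (ψ v * gs v i) := by
    rw [← integral_add i3 i2]; congr 1; ext v; simp; ring
  rw [e3]
  have e4 : ∫ v, f v * s v * fderiv ℝ ψ v (EuclideanSpace.single i 1)
      = ∫ v, f v * (s v * fderiv ℝ ψ v (EuclideanSpace.single i 1)) := by
    congr 1; ext v; ring
  rw [e4]
  linarith

/-! ### Polar coordinates -/

/-- The surface measure of the unit sphere. -/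
abbrev sph : Measure (Metric.sphere (0 : V) 1) := (volume : Measure V).toSphere

/-- The measure `r² dr` on `(0, ∞)`. -/
def radMeas : Measure ℝ := (volume.restrict (Set.Ioi 0)).withDensity fun r => ENNReal.ofReal (r ^ 2)

instance : SFinite radMeas := by unfold radMeas; infer_instance

/-- The homeomorphism of V∖{0} with sphere × (0, ∞) carries volume to the product measure, and the
origin is null. The exponent 2 in the radial measure is the dimension minus one. -/
lemma measurePreserving_polar :
    MeasurePreserving (fun p : Metric.sphere (0 : V) 1 × ℝ => p.2 • (p.1 : V)) (sph.prod radMeas)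
      volume := by
  have h0 := (Measure.measurePreserving_homeomorphUnitSphereProd (volume : Measure V)).symm
    (homeomorphUnitSphereProd V).toMeasurableEquiv
  have h1 : MeasurePreserving (Subtype.val : ({0}ᶜ : Set V) → V)
      ((volume : Measure V).comap Subtype.val) volume := by
    refine ⟨measurable_subtype_coe, ?_⟩
    rw [map_comap_subtype_coe (measurableSet_singleton _).compl, restrict_compl_singleton]
  have h2 : MeasurePreserving (Subtype.val : Set.Ioi (0 : ℝ) → ℝ) (Measure.volumeIoiPow 2) radMeas := by
    refine ⟨measurable_subtype_coe, ?_⟩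
    ext s hs
    rw [Measure.map_apply measurable_subtype_coe hs, Measure.volumeIoiPow, radMeas,
      withDensity_apply _ hs, withDensity_apply _ (measurable_subtype_coe hs),
      setLIntegral_subtype measurableSet_Ioi _ (fun r : ℝ => ENNReal.ofReal (r ^ 2)),
      Measure.restrict_restrict hs, Subtype.image_preimage_coe, Set.inter_comm]
  have hd : Module.finrank ℝ V - 1 = 2 := by simp
  rw [hd] at h0
  refine ⟨by fun_prop, ?_⟩
  have h3 : sph.prod radMeas = (sph.prod (Measure.volumeIoiPow 2)).map (Prod.map id Subtype.val) :=
    (((MeasurePreserving.id sph).prod h2).map_eq).symm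
  rw [h3, Measure.map_map (by fun_prop) (by fun_prop)]
  rw [← (h1.comp h0).map_eq]
  congr 1

lemma sph_univ_ne_zero : sph Set.univ ≠ 0 := by
  simp [sph, Real.pi_pos]

/-- The area of the unit sphere. -/
def area : ℝ := sph.real Set.univ

lemma area_pos : 0 < area :=
  ENNReal.toReal_pos sph_univ_ne_zero (measure_ne_top _ _)

lemma ofReal_area : ENNReal.ofReal area = sph Set.univ := by
  rw [area, Measure.real, ENNReal.ofReal_toReal (measure_ne_top _ _)]

lemma norm_polar (p : Metric.sphere (0 : V) 1 × ℝ) (hp : 0 < p.2) : ‖p.2 • (p.1 : V)‖ = p.2 := by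
  rw [norm_smul, norm_eq_of_mem_sphere p.1, mul_one, Real.norm_of_nonneg hp.le]

lemma ae_radMeas_pos : ∀ᵐ r ∂radMeas, 0 < r := by
  have : radMeas ≪ volume.restrict (Set.Ioi 0) := withDensity_absolutelyContinuous _ _
  exact this.ae_le (ae_restrict_mem measurableSet_Ioi)

lemma measurePreserving_norm :
    (volume : Measure V).map (fun v => ‖v‖) = ENNReal.ofReal area • radMeas := by
  rw [← measurePreserving_polar.map_eq, Measure.map_map (by fun_prop) (by fun_prop), ofReal_area,
    ← Measure.map_snd_prod]
  apply Measure.map_congr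
  have h : ∀ᵐ p ∂(sph.prod radMeas), 0 < p.2 := Measure.quasiMeasurePreserving_snd.ae ae_radMeas_pos
  filter_upwards [h] with p hp
  exact norm_polar p hp

lemma lintegral_norm (f : ℝ → ℝ≥0∞) (hf : Measurable f) :
    ∫⁻ v : V, f ‖v‖ = ENNReal.ofReal area * ∫⁻ r in Set.Ioi 0, ENNReal.ofReal (r ^ 2) * f r := by
  rw [← lintegral_map (f := f) (g := fun v : V => ‖v‖) hf (by fun_prop), measurePreserving_norm,
    lintegral_smul_measure, radMeas, lintegral_withDensity_eq_lintegral_mul _ (by fun_prop) hf]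
  rfl

/-- The radii inside the open ball of radius `R`. -/
def radii (R : ℝ≥0∞) : Set ℝ := {r | 0 < r ∧ ENNReal.ofReal r < R}

lemma isOpen_radii (R : ℝ≥0∞) : IsOpen (radii R) :=
  (isOpen_lt continuous_const continuous_id).inter
    (isOpen_lt ENNReal.continuous_ofReal continuous_const)

lemma mem_oball_iff {R : ℝ≥0∞} {v : V} : v ∈ oball R ↔ ENNReal.ofReal ‖v‖ < R := by
  simp [oball]

lemma mem_cball_iff {R : ℝ≥0∞} {v : V} : v ∈ cball R ↔ ENNReal.ofReal ‖v‖ ≤ R := by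
  simp [cball]

/-- The norm pushes volume forward to a multiple of r² dr, so null sets of radii lift to null sets
of vectors. -/
lemma ae_oball_of_ae_radii {R : ℝ≥0∞} {P : ℝ → Prop} (h : ∀ᵐ r, r ∈ radii R → P r) :
    ∀ᵐ v : V, v ∈ oball R → P ‖v‖ := by
  have h1 : ∀ᵐ r ∂((volume : Measure V).map (fun v => ‖v‖)), r ∈ radii R → P r := by
    rw [measurePreserving_norm]
    have hac : ENNReal.ofReal area • radMeas ≪ volume :=
      (Measure.smul_absolutelyContinuous).trans
        ((withDensity_absolutelyContinuous _ _).trans Measure.restrict_le_self.absolutelyContinuous)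
    exact hac.ae_le h
  have h2 := ae_of_ae_map (by fun_prop) h1
  have h3 : ∀ᵐ v : V, v ≠ 0 := by simp [ae_iff]
  filter_upwards [h2, h3] with v hv hv0 hvR
  exact hv ⟨norm_pos_iff.2 hv0, mem_oball_iff.1 hvR⟩

lemma cball_ae_eq_oball (R : ℝ≥0∞) : cball R =ᵐ[volume] oball R := by
  by_cases hR : R = ∞
  · have h1 : cball R = Set.univ := by ext; simp [cball, hR]
    have h2 : oball R = Set.univ := by ext; simp [oball, hR]
    rw [h1, h2]; exact ae_eq_refl _
  have h3 : volume (Metric.sphere (0 : V) R.toReal) = 0 := Measure.addHaar_sphere _ _ _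
  have h4 : ∀ᵐ v : V, v ∉ Metric.sphere (0 : V) R.toReal := measure_eq_zero_iff_ae_notMem.1 h3
  filter_upwards [h4] with v hv
  apply propext
  change v ∈ cball R ↔ v ∈ oball R
  rw [mem_cball_iff, mem_oball_iff]
  refine ⟨fun h => lt_of_le_of_ne h fun e => hv ?_, le_of_lt⟩
  simp [← e]

lemma integrable_comp_polar {E : Type*} [NormedAddCommGroup E] {f : V → E} (hf : Integrable f) :
    Integrable (fun p : Metric.sphere (0 : V) 1 × ℝ => f (p.2 • (p.1 : V))) (sph.prod radMeas) :=
  measurePreserving_polar.integrable_comp_of_integrable hf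

lemma integral_radMeas (g : ℝ → ℝ) : ∫ r, g r ∂radMeas = ∫ r in Set.Ioi 0, r ^ 2 * g r := by
  rw [radMeas, integral_withDensity_eq_integral_toReal_smul (by fun_prop) (by simp)]
  refine integral_congr_ae (ae_of_all _ fun r => ?_)
  simp [ENNReal.toReal_ofReal (sq_nonneg r)]

lemma integrable_radMeas_iff (g : ℝ → ℝ) :
    Integrable g radMeas ↔ IntegrableOn (fun r => r ^ 2 * g r) (Set.Ioi 0) := by
  rw [radMeas, integrable_withDensity_iff_integrable_smul' (by fun_prop) (by simp)]
  refine integrable_congr (ae_of_all _ fun r => ?_)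
  simp [ENNReal.toReal_ofReal (sq_nonneg r)]

lemma integral_polar {f : V → ℝ} (hf : Integrable f) :
    ∫ v, f v = ∫ r in Set.Ioi 0, r ^ 2 * ∫ ω : Metric.sphere (0 : V) 1, f (r • (ω : V)) ∂sph := by
  have h1 : ∫ v, f v = ∫ p, f (p.2 • (p.1 : V)) ∂(sph.prod radMeas) := by
    rw [← measurePreserving_polar.map_eq, integral_map (by fun_prop)]
    rw [measurePreserving_polar.map_eq]; exact hf.aestronglyMeasurable
  rw [h1, integral_prod_symm _ (integrable_comp_polar hf), integral_radMeas]

/-! ### The divergence theorem on balls -/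

/-- The flux of `ψ` in direction `i` through the sphere of radius `r`, divided by `r²`. -/
def flux (ψ : V → ℝ) (i : Fin 3) (r : ℝ) : ℝ :=
  ∫ ω : Metric.sphere (0 : V) 1, (ω : V) i * ψ (r • (ω : V)) ∂sph

lemma continuous_flux {ψ : V → ℝ} (hψ : Continuous ψ) (i : Fin 3) : Continuous (flux ψ i) := by
  have h := continuous_parametric_integral_of_continuous (μ := sph)
    (f := fun (r : ℝ) (ω : Metric.sphere (0 : V) 1) => (ω : V) i * ψ (r • (ω : V)))
    (by fun_prop) (isCompact_univ (X := Metric.sphere (0 : V) 1))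
  have e : flux ψ i = fun r => ∫ ω : Metric.sphere (0 : V) 1, (ω : V) i * ψ (r • (ω : V)) ∂sph := rfl
  rw [e]
  simpa using h

/-- Near the origin θ is constant, which removes the only point where the norm is not
differentiable. -/
lemma hasFDerivAt_comp_norm {θ η : ℝ → ℝ} (hθ : ∀ t, HasDerivAt θ (η t) t)
    (h0 : ∀ᶠ t in 𝓝 (0 : ℝ), η t = 0) (v : V) :
    HasFDerivAt (fun v : V => θ ‖v‖) ((η ‖v‖ / ‖v‖) • innerSL ℝ v) v := by
  by_cases hv : v = 0
  · subst hv
    have hη0 : η 0 = 0 := h0.self_of_nhds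
    obtain ⟨ε, hε, hball⟩ := Metric.eventually_nhds_iff.1 h0
    have hconst : (fun v : V => θ ‖v‖) =ᶠ[𝓝 0] fun _ => θ 0 := by
      filter_upwards [Metric.ball_mem_nhds (0 : V) hε] with v hv
      have hv' : ‖v‖ < ε := by simpa using hv
      have := Convex.is_const_of_fderivWithin_eq_zero (𝕜 := ℝ) (f := θ) (convex_ball (0 : ℝ) ε)
        (fun x _ => (hθ x).differentiableAt.differentiableWithinAt) (fun x hx => by
          have hx' : η x = 0 := hball (by simpa using hx)
          rw [fderivWithin_of_isOpen Metric.isOpen_ball hx]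
          ext
          simp [(hθ x).deriv, hx'])
        (x := ‖v‖) (y := 0) (by simpa using hv') (by simpa using hε)
      exact this
    simp only [norm_zero, hη0, zero_div, zero_smul]
    exact (hasFDerivAt_const (θ 0) (0 : V)).congr_of_eventuallyEq hconst
  · have h1 : HasFDerivAt (fun v : V => ‖v‖) (‖v‖⁻¹ • innerSL ℝ v) v := by
      have h2 := (hasStrictFDerivAt_norm_sq v).hasFDerivAt.sqrt (by simpa using hv)
      have e : (fun v : V => Real.sqrt (‖v‖ ^ 2)) = fun v => ‖v‖ := by
        ext v; exact Real.sqrt_sq (norm_nonneg v)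
      rw [e, Real.sqrt_sq (norm_nonneg v)] at h2
      have e2 : ‖v‖⁻¹ • innerSL ℝ v = (1 / (2 * ‖v‖)) • 2 • innerSL ℝ v := by
        ext w
        simp
        ring
      rw [e2]
      exact h2
    have h3 := (hθ ‖v‖).comp_hasFDerivAt v h1
    rw [div_eq_mul_inv, ← smul_smul]
    exact h3

lemma fderiv_comp_norm_single {θ η : ℝ → ℝ} (hθ : ∀ t, HasDerivAt θ (η t) t)
    (h0 : ∀ᶠ t in 𝓝 (0 : ℝ), η t = 0) (v : V) (i : Fin 3) :
    fderiv ℝ (fun v : V => θ ‖v‖) v (EuclideanSpace.single i 1) = η ‖v‖ * (v i / ‖v‖) := by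
  rw [(hasFDerivAt_comp_norm hθ h0 v).fderiv]
  simp [EuclideanSpace.inner_single_right]
  ring

lemma continuous_fderiv_single {ψ : V → ℝ} (hψ : ContDiff ℝ ((⊤ : ℕ∞) : WithTop ℕ∞) ψ) (i : Fin 3) :
    Continuous fun v => fderiv ℝ ψ v (EuclideanSpace.single i 1) :=
  (hψ.continuous_fderiv (by simp)).clm_apply continuous_const

lemma hasCompactSupport_fderiv_single {ψ : V → ℝ} (hc : HasCompactSupport ψ) (i : Fin 3) :
    HasCompactSupport fun v => fderiv ℝ ψ v (EuclideanSpace.single i 1) :=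
  (hc.fderiv (𝕜 := ℝ)).comp_left (g := fun L : V →L[ℝ] ℝ => L (EuclideanSpace.single i 1)) rfl

lemma integral_fderiv_single {ψ : V → ℝ} (hψ : ContDiff ℝ ((⊤ : ℕ∞) : WithTop ℕ∞) ψ)
    (hc : HasCompactSupport ψ) (i : Fin 3) :
    ∫ v, fderiv ℝ ψ v (EuclideanSpace.single i 1) = 0 := by
  have h1 := (continuous_fderiv_single hψ i).integrable_of_hasCompactSupport (μ := volume)
    (hasCompactSupport_fderiv_single hc i)
  have h2 := hψ.continuous.integrable_of_hasCompactSupport (μ := volume) hc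
  have h := integral_mul_fderiv_eq_neg_fderiv_mul_of_integrable (μ := (volume : Measure V))
    (f := fun _ => (1 : ℝ)) (g := ψ) (v := EuclideanSpace.single i 1) (by simp)
    (by simpa using h1) (by simpa using h2)
    (fun x _ => by simp) (fun x _ => hψ.differentiable (by simp) x)
  simpa using h

lemma eventually_zero_of_tsupport_subset {η : ℝ → ℝ} (hs : tsupport η ⊆ Set.Ioi 0) :
    ∀ᶠ t in 𝓝 (0 : ℝ), η t = 0 := by
  have : (tsupport η)ᶜ ∈ 𝓝 (0 : ℝ) :=
    (isClosed_tsupport η).isOpen_compl.mem_nhds fun h => lt_irrefl (0 : ℝ) (hs h)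
  filter_upwards [this] with t ht
  exact image_eq_zero_of_notMem_tsupport ht

/-- The divergence theorem on almost every ball. -/
lemma integral_ball_fderiv {ψ : V → ℝ} (hψ : ContDiff ℝ ((⊤ : ℕ∞) : WithTop ℕ∞) ψ)
    (hc : HasCompactSupport ψ) (i : Fin 3) :
    ∀ᵐ t : ℝ, t ∈ Set.Ioi 0 →
      (∫ v, (if ‖v‖ < t then 1 else 0) * fderiv ℝ ψ v (EuclideanSpace.single i 1))
        - t ^ 2 * flux ψ i t = 0 := by
  set dψ := fun v => fderiv ℝ ψ v (EuclideanSpace.single i 1) with hdψ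
  have hdc : Continuous dψ := continuous_fderiv_single hψ i
  have hdi : Integrable dψ := hdc.integrable_of_hasCompactSupport (hasCompactSupport_fderiv_single hc i)
  set D : ℝ → ℝ := fun t => ∫ v, (if ‖v‖ < t then 1 else 0) * dψ v with hD
  have hset : MeasurableSet {q : ℝ × V | ‖q.2‖ < q.1} := measurableSet_lt (by fun_prop) (by fun_prop)
  have hDm : StronglyMeasurable D := by
    refine StronglyMeasurable.integral_prod_right' (f := fun q : ℝ × V =>
      (if ‖q.2‖ < q.1 then 1 else 0) * dψ q.2) ?_
    refine Measurable.stronglyMeasurable ?_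
    refine Measurable.mul (Measurable.ite hset measurable_const measurable_const) ?_
    exact hdc.measurable.comp measurable_snd
  have hDb : ∀ t, ‖D t‖ ≤ ∫ v, ‖dψ v‖ := by
    intro t
    refine norm_integral_le_of_norm_le hdi.norm (ae_of_all _ fun v => ?_)
    split_ifs <;> simp
  have hDl : LocallyIntegrable D :=
    (locallyIntegrable_const (∫ v, ‖dψ v‖)).mono hDm.aestronglyMeasurable
      (ae_of_all _ fun t => (hDb t).trans (le_abs_self _))
  have hBl : Continuous fun t => t ^ 2 * flux ψ i t :=
    (continuous_pow 2).mul (continuous_flux hψ.continuous i)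
  -- The identity is tested against η(t) dt. Fubini turns the ball integrals into -∫ θ(|v|) ∂_i ψ
  -- with θ' = η, integration by parts on the whole space moves the derivative onto θ(|v|), and
  -- polar coordinates recover the flux.
  refine isOpen_Ioi.ae_eq_zero_of_integral_contDiff_smul_eq_zero
    ((hDl.sub hBl.locallyIntegrable).locallyIntegrableOn _) fun η hη hηc hηs => ?_
  have h0 := eventually_zero_of_tsupport_subset hηs
  have hηi : Integrable η := hη.continuous.integrable_of_hasCompactSupport hηc
  have hηpos : ∀ t, t ≤ 0 → η t = 0 := fun t ht =>
    image_eq_zero_of_notMem_tsupport fun h => absurd (hηs h) (not_lt.2 ht)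
  -- The additive constant makes θ(t) = -∫_t^∞ η for t ≥ 0.
  set θ : ℝ → ℝ := fun t => (∫ s in (0 : ℝ)..t, η s) - ∫ s, η s with hθdef
  have hθ : ∀ t, HasDerivAt θ (η t) t := fun t =>
    (hη.continuous.integral_hasStrictDerivAt 0 t).hasDerivAt.sub_const _
  have hθ2 : ∀ t, 0 ≤ t → ∫ s, (if t < s then 1 else 0) * η s = -θ t := by
    intro t ht
    have e1 : ∫ s, (if t < s then 1 else 0) * η s = ∫ s in Set.Ioi t, η s := by
      rw [← integral_indicator measurableSet_Ioi]
      congr 1; ext s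
      by_cases h : t < s <;> simp [h]
    have e2 : ∫ s, η s = ∫ s in Set.Ioi 0, η s := by
      rw [← integral_indicator measurableSet_Ioi]
      congr 1; ext s
      by_cases h : 0 < s
      · simp [h]
      · simp [h, hηpos s (not_lt.1 h)]
    rw [e1, hθdef]
    simp only
    rw [e2, intervalIntegral.integral_of_le ht, ← Set.Ioc_union_Ioi_eq_Ioi ht,
      setIntegral_union (Set.Ioc_disjoint_Ioi le_rfl) measurableSet_Ioi hηi.integrableOn hηi.integrableOn]
    ring
  have hB := hη.continuous.mul hBl
  have iB : Integrable fun t => η t * (t ^ 2 * flux ψ i t) :=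
    hB.integrable_of_hasCompactSupport hηc.mul_right
  have iD : Integrable fun t => η t * D t := by
    have := hDl.integrable_smul_left_of_hasCompactSupport hη.continuous hηc
    simpa using this
  have eD : ∫ t, η t * D t = -∫ v : V, θ ‖v‖ * dψ v := by
    have e1 : ∀ t, η t * D t = ∫ v, (if ‖v‖ < t then 1 else 0) * (η t * dψ v) := fun t => by
      rw [hD]; simp only
      rw [← integral_const_mul]; congr 1; ext v; ring
    simp_rw [e1]
    rw [integral_integral_swap, ← integral_neg]
    · congr 1; ext v
      rw [← neg_mul, ← hθ2 ‖v‖ (norm_nonneg v), ← integral_mul_const]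
      congr 1; ext t; ring
    · have hp := hηi.mul_prod hdi
      refine hp.mono ?_ (ae_of_all _ fun q => ?_)
      · exact ((Measurable.ite hset measurable_const measurable_const).aestronglyMeasurable).mul
          hp.aestronglyMeasurable
      · simp only [Function.uncurry]
        split_ifs
        · simp
        · simp only [zero_mul, norm_zero]
          exact norm_nonneg _
  have hηM : ∃ M, ∀ t, ‖η t‖ ≤ M := hη.continuous.bounded_above_of_compact_support hηc
  obtain ⟨M, hM⟩ := hηM
  have hcθ : Continuous θ := continuous_iff_continuousAt.2 fun t => (hθ t).continuousAt
  have iflux : Integrable fun v : V => η ‖v‖ * (v i / ‖v‖) * ψ v := by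
    have hψi : Integrable ψ := hψ.continuous.integrable_of_hasCompactSupport hc
    refine hψi.bdd_mul (c := M) ?_ (ae_of_all _ fun v => ?_)
    · refine Measurable.aestronglyMeasurable ?_
      have := hη.continuous.measurable
      fun_prop
    · rw [norm_mul]
      calc _ ≤ M * 1 := by
            refine mul_le_mul (hM _) ?_ (norm_nonneg _) ((norm_nonneg _).trans (hM 0))
            rw [norm_div, norm_norm]
            exact div_le_one_of_le₀ (PiLp.norm_apply_le v i) (norm_nonneg _)
        _ = M := mul_one M
  have eP : ∫ v : V, θ ‖v‖ * dψ v = -∫ v : V, η ‖v‖ * (v i / ‖v‖) * ψ v := by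
    have h := integral_mul_fderiv_eq_neg_fderiv_mul_of_integrable (μ := (volume : Measure V))
      (f := fun v : V => θ ‖v‖) (g := ψ) (v := EuclideanSpace.single i 1)
      (by simpa only [fderiv_comp_norm_single hθ h0] using iflux)
      (((hcθ.comp continuous_norm).mul hdc).integrable_of_hasCompactSupport
        (hasCompactSupport_fderiv_single hc i).mul_left)
      (((hcθ.comp continuous_norm).mul hψ.continuous).integrable_of_hasCompactSupport hc.mul_left)
      (fun x _ => (hasFDerivAt_comp_norm hθ h0 x).differentiableAt)
      (fun x _ => hψ.differentiable (by simp) x)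
    simpa only [fderiv_comp_norm_single hθ h0] using h
  have eB : ∫ v : V, η ‖v‖ * (v i / ‖v‖) * ψ v = ∫ t, η t * (t ^ 2 * flux ψ i t) := by
    rw [integral_polar iflux, ← integral_indicator measurableSet_Ioi]
    congr 1; ext r
    by_cases hr : 0 < r
    · rw [Set.indicator_of_mem (Set.mem_Ioi.2 hr), flux, ← mul_assoc, mul_comm (η r), mul_assoc,
        ← integral_const_mul (η r)]
      congr 2; ext ω
      rw [norm_polar (ω, r) hr]
      simp
      field_simp
    · rw [Set.indicator_of_notMem (by simpa using hr), hηpos r (not_lt.1 hr), zero_mul]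
  change ∫ t, η t * (D t - t ^ 2 * flux ψ i t) = 0
  simp_rw [mul_sub]
  rw [integral_sub iD iB, eD, eP, eB]
  ring

/-! ### Radial profiles and their weak gradients -/

/-- `u` is locally absolutely continuous on `(0, R)` with derivative `r H(r)`, where `r³ H(r)` is
integrable near `0`; these are the radial `W^{1,1}_loc` functions on the ball of radius `R`. -/
structure IsProfile (R : ℝ≥0∞) (u H : ℝ → ℝ) : Prop where
  measurable : Measurable H
  integrable : ∀ b, b ∈ radii R → IntegrableOn (fun s => s ^ 3 * H s) (Set.Ioc 0 b)
  ftc : ∀ r s, 0 < r → r ≤ s → s ∈ radii R → u s - u r = ∫ t in r..s, t * H t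

lemma radii_of_le {R : ℝ≥0∞} {r s : ℝ} (hs : s ∈ radii R) (hr : 0 < r) (h : r ≤ s) : r ∈ radii R :=
  ⟨hr, (ENNReal.ofReal_le_ofReal h).trans_lt hs.2⟩

lemma exists_mem_radii {R : ℝ≥0∞} (hR : 0 < R) : ∃ b, b ∈ radii R := by
  obtain ⟨q, -, h0, h1⟩ := ENNReal.lt_iff_exists_real_btwn.1 hR
  exact ⟨q, by simpa using h0, h1⟩

lemma exists_radius {R : ℝ≥0∞} (hR : 0 < R) {K : Set V} (hK : IsCompact K) (hs : K ⊆ oball R) :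
    ∃ b ∈ radii R, ∀ v ∈ K, ‖v‖ ≤ b := by
  obtain ⟨b0, hb0⟩ := exists_mem_radii hR
  rcases K.eq_empty_or_nonempty with h | h
  · exact ⟨b0, hb0, by simp [h]⟩
  · obtain ⟨v0, hv0, hmax⟩ := hK.exists_isMaxOn h continuous_norm.continuousOn
    refine ⟨max ‖v0‖ b0, ⟨lt_max_of_lt_right hb0.1, ?_⟩, fun v hv => (hmax hv).trans (le_max_left _ _)⟩
    rcases max_choice ‖v0‖ b0 with e | e
    · rw [e]; exact mem_oball_iff.1 (hs hv0)
    · rw [e]; exact hb0.2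

lemma IsProfile.integrableOn_norm {R : ℝ≥0∞} {u H : ℝ → ℝ} (h : IsProfile R u H) {b : ℝ}
    (hb : b ∈ radii R) : IntegrableOn (fun v : V => ‖v‖ * H ‖v‖) (Metric.closedBall 0 b) := by
  have h1 : Integrable (fun v : V => (Set.Ioc 0 b).indicator (fun r => r * H r) ‖v‖) := by
    rw [integrable_fun_norm_addHaar (μ := (volume : Measure V))
      (f := fun r => (Set.Ioc 0 b).indicator (fun r => r * H r) r)]
    have h2 := (h.integrable b hb).integrable_indicator measurableSet_Ioc
    refine h2.integrableOn.congr_fun (fun r hr => ?_) measurableSet_Ioi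
    by_cases hr' : r ∈ Set.Ioc 0 b
    · simp [Set.indicator_of_mem hr']; ring
    · simp [Set.indicator_of_notMem hr']
  refine h1.integrableOn.congr_fun (fun v hv => ?_) Metric.isClosed_closedBall.measurableSet
  have hv' : ‖v‖ ≤ b := by simpa using hv
  simp only
  by_cases h0 : 0 < ‖v‖
  · have : ‖v‖ ∈ Set.Ioc 0 b := ⟨h0, hv'⟩
    rw [Set.indicator_of_mem this]
  · have : ‖v‖ ∉ Set.Ioc 0 b := fun h => h0 h.1
    have h00 : ‖v‖ = 0 := le_antisymm (not_lt.1 h0) (norm_nonneg v)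
    rw [Set.indicator_of_notMem this, h00, zero_mul]

lemma IsProfile.locallyIntegrableOn_grad {R : ℝ≥0∞} (hR : 0 < R) {u H : ℝ → ℝ}
    (h : IsProfile R u H) : LocallyIntegrableOn (fun v : V => H ‖v‖ • v) (oball R) := by
  rw [locallyIntegrableOn_iff (isOpen_oball R).isLocallyClosed]
  intro K hK hKc
  obtain ⟨b, hb, hbK⟩ := exists_radius hR hKc hK
  have h1 : IntegrableOn (fun v : V => ‖v‖ * H ‖v‖) K :=
    (h.integrableOn_norm hb).mono_set fun v hv => by simpa using hbK v hv
  have := h.measurable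
  refine Integrable.mono h1 (Measurable.aestronglyMeasurable (by fun_prop)) (ae_of_all _ fun v => ?_)
  rw [norm_smul, norm_mul, norm_norm, mul_comm]

/-- The truncated kernel of `u(b) - u(|v|) = ∫_{|v|}^b t H(t) dt`. -/
def tailKernel (b : ℝ) (H : ℝ → ℝ) (q : V × ℝ) : ℝ :=
  (Set.Ioc 0 b).indicator (fun t => (if ‖q.1‖ < t then 1 else 0) * (t * H t)) q.2

/-- For fixed t the slice is a ball of volume t³ |B₁|, so the iterated integral of the absolute
value is that of t · t³ |H(t)| on (0, b]. -/
lemma IsProfile.integrable_tailKernel {R : ℝ≥0∞} {u H : ℝ → ℝ} (h : IsProfile R u H) {b : ℝ}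
    (hb : b ∈ radii R) : Integrable (tailKernel b H) (volume.prod volume) := by
  have hm := h.measurable
  have hset : MeasurableSet {q : V × ℝ | ‖q.1‖ < q.2} := measurableSet_lt (by fun_prop) (by fun_prop)
  have hmeas : Measurable (tailKernel b H) := by
    have : tailKernel b H = (Set.univ ×ˢ Set.Ioc 0 b).indicator
        (fun q : V × ℝ => (if ‖q.1‖ < q.2 then 1 else 0) * (q.2 * H q.2)) := by
      ext q
      by_cases hq : q.2 ∈ Set.Ioc 0 b
      · have hq' : q ∈ (Set.univ : Set V) ×ˢ Set.Ioc 0 b := ⟨trivial, hq⟩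
        rw [tailKernel, Set.indicator_of_mem hq, Set.indicator_of_mem hq']
      · rw [tailKernel, Set.indicator_of_notMem hq, Set.indicator_of_notMem (fun h => hq h.2)]
    rw [this]
    refine Measurable.indicator (Measurable.mul ?_ (by fun_prop))
      (MeasurableSet.univ.prod measurableSet_Ioc)
    exact Measurable.ite hset measurable_const measurable_const
  have hk : ∀ (v : V) (t : ℝ), tailKernel b H (v, t)
      = (Metric.ball (0 : V) t).indicator (fun _ => (Set.Ioc 0 b).indicator (fun t => t * H t) t) v := by
    intro v t
    by_cases ht : t ∈ Set.Ioc 0 b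
    · by_cases hv : ‖v‖ < t
      · have : v ∈ Metric.ball (0 : V) t := by simpa using hv
        rw [Set.indicator_of_mem this, tailKernel, Set.indicator_of_mem ht, Set.indicator_of_mem ht]
        simp [hv]
      · have : v ∉ Metric.ball (0 : V) t := by simpa using hv
        rw [Set.indicator_of_notMem this, tailKernel, Set.indicator_of_mem ht]
        simp [hv]
    · rw [tailKernel, Set.indicator_of_notMem ht, Set.indicator_of_notMem ht]; simp
  rw [integrable_prod_iff' hmeas.aestronglyMeasurable]
  constructor
  · refine ae_of_all _ fun t => ?_
    simp_rw [hk]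
    exact (integrableOn_const (μ := (volume : Measure V)) (s := Metric.ball (0 : V) t)
      (by finiteness)).integrable_indicator
      Metric.isOpen_ball.measurableSet
  · have hvol : ∀ t, 0 < t → (volume : Measure V).real (Metric.ball (0 : V) t)
        = t ^ 3 * (volume : Measure V).real (Metric.ball (0 : V) 1) := by
      intro t ht
      rw [Measure.real, Measure.addHaar_ball_of_pos _ _ ht, ENNReal.toReal_mul,
        ENNReal.toReal_ofReal (by positivity)]
      simp [Measure.real]
    have h2 := (h.integrable b hb).integrable_indicator measurableSet_Ioc
    have h3 : Integrable fun t => (Set.Ioc 0 b).indicator (fun t => t) t *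
        (Set.Ioc 0 b).indicator (fun s => s ^ 3 * H s) t :=
      h2.bdd_mul (c := b) (Measurable.aestronglyMeasurable (measurable_id.indicator measurableSet_Ioc))
        (ae_of_all _ fun t => by
          by_cases ht : t ∈ Set.Ioc 0 b
          · rw [Set.indicator_of_mem ht, Real.norm_of_nonneg ht.1.le]; exact ht.2
          · rw [Set.indicator_of_notMem ht, norm_zero]; exact hb.1.le)
    refine (h3.norm.mul_const ((volume : Measure V).real (Metric.ball (0 : V) 1))).congr
      (ae_of_all _ fun t => ?_)
    simp_rw [hk, norm_indicator_eq_indicator_norm]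
    rw [integral_indicator Metric.isOpen_ball.measurableSet, setIntegral_const]
    by_cases ht : t ∈ Set.Ioc 0 b
    · simp only [Set.indicator_of_mem ht, hvol t ht.1, smul_eq_mul, norm_mul, norm_pow,
        Real.norm_of_nonneg ht.1.le]
      ring
    · simp only [Set.indicator_of_notMem ht]; simp

lemma IsProfile.eq_sub_integral {R : ℝ≥0∞} {u H : ℝ → ℝ} (h : IsProfile R u H) {b : ℝ}
    (hb : b ∈ radii R) {v : V} (hv0 : v ≠ 0) (hv : ‖v‖ ≤ b) :
    u ‖v‖ = u b - ∫ t, tailKernel b H (v, t) := by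
  have h1 := h.ftc ‖v‖ b (norm_pos_iff.2 hv0) hv hb
  have h2 : ∫ t, tailKernel b H (v, t) = ∫ t in ‖v‖..b, t * H t := by
    rw [intervalIntegral.integral_of_le hv, ← integral_indicator measurableSet_Ioc]
    congr 1; ext t
    by_cases ht : t ∈ Set.Ioc ‖v‖ b
    · have : t ∈ Set.Ioc 0 b := ⟨(norm_nonneg v).trans_lt ht.1, ht.2⟩
      rw [Set.indicator_of_mem ht, tailKernel, Set.indicator_of_mem this]
      simp [ht.1]
    · rw [Set.indicator_of_notMem ht, tailKernel]
      by_cases h' : t ∈ Set.Ioc 0 b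
      · rw [Set.indicator_of_mem h']
        have : ¬ ‖v‖ < t := fun hh => ht ⟨hh, h'.2⟩
        simp [this]
      · rw [Set.indicator_of_notMem h']
  linarith

/-- The formula u(|v|) = u(b) - ∫ 1_{|v| < t ≤ b} t H(t) dt is a superposition of indicators of
balls. Each ball contributes its flux by the divergence theorem, and polar coordinates reassemble
the fluxes into ∫ H(|v|) v_i ψ. In particular the origin carries no singular part. -/
lemma IsProfile.hasWeakGradOn {R : ℝ≥0∞} (hR : 0 < R) {u H : ℝ → ℝ} (h : IsProfile R u H) :
    HasWeakGradOn (oball R) (fun v => u ‖v‖) (fun v => H ‖v‖ • v) := by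
  have hne : ∀ᵐ v : V, v ≠ 0 := by simp [ae_iff]
  refine ⟨?_, h.locallyIntegrableOn_grad hR, ?_⟩
  · rw [locallyIntegrableOn_iff (isOpen_oball R).isLocallyClosed]
    intro K hK hKc
    obtain ⟨b, hb, hbK⟩ := exists_radius hR hKc hK
    have h1 : IntegrableOn (fun v : V => u b - ∫ t, tailKernel b H (v, t)) K :=
      (integrableOn_const hKc.measure_lt_top.ne).sub (h.integrable_tailKernel hb).integral_prod_left.integrableOn
    refine h1.congr ?_
    rw [EventuallyEq, ae_restrict_iff' hKc.measurableSet]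
    filter_upwards [hne] with v hv hvK
    exact (h.eq_sub_integral hb hv (hbK v hvK)).symm
  · intro ψ hψ hc hs i
    obtain ⟨b, hb, hbK⟩ := exists_radius hR hc hs
    set dψ := fun v => fderiv ℝ ψ v (EuclideanSpace.single i 1) with hdψ
    have hdc : Continuous dψ := continuous_fderiv_single hψ i
    have hdcs : HasCompactSupport dψ := hasCompactSupport_fderiv_single hc i
    have hdi : Integrable dψ := hdc.integrable_of_hasCompactSupport hdcs
    obtain ⟨M, hM⟩ := hdc.bounded_above_of_compact_support hdcs
    have hψ0 : ∀ v, b < ‖v‖ → ψ v = 0 := fun v hv =>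
      image_eq_zero_of_notMem_tsupport fun h => absurd (hbK v h) (not_le.2 hv)
    have hdψ0 : ∀ v, b < ‖v‖ → dψ v = 0 := fun v hv => by
      simp only [hdψ]
      rw [fderiv_of_notMem_tsupport ℝ (fun h => absurd (hbK v h) (not_le.2 hv))]; rfl
    have hk := h.integrable_tailKernel hb
    have hkd : Integrable (fun q : V × ℝ => dψ q.1 * tailKernel b H q) (volume.prod volume) :=
      hk.bdd_mul (c := M) (hdc.comp continuous_fst).aestronglyMeasurable (ae_of_all _ fun q => hM _)
    have e1 : ∫ v, u ‖v‖ * dψ v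
        = ∫ v, (u b * dψ v - ∫ t, dψ v * tailKernel b H (v, t)) := by
      apply integral_congr_ae
      filter_upwards [hne] with v hv
      by_cases hvb : ‖v‖ ≤ b
      · rw [h.eq_sub_integral hb hv hvb, integral_const_mul]; ring
      · simp [hdψ0 v (not_le.1 hvb)]
    have e2 : ∫ v, ∫ t, dψ v * tailKernel b H (v, t)
        = ∫ t, (Set.Ioc 0 b).indicator (fun t => t * H t * (t ^ 2 * flux ψ i t)) t := by
      rw [integral_integral_swap hkd]
      apply integral_congr_ae
      filter_upwards [integral_ball_fderiv hψ hc i] with t ht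
      by_cases htb : t ∈ Set.Ioc 0 b
      · rw [Set.indicator_of_mem htb, ← sub_eq_zero.1 (ht htb.1), ← integral_const_mul]
        congr 1; ext v
        rw [tailKernel, Set.indicator_of_mem htb]
        simp only
        ring
      · simp [tailKernel, Set.indicator_of_notMem htb]
    have hgi : Integrable fun v => (H ‖v‖ • v) i * ψ v :=
      integrable_mul_of_locallyIntegrableOn
        (LocallyIntegrableOn.coord (h.locallyIntegrableOn_grad hR) i) hψ.continuous hc hs
    have e3 : ∫ v, (H ‖v‖ • v) i * ψ v
        = ∫ t, (Set.Ioc 0 b).indicator (fun t => t * H t * (t ^ 2 * flux ψ i t)) t := by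
      rw [integral_polar hgi, ← integral_indicator measurableSet_Ioi]
      congr 1; ext r
      by_cases hr : 0 < r
      · rw [Set.indicator_of_mem (Set.mem_Ioi.2 hr)]
        have hn : ∀ ω : Metric.sphere (0 : V) 1, ‖r • (ω : V)‖ = r := fun ω => norm_polar (ω, r) hr
        by_cases hrb : r ≤ b
        · have hr' : r ∈ Set.Ioc 0 b := ⟨hr, hrb⟩
          rw [Set.indicator_of_mem hr', flux, ← mul_assoc, mul_comm _ (r ^ 2), mul_assoc,
            ← integral_const_mul (r * H r)]
          congr 2; ext ω
          rw [hn]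
          simp
          ring
        · rw [Set.indicator_of_notMem (fun h => hrb h.2)]
          have : ∀ ω : Metric.sphere (0 : V) 1, ψ (r • (ω : V)) = 0 := fun ω =>
            hψ0 _ (by rw [hn]; exact not_le.1 hrb)
          simp [this]
      · rw [Set.indicator_of_notMem (by simpa using hr), Set.indicator_of_notMem (fun h => hr h.1)]
    change ∫ v, u ‖v‖ * dψ v = _
    rw [e1, integral_sub (hdi.const_mul _) hkd.integral_prod_left, e2, e3, integral_const_mul,
      integral_fderiv_single hψ hc i]
    ring

/-! ### From radial weak derivatives to profiles -/

lemma exists_Icc_radii {R : ℝ≥0∞} {K : Set ℝ} (hK : IsCompact K) (hs : K ⊆ radii R) {a : ℝ}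
    (ha : a ∈ radii R) : ∃ α ∈ radii R, ∃ β ∈ radii R, α ≤ a ∧ a ≤ β ∧ K ⊆ Set.Icc α β := by
  have hc : IsCompact (insert a K) := hK.insert a
  have hsub : insert a K ⊆ radii R := Set.insert_subset ha hs
  have hne : (insert a K).Nonempty := Set.insert_nonempty _ _
  obtain ⟨α, hα, hα'⟩ := hc.exists_isLeast hne
  obtain ⟨β, hβ, hβ'⟩ := hc.exists_isGreatest hne
  exact ⟨α, hsub hα, β, hsub hβ, hα' (Set.mem_insert _ _), hβ' (Set.mem_insert _ _),
    fun x hx => ⟨hα' (Set.mem_insert_of_mem _ hx), hβ' (Set.mem_insert_of_mem _ hx)⟩⟩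

lemma Icc_subset_radii {R : ℝ≥0∞} {α β : ℝ} (hα : α ∈ radii R) (hβ : β ∈ radii R) :
    Set.Icc α β ⊆ radii R := fun _ hx => radii_of_le hβ (hα.1.trans_le hx.1) hx.2

/-- The lemma of du Bois-Reymond on the interval `(0, R)`. -/
lemma ae_eq_const_of_integral_deriv_eq_zero {R : ℝ≥0∞} {a : ℝ} (ha : a ∈ radii R) {W : ℝ → ℝ}
    (hW : LocallyIntegrableOn W (radii R))
    (h : ∀ θ : ℝ → ℝ, ContDiff ℝ ((⊤ : ℕ∞) : WithTop ℕ∞) θ → HasCompactSupport θ →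
      tsupport θ ⊆ radii R → ∫ t, W t * deriv θ t = 0) :
    ∃ c, ∀ᵐ r, r ∈ radii R → W r = c := by
  obtain ⟨ε, hε, hball⟩ := Metric.isOpen_iff.1 (isOpen_radii R) a ha
  let bump : ContDiffBump a := ⟨ε / 4, ε / 2, by positivity, by linarith⟩
  set η₀ := bump.normed volume with hη₀
  have hη₀s : ContDiff ℝ ((⊤ : ℕ∞) : WithTop ℕ∞) η₀ := bump.contDiff_normed
  have hη₀c : HasCompactSupport η₀ := bump.hasCompactSupport_normed
  have hη₀t : tsupport η₀ ⊆ radii R := by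
    rw [hη₀, bump.tsupport_normed_eq]
    exact (Metric.closedBall_subset_ball (show ε / 2 < ε by linarith)).trans hball
  have hη₀1 : ∫ t, η₀ t = 1 := bump.integral_normed
  have hmulint : ∀ φ : ℝ → ℝ, Continuous φ → HasCompactSupport φ → tsupport φ ⊆ radii R →
      Integrable fun t => W t * φ t := by
    intro φ hφ hφc hφs
    have h1 : IntegrableOn (fun t => W t * φ t) (tsupport φ) :=
      (hW.integrableOn_compact_subset hφs hφc).mul_continuousOn hφ.continuousOn hφc
    refine (integrableOn_iff_integrable_of_support_subset fun v hv => ?_).1 h1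
    apply subset_tsupport
    intro h
    exact hv (by simp [h])
  set c := ∫ t, W t * η₀ t with hc
  refine ⟨c, ?_⟩
  suffices hs : ∀ᵐ r, r ∈ radii R → W r - c = 0 by
    filter_upwards [hs] with r hr hrR using sub_eq_zero.1 (hr hrR)
  refine (isOpen_radii R).ae_eq_zero_of_integral_contDiff_smul_eq_zero
    (hW.sub ((locallyIntegrable_const c).locallyIntegrableOn _)) fun η hη hηc hηt => ?_
  -- The function ξ = η - m η₀ has mean zero, so its primitive θ is again a test function; the
  -- hypothesis for θ' = ξ says ∫ W η = m c.
  set m := ∫ t, η t with hm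
  set ξ : ℝ → ℝ := fun t => η t - m * η₀ t with hξ
  have hξs : ContDiff ℝ ((⊤ : ℕ∞) : WithTop ℕ∞) ξ := hη.sub (contDiff_const.mul hη₀s)
  have hηi : Integrable η := hη.continuous.integrable_of_hasCompactSupport hηc
  have hη₀i : Integrable η₀ := hη₀s.continuous.integrable_of_hasCompactSupport hη₀c
  have hξi : Integrable ξ := hηi.sub (hη₀i.const_mul m)
  have hξ0 : ∫ t, ξ t = 0 := by
    rw [hξ, integral_sub hηi (hη₀i.const_mul m), integral_const_mul, hη₀1]; ring
  obtain ⟨α, hα, β, hβ, hαa, haβ, hK⟩ := exists_Icc_radii (hηc.isCompact.union hη₀c.isCompact)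
    (Set.union_subset hηt hη₀t) ha
  have hξz : ∀ t, t ∉ Set.Icc α β → ξ t = 0 := by
    intro t ht
    have h1 : η t = 0 := image_eq_zero_of_notMem_tsupport fun h => ht (hK (Or.inl h))
    have h2 : η₀ t = 0 := image_eq_zero_of_notMem_tsupport fun h => ht (hK (Or.inr h))
    simp [hξ, h1, h2]
  set θ : ℝ → ℝ := fun t => ∫ s in α..t, ξ s with hθ
  have hθd : ∀ t, HasDerivAt θ (ξ t) t := fun t =>
    (hξs.continuous.integral_hasStrictDerivAt α t).hasDerivAt
  have hθd' : deriv θ = ξ := funext fun t => (hθd t).deriv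
  have hθs : ContDiff ℝ ((⊤ : ℕ∞) : WithTop ℕ∞) θ := by
    rw [contDiff_infty_iff_deriv, hθd']
    exact ⟨fun t => (hθd t).differentiableAt, hξs⟩
  have hθz : ∀ t, t ∉ Set.Icc α β → θ t = 0 := by
    intro t ht
    by_cases h1 : t < α
    · rw [hθ]
      simp only
      rw [intervalIntegral.integral_symm, intervalIntegral.integral_of_le h1.le,
        setIntegral_congr_ae (g := fun _ => (0 : ℝ)) measurableSet_Ioc]
      · simp
      · filter_upwards [compl_mem_ae_iff.2 (measure_singleton (μ := (volume : Measure ℝ)) α)]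
          with s hs hst
        exact hξz s fun h => hs (le_antisymm hst.2 h.1)
    · have h2 : β < t := by
        by_contra h2
        exact ht ⟨not_lt.1 h1, not_lt.1 h2⟩
      rw [hθ]
      simp only
      rw [intervalIntegral.integral_of_le (not_lt.1 h1), ← integral_Icc_eq_integral_Ioc,
        setIntegral_eq_integral_of_forall_compl_eq_zero, hξ0]
      intro s hs
      exact hξz s fun h => hs ⟨h.1, h.2.trans h2.le⟩
  have hθt : tsupport θ ⊆ Set.Icc α β := by
    refine closure_minimal (fun t ht => ?_) isClosed_Icc
    by_contra h'
    exact ht (hθz t h')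
  have hθc : HasCompactSupport θ := isCompact_Icc.of_isClosed_subset (isClosed_tsupport _) hθt
  have key := h θ hθs hθc (hθt.trans (Icc_subset_radii hα hβ))
  rw [hθd'] at key
  have i1 := hmulint η hη.continuous hηc hηt
  have i2 := hmulint η₀ hη₀s.continuous hη₀c hη₀t
  have e1 : ∫ t, W t * ξ t = (∫ t, W t * η t) - m * c := by
    rw [hc, ← integral_const_mul, ← integral_sub i1 (i2.const_mul m)]
    congr 1; ext t; simp only [hξ]; ring
  have e2 : ∫ t, η t • (W t - c) = (∫ t, W t * η t) - m * c := by
    rw [hm, ← integral_mul_const, ← integral_sub i1 (hηi.mul_const c)]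
    congr 1; ext t; simp only [smul_eq_mul]; ring
  change ∫ t, η t • (W t - c) = 0
  rw [e2, ← e1, key]

/-- Integration by parts against a primitive of a locally integrable function. -/
lemma integral_primitive_mul_deriv {R : ℝ≥0∞} {a : ℝ} (ha : a ∈ radii R) {w : ℝ → ℝ}
    (hw : LocallyIntegrableOn w (radii R)) {θ : ℝ → ℝ}
    (hθ : ContDiff ℝ ((⊤ : ℕ∞) : WithTop ℕ∞) θ) (hθc : HasCompactSupport θ)
    (hθt : tsupport θ ⊆ radii R) :
    ∫ t, (∫ s in a..t, w s) * deriv θ t = -∫ t, w t * θ t := by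
  obtain ⟨α, hα, β, hβ, hαa, haβ, hK⟩ := exists_Icc_radii hθc.isCompact hθt ha
  -- enlarge the interval so that `θ` vanishes at its end points
  obtain ⟨α', hα'0, hα'⟩ : ∃ α', 0 < α' ∧ α' < α := ⟨α / 2, by linarith [hα.1], by linarith [hα.1]⟩
  obtain ⟨q, -, hq0, hq1⟩ := ENNReal.lt_iff_exists_real_btwn.1 hβ.2
  have hβq : β < q := (ENNReal.ofReal_lt_ofReal_iff_of_nonneg hβ.1.le).1 hq0
  have hα'R : α' ∈ radii R := radii_of_le hα hα'0 hα'.le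
  have hqR : q ∈ radii R := ⟨hβ.1.trans hβq, hq1⟩
  have hle : α' ≤ q := by linarith
  have hwi : IntervalIntegrable w volume α' q := by
    rw [intervalIntegrable_iff_integrableOn_Icc_of_le hle]
    exact hw.integrableOn_compact_subset (Icc_subset_radii hα'R hqR) isCompact_Icc
  -- A primitive of an integrable function is absolutely continuous, which is enough for integration
  -- by parts; the boundary terms vanish with θ.
  have hac := hwi.absolutelyContinuousOnInterval_intervalIntegral (c := a)
    (by rw [Set.uIcc_of_le hle]; exact ⟨by linarith, by linarith⟩)
  have hθac : AbsolutelyContinuousOnInterval θ α' q :=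
    (hθ.of_le (by simp)).contDiffOn.absolutelyContinuousOnInterval
  have hz : ∀ t, t ∉ Set.Icc α β → θ t = 0 := fun t ht =>
    image_eq_zero_of_notMem_tsupport fun h => ht (hK h)
  have hz' : ∀ t, t ∉ Set.Icc α β → deriv θ t = 0 := fun t ht => by
    by_contra h'
    exact ht (hK (support_deriv_subset h'))
  have hsub : ∀ t, t ∉ Set.Icc α' q → t ∉ Set.Icc α β := fun t ht h =>
    ht ⟨hα'.le.trans h.1, h.2.trans hβq.le⟩
  have key := hac.integral_mul_deriv_eq_deriv_mul hθac
  rw [hz α' (fun h => absurd h.1 (not_le.2 hα')), hz q (fun h => absurd h.2 (not_le.2 hβq))] at key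
  have e1 : ∫ x in α'..q, (∫ s in a..x, w s) * deriv θ x = ∫ x, (∫ s in a..x, w s) * deriv θ x := by
    rw [intervalIntegral.integral_of_le hle, ← integral_Icc_eq_integral_Ioc,
      setIntegral_eq_integral_of_forall_compl_eq_zero]
    intro t ht
    rw [hz' t (hsub t ht), mul_zero]
  have e2 : ∫ x in α'..q, deriv (fun x => ∫ s in a..x, w s) x * θ x = ∫ x, w x * θ x := by
    have : ∫ x in α'..q, deriv (fun x => ∫ s in a..x, w s) x * θ x = ∫ x in α'..q, w x * θ x := by
      apply intervalIntegral.integral_congr_ae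
      filter_upwards [hwi.ae_hasDerivAt_integral] with x hx hxI
      rw [(hx (Set.uIoc_subset_uIcc hxI) a
        (by rw [Set.uIcc_of_le hle]; exact ⟨by linarith, by linarith⟩)).deriv]
    rw [this, intervalIntegral.integral_of_le hle, ← integral_Icc_eq_integral_Ioc,
      setIntegral_eq_integral_of_forall_compl_eq_zero]
    intro t ht
    rw [hz t (hsub t ht), mul_zero]
  rw [← e1, key, e2]
  ring

lemma contDiff_comp_norm {k : ℝ → ℝ} (hk : ContDiff ℝ ((⊤ : ℕ∞) : WithTop ℕ∞) k)
    (h0 : ∀ᶠ t in 𝓝 (0 : ℝ), k t = 0) :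
    ContDiff ℝ ((⊤ : ℕ∞) : WithTop ℕ∞) (fun v : V => k ‖v‖) := by
  rw [contDiff_iff_contDiffAt]
  intro v
  by_cases hv : v = 0
  · subst hv
    have h1 : Tendsto (fun v : V => ‖v‖) (𝓝 0) (𝓝 0) := by
      simpa using (continuous_norm (E := V)).tendsto 0
    have h2 : (fun v : V => k ‖v‖) =ᶠ[𝓝 0] fun _ => (0 : ℝ) := h1.eventually h0
    exact (contDiffAt_const (c := (0 : ℝ))).congr_of_eventuallyEq h2
  · exact hk.contDiffAt.comp v (contDiffAt_norm ℝ hv)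

lemma tsupport_comp_norm_subset (k : ℝ → ℝ) (φ : V → ℝ) :
    tsupport (fun v : V => k ‖v‖ * φ v) ⊆ {v | ‖v‖ ∈ tsupport k} := by
  refine closure_minimal (fun v hv => ?_) ((isClosed_tsupport k).preimage continuous_norm)
  exact subset_tsupport _ fun h => hv (by simp [h])

lemma isCompact_norm_mem_tsupport {k : ℝ → ℝ} (hk : HasCompactSupport k) :
    IsCompact {v : V | ‖v‖ ∈ tsupport k} := by
  obtain ⟨M, hM⟩ := hk.isCompact.isBounded.subset_closedBall 0
  refine (isCompact_closedBall (0 : V) M).of_isClosed_subset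
    ((isClosed_tsupport k).preimage continuous_norm) fun v hv => ?_
  have := hM hv
  simpa using this

lemma fderiv_radial_mul_coord {k : ℝ → ℝ} (hk : ContDiff ℝ ((⊤ : ℕ∞) : WithTop ℕ∞) k)
    (h0 : ∀ᶠ t in 𝓝 (0 : ℝ), k t = 0) (v : V) (i : Fin 3) :
    fderiv ℝ (fun v : V => k ‖v‖ * v i) v (EuclideanSpace.single i 1)
      = deriv k ‖v‖ * (v i / ‖v‖) * v i + k ‖v‖ := by
  have hd : ∀ t, HasDerivAt k (deriv k t) t := fun t =>
    (hk.differentiable (by simp) t).hasDerivAt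
  have h0' : ∀ᶠ t in 𝓝 (0 : ℝ), deriv k t = 0 := by
    filter_upwards [h0.eventually_nhds] with t ht
    have : k =ᶠ[𝓝 t] fun _ => (0 : ℝ) := ht
    rw [this.deriv_eq]; simp
  have e : fderiv ℝ (fun v : V => v i) v = (EuclideanSpace.proj (𝕜 := ℝ) i : V →L[ℝ] ℝ) :=
    (EuclideanSpace.proj (𝕜 := ℝ) i : V →L[ℝ] ℝ).fderiv
  have hdi : DifferentiableAt ℝ (fun v : V => v i) v :=
    (EuclideanSpace.proj (𝕜 := ℝ) i : V →L[ℝ] ℝ).differentiableAt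
  rw [fderiv_fun_mul (hasFDerivAt_comp_norm hd h0' v).differentiableAt hdi]
  simp only [add_apply, smul_apply, smul_eq_mul,
    fderiv_comp_norm_single hd h0' v i, e]
  simp
  ring

/-- The spherical mean of the radial component of a vector field. -/
def radialMean (G : V → V) (r : ℝ) : ℝ :=
  area⁻¹ * ∫ ω : Metric.sphere (0 : V) 1, inner ℝ (G (r • (ω : V))) (ω : V) ∂sph

lemma measurable_radialMean {G : V → V} (hG : Measurable G) : Measurable (radialMean G) := by
  have h : StronglyMeasurable (fun q : ℝ × Metric.sphere (0 : V) 1 =>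
      inner ℝ (G (q.1 • (q.2 : V))) (q.2 : V)) := by
    refine Measurable.stronglyMeasurable ?_
    fun_prop
  exact (h.integral_prod_right' (ν := sph)).measurable.const_mul _

lemma integrableOn_radialMean {R : ℝ≥0∞} {G : V → V} (hGm : Measurable G)
    (hG : LocallyIntegrableOn G (oball R)) {b : ℝ} (hb : b ∈ radii R) :
    IntegrableOn (fun r => r ^ 2 * radialMean G r) (Set.Ioc 0 b) := by
  have hsub : Metric.closedBall (0 : V) b ⊆ oball R := fun v hv => by
    rw [mem_oball_iff]
    exact (ENNReal.ofReal_le_ofReal (by simpa using hv)).trans_lt hb.2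
  have h1 : IntegrableOn G (Metric.closedBall 0 b) :=
    hG.integrableOn_compact_subset hsub (isCompact_closedBall _ _)
  have h2 : IntegrableOn (fun v => inner ℝ (G v) (‖v‖⁻¹ • v)) (Metric.closedBall 0 b) := by
    refine Integrable.mono h1 (Measurable.aestronglyMeasurable (by fun_prop)) (ae_of_all _ fun v => ?_)
    refine (norm_inner_le_norm _ _).trans ?_
    rw [norm_smul, norm_inv, norm_norm]
    exact mul_le_of_le_one_right (norm_nonneg _) (inv_mul_le_one)
  have h3 := h2.integrable_indicator Metric.isClosed_closedBall.measurableSet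
  have h4 := (integrable_comp_polar h3).integral_prod_right
  rw [integrable_radMeas_iff] at h4
  have h5 := IntegrableOn.mono_set (h4.const_mul area⁻¹) (fun x (hx : x ∈ Set.Ioc 0 b) => Set.mem_Ioi.2 hx.1)
  refine h5.congr_fun (fun r hr => ?_) measurableSet_Ioc
  simp only [radialMean]
  rw [← mul_assoc, mul_comm area⁻¹, mul_assoc]
  congr 3; ext ω
  have hn := norm_polar (ω, r) hr.1
  simp only at hn
  rw [Set.indicator_of_mem (by simpa [hn] using hr.2), hn, smul_smul, inv_mul_cancel₀ hr.1.ne',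
    one_smul]

/-- Test with the field k(|v|) v, where k = θ/r³. Its divergence is r k' + 3 k = (r³ k)'/r² = θ'/r²,
so the volume element r² leaves exactly θ'. On the gradient side r² · k r = θ, paired with the
spherical mean of the radial component. -/
lemma integral_radial_deriv {R : ℝ≥0∞} {g : ℝ → ℝ} {G : V → V}
    (h : HasWeakGradOn (oball R) (fun v => g ‖v‖) G) {θ : ℝ → ℝ}
    (hθ : ContDiff ℝ ((⊤ : ℕ∞) : WithTop ℕ∞) θ) (hθc : HasCompactSupport θ)
    (hθt : tsupport θ ⊆ radii R) :
    ∫ t, g t * deriv θ t = -∫ t, radialMean G t * θ t := by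
  have hθ0 : ∀ᶠ t in 𝓝 (0 : ℝ), θ t = 0 :=
    eventually_zero_of_tsupport_subset fun t ht => (hθt ht).1
  set k : ℝ → ℝ := fun t => θ t / t ^ 3 with hkdef
  have hk0 : ∀ᶠ t in 𝓝 (0 : ℝ), k t = 0 := by
    filter_upwards [hθ0] with t ht using by simp [hkdef, ht]
  have hks : ContDiff ℝ ((⊤ : ℕ∞) : WithTop ℕ∞) k := by
    rw [contDiff_iff_contDiffAt]
    intro t
    by_cases ht : t = 0
    · subst ht
      exact (contDiffAt_const (c := (0 : ℝ))).congr_of_eventuallyEq hk0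
    · exact hθ.contDiffAt.div (contDiffAt_id.pow 3) (pow_ne_zero 3 ht)
  have hkt : tsupport k ⊆ tsupport θ := closure_mono fun t ht h' => ht (by simp [hkdef, h'])
  have hkc : HasCompactSupport k := hθc.isCompact.of_isClosed_subset (isClosed_tsupport _) hkt
  have hψs : ∀ i : Fin 3, ContDiff ℝ ((⊤ : ℕ∞) : WithTop ℕ∞) (fun v : V => k ‖v‖ * v i) := fun i =>
    (contDiff_comp_norm hks hk0).mul (EuclideanSpace.proj (𝕜 := ℝ) i : V →L[ℝ] ℝ).contDiff
  have hψc : ∀ i : Fin 3, HasCompactSupport (fun v : V => k ‖v‖ * v i) := fun i =>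
    (isCompact_norm_mem_tsupport hkc).of_isClosed_subset (isClosed_tsupport _)
      (tsupport_comp_norm_subset k _)
  have hψt : ∀ i : Fin 3, tsupport (fun v : V => k ‖v‖ * v i) ⊆ oball R := fun i v hv => by
    rw [mem_oball_iff]
    exact (hθt (hkt (tsupport_comp_norm_subset k _ hv))).2
  have hi : ∀ i : Fin 3, ∫ v : V, g ‖v‖ * (deriv k ‖v‖ * (v i / ‖v‖) * v i + k ‖v‖)
      = -∫ v, G v i * (k ‖v‖ * v i) := fun i => by
    rw [← h.integral_eq _ (hψs i) (hψc i) (hψt i) i]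
    simp_rw [fderiv_radial_mul_coord hks hk0]
  have hint1 : ∀ i : Fin 3,
      Integrable fun v : V => g ‖v‖ * (deriv k ‖v‖ * (v i / ‖v‖) * v i + k ‖v‖) := fun i => by
    simp_rw [← fderiv_radial_mul_coord hks hk0]
    refine integrable_mul_of_locallyIntegrableOn h.locallyIntegrable
      (continuous_fderiv_single (hψs i) i) (hasCompactSupport_fderiv_single (hψc i) i) ?_
    refine (closure_mono ?_).trans ((tsupport_fderiv_subset ℝ).trans (hψt i))
    intro v hv h0
    exact hv (by simp only [h0]; rfl)
  have hint2 : ∀ i : Fin 3, Integrable fun v => G v i * (k ‖v‖ * v i) := fun i =>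
    integrable_mul_of_locallyIntegrableOn (LocallyIntegrableOn.coord h.grad_locallyIntegrable i)
      (hψs i).continuous (hψc i) (hψt i)
  have hsum : ∫ v : V, ∑ i : Fin 3, g ‖v‖ * (deriv k ‖v‖ * (v i / ‖v‖) * v i + k ‖v‖)
      = -∫ v, ∑ i : Fin 3, G v i * (k ‖v‖ * v i) := by
    rw [integral_finsetSum _ fun i _ => hint1 i, integral_finsetSum _ fun i _ => hint2 i,
      ← Finset.sum_neg_distrib]
    exact Finset.sum_congr rfl fun i _ => hi i
  have hI1 := integrable_finsetSum Finset.univ fun i _ => hint1 i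
  have hI2 := integrable_finsetSum Finset.univ fun i _ => hint2 i
  rw [integral_polar hI1, integral_polar hI2] at hsum
  have hL : ∀ r ∈ Set.Ioi (0 : ℝ), r ^ 2 * ∫ ω : Metric.sphere (0 : V) 1, ∑ i : Fin 3,
      g ‖r • (ω : V)‖ * (deriv k ‖r • (ω : V)‖ * ((r • (ω : V)) i / ‖r • (ω : V)‖) * (r • (ω : V)) i
        + k ‖r • (ω : V)‖) ∂sph = area * (g r * deriv θ r) := by
    intro r hr
    have hr' : r ≠ 0 := (Set.mem_Ioi.1 hr).ne'
    have hθk : deriv θ r = deriv k r * r ^ 3 + k r * (3 * r ^ 2) := by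
      have e : θ =ᶠ[𝓝 r] fun t => k t * t ^ 3 := by
        filter_upwards [isOpen_ne.mem_nhds hr'] with t ht
        have ht' : t ≠ 0 := ht
        simp only [hkdef]; field_simp
      rw [e.deriv_eq]
      have h1 := ((hks.differentiable (by simp) r).hasDerivAt.mul (hasDerivAt_pow 3 r)).deriv
      have h2 : (k * fun x => x ^ 3) = fun t => k t * t ^ 3 := rfl
      rw [h2] at h1
      rw [h1]; norm_num
    have hω : ∀ ω : Metric.sphere (0 : V) 1, ∑ i : Fin 3,
        g ‖r • (ω : V)‖ * (deriv k ‖r • (ω : V)‖ * ((r • (ω : V)) i / ‖r • (ω : V)‖) * (r • (ω : V)) i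
        + k ‖r • (ω : V)‖) = g r * (deriv k r * r + 3 * k r) := by
      intro ω
      have hn := norm_polar (ω, r) hr
      simp only at hn
      have hω1 := norm_sq_eq_coords (ω : V)
      rw [norm_eq_of_mem_sphere ω] at hω1
      simp only [hn, Fin.sum_univ_three, PiLp.smul_apply, smul_eq_mul]
      field_simp
      linear_combination (-(g r * deriv k r * r)) * hω1
    simp_rw [hω]
    rw [integral_const, hθk]
    simp only [smul_eq_mul, area]
    ring
  have hRt : ∀ r ∈ Set.Ioi (0 : ℝ), r ^ 2 * ∫ ω : Metric.sphere (0 : V) 1, ∑ i : Fin 3,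
      G (r • (ω : V)) i * (k ‖r • (ω : V)‖ * (r • (ω : V)) i) ∂sph
        = area * (radialMean G r * θ r) := by
    intro r hr
    have hr' : r ≠ 0 := (Set.mem_Ioi.1 hr).ne'
    have hω : ∀ ω : Metric.sphere (0 : V) 1, ∑ i : Fin 3,
        G (r • (ω : V)) i * (k ‖r • (ω : V)‖ * (r • (ω : V)) i)
          = k r * r * inner ℝ (G (r • (ω : V))) (ω : V) := by
      intro ω
      have hn := norm_polar (ω, r) hr
      simp only at hn
      rw [inner_eq_coords]
      simp only [hn, Fin.sum_univ_three, PiLp.smul_apply, smul_eq_mul]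
      ring
    simp_rw [hω]
    rw [integral_const_mul, radialMean]
    have := area_pos.ne'
    simp only [hkdef]
    field_simp
  rw [setIntegral_congr_fun measurableSet_Ioi hL, setIntegral_congr_fun measurableSet_Ioi hRt,
    integral_const_mul, integral_const_mul] at hsum
  have hz : ∀ t, t ∉ Set.Ioi (0 : ℝ) → t ∉ tsupport θ := fun t ht h => ht (hθt h).1
  rw [setIntegral_eq_integral_of_forall_compl_eq_zero (fun t ht => by
      have : deriv θ t = 0 := by
        by_contra h'
        exact hz t ht (support_deriv_subset h')
      rw [this, mul_zero]),
    setIntegral_eq_integral_of_forall_compl_eq_zero (fun t ht => by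
      rw [image_eq_zero_of_notMem_tsupport (hz t ht), mul_zero])] at hsum
  have := area_pos.ne'
  have e : area * (∫ t, g t * deriv θ t) = area * -∫ t, radialMean G t * θ t := by
    rw [hsum]; ring
  exact mul_left_cancel₀ this e

lemma locallyIntegrableOn_radial {R : ℝ≥0∞} {g : ℝ → ℝ}
    (h : LocallyIntegrableOn (fun v : V => g ‖v‖) (oball R)) : LocallyIntegrableOn g (radii R) := by
  rw [locallyIntegrableOn_iff (isOpen_radii R).isLocallyClosed]
  intro K hK hKc
  rcases K.eq_empty_or_nonempty with he | ⟨a, ha⟩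
  · simp [he]
  obtain ⟨α, hα, β, hβ, -, -, hKI⟩ := exists_Icc_radii hKc hK (hK ha)
  have hsub : Metric.closedBall (0 : V) β ⊆ oball R := fun v hv => by
    rw [mem_oball_iff]
    exact (ENNReal.ofReal_le_ofReal (by simpa using hv)).trans_lt hβ.2
  have h1 : IntegrableOn (fun v : V => g ‖v‖) (Metric.ball 0 β) :=
    (h.integrableOn_compact_subset hsub (isCompact_closedBall _ _)).mono_set
      Metric.ball_subset_closedBall
  rw [integrableOn_fun_norm_addHaar (μ := (volume : Measure V)), ← integrableOn_Ioc_iff_integrableOn_Ioo]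
    at h1
  have h2 : IntegrableOn (fun r : ℝ => r ^ 2 * g r) K := by
    refine (h1.mono_set fun x hx => ⟨(hK hx).1, (hKI hx).2⟩).congr_fun (fun r _ => ?_) hKc.measurableSet
    simp
  have h3 : ContinuousOn (fun r : ℝ => (r ^ 2)⁻¹) K := fun x hx =>
    ((continuousAt_id.pow 2).inv₀ (pow_ne_zero 2 (hK hx).1.ne')).continuousWithinAt
  refine (h2.continuousOn_mul h3 hKc).congr_fun (fun r hr => ?_) hKc.measurableSet
  have := (hK hr).1.ne'
  simp only
  field_simp

/-- A radial weakly differentiable function is represented by a profile. -/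
lemma exists_profile {R : ℝ≥0∞} (hR : 0 < R) {g : ℝ → ℝ}
    (h : WeaklyDifferentiableOn (oball R) (fun v => g ‖v‖)) :
    ∃ u H, IsProfile R u H ∧ ∀ᵐ r, r ∈ radii R → g r = u r := by
  obtain ⟨G0, hG0⟩ := h
  obtain ⟨a, ha⟩ := exists_mem_radii hR
  have hm := hG0.grad_locallyIntegrable.aestronglyMeasurable
  set G := hm.mk G0 with hG
  have hGm : Measurable G := hm.stronglyMeasurable_mk.measurable
  have hWG : HasWeakGradOn (oball R) (fun v => g ‖v‖) G :=
    hG0.congr (isOpen_oball R).measurableSet (ae_eq_refl _) hm.ae_eq_mk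
  -- The spherical mean of the radial component plays the role of u', so H = u'/r.
  set H : ℝ → ℝ := fun r => radialMean G r / r with hH
  have hHm : Measurable H := (measurable_radialMean hGm).div measurable_id
  have hint : ∀ b, b ∈ radii R → IntegrableOn (fun s => s ^ 3 * H s) (Set.Ioc 0 b) := by
    intro b hb
    refine (integrableOn_radialMean hGm hWG.grad_locallyIntegrable hb).congr_fun (fun r hr => ?_)
      measurableSet_Ioc
    have := hr.1.ne'
    simp only [hH]; field_simp
  have hloc : LocallyIntegrableOn (fun t => t * H t) (radii R) := by
    rw [locallyIntegrableOn_iff (isOpen_radii R).isLocallyClosed]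
    intro K hK hKc
    rcases K.eq_empty_or_nonempty with he | ⟨x, hx⟩
    · simp [he]
    obtain ⟨α, hα, β, hβ, -, -, hKI⟩ := exists_Icc_radii hKc hK (hK hx)
    have h1 : IntegrableOn (fun s => s ^ 3 * H s) K :=
      (hint β hβ).mono_set fun x hx => ⟨(hK hx).1, (hKI hx).2⟩
    have h3 : ContinuousOn (fun r : ℝ => (r ^ 2)⁻¹) K := fun x hx =>
      ((continuousAt_id.pow 2).inv₀ (pow_ne_zero 2 (hK hx).1.ne')).continuousWithinAt
    refine (h1.continuousOn_mul h3 hKc).congr_fun (fun r hr => ?_) hKc.measurableSet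
    have := (hK hr).1.ne'
    simp only
    field_simp
  have hinterval : ∀ r s, r ∈ radii R → s ∈ radii R → IntervalIntegrable (fun t => t * H t) volume r s := by
    have : ∀ r s, r ≤ s → r ∈ radii R → s ∈ radii R →
        IntervalIntegrable (fun t => t * H t) volume r s := fun r s hrs hr hs => by
      rw [intervalIntegrable_iff_integrableOn_Icc_of_le hrs]
      exact hloc.integrableOn_compact_subset (Icc_subset_radii hr hs) isCompact_Icc
    intro r s hr hs
    rcases le_total r s with h | h
    · exact this r s h hr hs
    · exact (this s r h hs hr).symm
  set P : ℝ → ℝ := fun r => ∫ t in a..r, t * H t with hP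
  have hPc : ContinuousOn P (radii R) := by
    intro x hx
    obtain ⟨α, hα, hαx⟩ : ∃ α, α ∈ radii R ∧ α < min a x :=
      ⟨min a x / 2, by
        have : 0 < min a x := lt_min ha.1 hx.1
        exact radii_of_le ha (by linarith) (by linarith [min_le_left a x]), by
        have : 0 < min a x := lt_min ha.1 hx.1
        linarith⟩
    obtain ⟨q, -, hq0, hq1⟩ := ENNReal.lt_iff_exists_real_btwn.1
      (max_lt ha.2 hx.2 : max (ENNReal.ofReal a) (ENNReal.ofReal x) < R)
    have haq : a < q := (ENNReal.ofReal_lt_ofReal_iff_of_nonneg ha.1.le).1 ((le_max_left _ _).trans_lt hq0)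
    have hxq : x < q := (ENNReal.ofReal_lt_ofReal_iff_of_nonneg hx.1.le).1 ((le_max_right _ _).trans_lt hq0)
    have hq : q ∈ radii R := ⟨ha.1.trans haq, hq1⟩
    have hαq : α ≤ q := by linarith [min_le_left a x]
    have hc := intervalIntegral.continuousOn_primitive_interval' (hinterval α q hα hq)
      (a := a) (by rw [Set.uIcc_of_le hαq]; exact ⟨by linarith [min_le_left a x], haq.le⟩)
    rw [Set.uIcc_of_le hαq] at hc
    exact (hc.continuousAt (Icc_mem_nhds (by linarith [min_le_right a x]) hxq)).continuousWithinAt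
  have hgl := locallyIntegrableOn_radial hWG.locallyIntegrable
  have hPl : LocallyIntegrableOn P (radii R) :=
    hPc.locallyIntegrableOn (isOpen_radii R).measurableSet
  -- Both g and the primitive P have distributional derivative `radialMean G`, so they differ by a
  -- constant almost everywhere.
  obtain ⟨c, hc⟩ := ae_eq_const_of_integral_deriv_eq_zero ha (hgl.sub hPl) (by
    intro θ hθ hθc hθt
    have hdc : Continuous (deriv θ) := hθ.continuous_deriv (by simp)
    have hdt : tsupport (deriv θ) ⊆ radii R := (tsupport_deriv_subset ..).trans hθt
    have hmul : ∀ φ : ℝ → ℝ, LocallyIntegrableOn φ (radii R) → Integrable fun t => φ t * deriv θ t := by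
      intro φ hφ
      have h1 : IntegrableOn (fun t => φ t * deriv θ t) (tsupport (deriv θ)) :=
        (hφ.integrableOn_compact_subset hdt hθc.deriv).mul_continuousOn hdc.continuousOn hθc.deriv
      refine (integrableOn_iff_integrable_of_support_subset fun v hv => ?_).1 h1
      apply subset_tsupport
      intro h
      exact hv (by simp [h])
    have e1 := integral_radial_deriv hWG hθ hθc hθt
    have e2 := integral_primitive_mul_deriv ha hloc hθ hθc hθt
    have e3 : ∫ t, t * H t * θ t = ∫ t, radialMean G t * θ t := by
      congr 1; ext t
      by_cases ht : t ∈ tsupport θ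
      · have := (hθt ht).1.ne'
        simp only [hH]; field_simp
      · rw [image_eq_zero_of_notMem_tsupport ht]; simp
    have e4 : ∀ t, (g - P) t * deriv θ t = g t * deriv θ t - P t * deriv θ t := fun t => by
      simp only [Pi.sub_apply]; ring
    simp_rw [e4]
    rw [integral_sub (hmul g hgl) (hmul P hPl), e1, e2, e3]
    ring)
  refine ⟨fun r => c + P r, H, ⟨hHm, hint, fun r s hr hrs hs => ?_⟩, ?_⟩
  · have hrR := radii_of_le hs hr hrs
    have := intervalIntegral.integral_add_adjacent_intervals (hinterval a r ha hrR) (hinterval r s hrR hs)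
    simp only [hP]
    linarith
  · filter_upwards [hc] with r hr hrR
    have := hr hrR
    simp only [Pi.sub_apply] at this
    linarith

/-! ### The norm and the quadratic form in terms of profiles -/

/-- The localized norm squared of the radial function `u μ^{1/2}` with `u' = r H`. -/
def energy (R : ℝ≥0∞) (u H : ℝ → ℝ) : ℝ≥0∞ :=
  ∫⁻ v in cball R, ENNReal.ofReal (lam R v * ((H ‖v‖ - u ‖v‖) ^ 2 + u ‖v‖ ^ 2) * maxwellian v)

/-- The localized quadratic form of the radial function `u μ` with `u' = r H`. -/
def qform (R : ℝ≥0∞) (H : ℝ → ℝ) : ℝ≥0∞ :=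
  2⁻¹ * ∫⁻ v in cball R, ∫⁻ w in cball R,
    ENNReal.ofReal (maxwellian v * maxwellian w * (kappa v w * (H ‖v‖ - H ‖w‖) ^ 2))

lemma ae_restrict_cball_iff {R : ℝ≥0∞} {P : V → Prop} :
    (∀ᵐ v ∂(volume.restrict (cball R)), P v) ↔ ∀ᵐ v ∂(volume.restrict (oball R)), P v := by
  rw [Measure.restrict_congr_set (cball_ae_eq_oball R)]

lemma contDiff_exp_norm_sq (a : ℝ) :
    ContDiff ℝ ((⊤ : ℕ∞) : WithTop ℕ∞) (fun v : V => Real.exp (a * ‖v‖ ^ 2)) :=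
  Real.contDiff_exp.comp (contDiff_const.mul (contDiff_norm_sq ℝ))

lemma fderiv_exp_norm_sq (a : ℝ) (v : V) (i : Fin 3) :
    fderiv ℝ (fun v : V => Real.exp (a * ‖v‖ ^ 2)) v (EuclideanSpace.single i 1)
      = ((2 * a * Real.exp (a * ‖v‖ ^ 2)) • v) i := by
  have h := ((hasStrictFDerivAt_norm_sq v).hasFDerivAt.const_mul a).exp
  rw [h.fderiv]
  simp [EuclideanSpace.inner_single_right]
  ring

lemma HasWeakGradOn.mul_exp {U : Set V} (hU : IsOpen U) {f : V → ℝ} {G : V → V}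
    (h : HasWeakGradOn U f G) (a : ℝ) :
    HasWeakGradOn U (fun v => f v * Real.exp (a * ‖v‖ ^ 2))
      (fun v => Real.exp (a * ‖v‖ ^ 2) • G v + f v • (2 * a * Real.exp (a * ‖v‖ ^ 2)) • v) :=
  h.mul_smooth hU (contDiff_exp_norm_sq a) (by fun_prop) (fderiv_exp_norm_sq a)

lemma maxwellian_half (v : V) : maxwellian v ^ (1 / 2 : ℝ) = Real.exp (-(1 / 2) * ‖v‖ ^ 2) := by
  rw [maxwellian, ← Real.exp_mul]; ring_nf

lemma maxwellian_half_mul_self (v : V) :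
    maxwellian v ^ (1 / 2 : ℝ) * maxwellian v ^ (1 / 2 : ℝ) = maxwellian v := by
  rw [← Real.rpow_add (maxwellian_pos v)]; norm_num

/-- Here ∇(u μ^{1/2}) = (H - u) μ^{1/2} v, so both terms of the norm carry the factor v_i v_j and
only the entry σ_R^{ij} v_i v_j of the matrix enters. -/
lemma sigmaNormSq_eq_energy {R : ℝ≥0∞} (hR : 0 < R) {u H : ℝ → ℝ} (h : IsProfile R u H) {p : V → ℝ}
    (hp : ∀ᵐ v ∂(volume.restrict (oball R)), p v = u ‖v‖ * maxwellian v ^ (1 / 2 : ℝ)) :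
    sigmaNormSq R p = energy R u H := by
  have h1 := (h.hasWeakGradOn hR).mul_exp (isOpen_oball R) (-(1 / 2))
  have h2 := weakGrad_ae_eq (isOpen_oball R) h1 (f := p) (by
    filter_upwards [hp] with v hv
    rw [hv, maxwellian_half])
  refine lintegral_congr_ae ?_
  refine ae_restrict_cball_iff.2 ?_
  filter_upwards [hp, h2] with v hv hG
  congr 1
  rw [hG, hv, maxwellian_half]
  have hE : Real.exp (-(1 / 2) * ‖v‖ ^ 2) ^ 2 = maxwellian v := by
    rw [sq, ← maxwellian_half, maxwellian_half_mul_self]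
  rw [← hE, ← sum_sigmaCoeff R v, Finset.sum_mul, Finset.sum_mul]
  refine Finset.sum_congr rfl fun i _ => ?_
  rw [Finset.sum_mul, Finset.sum_mul]
  refine Finset.sum_congr rfl fun j _ => ?_
  simp only [PiLp.add_apply, PiLp.smul_apply, smul_eq_mul]
  ring

lemma quadForm_eq_qform {R : ℝ≥0∞} (hR : 0 < R) {u H : ℝ → ℝ} (h : IsProfile R u H) {f : V → ℝ}
    (hf : ∀ᵐ v ∂(volume.restrict (oball R)), f v = u ‖v‖ * maxwellian v) :
    quadForm R f = qform R H := by
  have h2 := weakGrad_ae_eq (isOpen_oball R) (h.hasWeakGradOn hR)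
    (f := fun v => f v * (maxwellian v)⁻¹) (by
    filter_upwards [hf] with v hv
    rw [hv, mul_assoc, mul_inv_cancel₀ (maxwellian_pos v).ne', mul_one])
  have h3 := ae_restrict_cball_iff.2 h2
  simp only [quadForm, qform]
  congr 1
  refine lintegral_congr_ae ?_
  filter_upwards [h3] with v hv
  refine lintegral_congr_ae ?_
  filter_upwards [h3] with w hw
  rw [hv, hw, ← sum_coulomb_sub]
  simp only [PiLp.smul_apply, smul_eq_mul]

lemma RadialFiniteEnergy.exists_profile {R : ℝ≥0∞} (hR : 0 < R) {f : V → ℝ}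
    (hf : RadialFiniteEnergy R f) :
    ∃ u H, IsProfile R u H ∧ (∀ᵐ v ∂(volume.restrict (oball R)), f v = u ‖v‖ * maxwellian v) ∧
      (∀ᵐ v ∂(volume.restrict (oball R)),
        divSqrtMaxwellian f v = u ‖v‖ * maxwellian v ^ (1 / 2 : ℝ)) ∧ energy R u H < ∞ := by
  obtain ⟨F, hF⟩ := hf.radial
  obtain ⟨G, hG⟩ := hf.weaklyDifferentiable
  have h1 := hG.mul_exp (isOpen_oball R) 1
  have e : (fun v => f v * Real.exp (1 * ‖v‖ ^ 2)) = fun v : V => F ‖v‖ * Real.exp (‖v‖ ^ 2) := by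
    ext v; rw [hF, one_mul]
  rw [e] at h1
  -- The profile represents f μ⁻¹ rather than f, so that H is the quantity in the quadratic form.
  obtain ⟨u, H, hp, hu⟩ := Landau.exists_profile hR (g := fun r => F r * Real.exp (r ^ 2)) ⟨_, h1⟩
  have h2 : ∀ᵐ v ∂(volume.restrict (oball R)), F ‖v‖ * Real.exp (‖v‖ ^ 2) = u ‖v‖ :=
    (ae_restrict_iff' (isOpen_oball R).measurableSet).2 (ae_oball_of_ae_radii hu)
  have h3 : ∀ᵐ v ∂(volume.restrict (oball R)), f v = u ‖v‖ * maxwellian v := by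
    filter_upwards [h2] with v hv
    rw [hF, ← hv, maxwellian, mul_assoc, ← Real.exp_add]; simp
  have h4 : ∀ᵐ v ∂(volume.restrict (oball R)),
      divSqrtMaxwellian f v = u ‖v‖ * maxwellian v ^ (1 / 2 : ℝ) := by
    filter_upwards [h3] with v hv
    rw [divSqrtMaxwellian, hv, mul_assoc]
    congr 1
    nth_rewrite 1 [← Real.rpow_one (maxwellian v)]
    rw [← Real.rpow_add (maxwellian_pos v)]; norm_num
  refine ⟨u, H, hp, h3, h4, ?_⟩
  rw [← sigmaNormSq_eq_energy hR hp h4]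
  exact hf.finite

/-! ### The projection -/

/-- The general element of `kernelSpan R`. -/
def kerFn (R : ℝ≥0∞) (a : ℝ) (b : V) (c : ℝ) : V → ℝ :=
  (cball R).indicator fun v => (a + inner ℝ b v + c * ‖v‖ ^ 2) * maxwellian v ^ (1 / 2 : ℝ)

lemma exists_kerFn {R : ℝ≥0∞} {k : V → ℝ} (hk : k ∈ kernelSpan R) : ∃ a b c, k = kerFn R a b c := by
  induction hk using Submodule.span_induction with
  | mem x hx =>
    obtain ⟨h, hh, rfl⟩ := hx
    rcases hh with (rfl | rfl) | ⟨i, rfl⟩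
    · exact ⟨1, 0, 0, by simp [kerFn]⟩
    · exact ⟨0, 0, 1, by simp [kerFn]⟩
    · exact ⟨0, EuclideanSpace.single i 1, 0, by simp [kerFn, EuclideanSpace.inner_single_left]⟩
  | zero => exact ⟨0, 0, 0, by ext v; simp [kerFn]⟩
  | add x y _ _ hx hy =>
    obtain ⟨a, b, c, rfl⟩ := hx
    obtain ⟨a', b', c', rfl⟩ := hy
    refine ⟨a + a', b + b', c + c', ?_⟩
    ext v
    by_cases hv : v ∈ cball R
    · simp only [kerFn, Pi.add_apply, Set.indicator_of_mem hv]
      rw [inner_add_left]; ring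
    · simp only [kerFn, Pi.add_apply, Set.indicator_of_notMem hv, add_zero]
  | smul t x _ hx =>
    obtain ⟨a, b, c, rfl⟩ := hx
    refine ⟨t * a, t • b, t * c, ?_⟩
    ext v
    by_cases hv : v ∈ cball R
    · simp only [kerFn, Pi.smul_apply, smul_eq_mul, Set.indicator_of_mem hv]
      rw [real_inner_smul_left]; ring
    · simp only [kerFn, Pi.smul_apply, smul_eq_mul, Set.indicator_of_notMem hv, mul_zero]

lemma kerFn_mem (R : ℝ≥0∞) (a : ℝ) (b : V) (c : ℝ) : kerFn R a b c ∈ kernelSpan R := by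
  set T : (V → ℝ) → (V → ℝ) :=
    fun h => (cball R).indicator (fun v => h v * maxwellian v ^ (1 / 2 : ℝ)) with hT
  have h1 : T (fun _ => 1) ∈ kernelSpan R := Submodule.subset_span ⟨_, Or.inl (Or.inl rfl), rfl⟩
  have h2 : T (fun v => ‖v‖ ^ 2) ∈ kernelSpan R := Submodule.subset_span ⟨_, Or.inl (Or.inr rfl), rfl⟩
  have h3 : ∀ i : Fin 3, T (fun v => v i) ∈ kernelSpan R := fun i =>
    Submodule.subset_span ⟨_, Or.inr ⟨i, rfl⟩, rfl⟩
  have e : kerFn R a b c = a • T (fun _ => 1) + c • T (fun v => ‖v‖ ^ 2)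
      + (b 0 • T (fun v => v 0) + b 1 • T (fun v => v 1) + b 2 • T (fun v => v 2)) := by
    ext v
    by_cases hv : v ∈ cball R
    · simp [kerFn, hT, Set.indicator_of_mem hv, inner_eq_coords]
      ring
    · simp [kerFn, hT, Set.indicator_of_notMem hv]
  rw [e]
  exact add_mem (add_mem (Submodule.smul_mem _ _ h1) (Submodule.smul_mem _ _ h2))
    (add_mem (add_mem (Submodule.smul_mem _ _ (h3 0)) (Submodule.smul_mem _ _ (h3 1)))
      (Submodule.smul_mem _ _ (h3 2)))

/-- The weight that dominates `(1 + r²)² / lam`. -/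
def dualWt (r : ℝ) : ℝ := (1 + r ^ 2) ^ 2 * (1 + r) ^ 3 / r ^ 2

/-- The volume element r² cancels 1/r² and leaves a polynomial of degree 7, at most (1 + r)⁷ ≤ 2⁷ (1
+ r⁷). -/
lemma integrable_dualWt : Integrable fun v : V => dualWt ‖v‖ * maxwellian v := by
  have h := (integrable_fun_norm_addHaar (μ := (volume : Measure V))
    (f := fun r : ℝ => dualWt r * Real.exp (-r ^ 2))).2
  refine h ?_
  have i0 : IntegrableOn (fun r : ℝ => Real.exp (-1 * r ^ 2)) (Set.Ioi 0) :=
    (integrable_exp_neg_mul_sq one_pos).integrableOn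
  have i7 : IntegrableOn (fun r : ℝ => r ^ ((7 : ℕ) : ℝ) * Real.exp (-1 * r ^ 2)) (Set.Ioi 0) :=
    (integrable_rpow_mul_exp_neg_mul_sq one_pos (s := ((7 : ℕ) : ℝ)) (by norm_num)).integrableOn
  refine Integrable.mono' (g := fun r : ℝ => 128 * (Real.exp (-1 * r ^ 2)
    + r ^ ((7 : ℕ) : ℝ) * Real.exp (-1 * r ^ 2))) ((i0.add i7).const_mul 128)
    (Measurable.aestronglyMeasurable (by unfold dualWt; fun_prop)) ?_
  filter_upwards [ae_restrict_mem measurableSet_Ioi] with r hr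
  have hr : 0 < r := hr
  simp only [finrank_euclideanSpace, Fintype.card_fin, smul_eq_mul, dualWt, Real.rpow_natCast]
  rw [Real.norm_of_nonneg (by positivity)]
  have e : r ^ (3 - 1) * ((1 + r ^ 2) ^ 2 * (1 + r) ^ 3 / r ^ 2 * Real.exp (-r ^ 2))
      = (1 + r ^ 2) ^ 2 * (1 + r) ^ 3 * Real.exp (-1 * r ^ 2) := by
    rw [neg_one_mul]; field_simp
  rw [e]
  have h1 : (1 + r ^ 2) ^ 2 * (1 + r) ^ 3 ≤ 128 * (1 + r ^ 7) := by
    have ha : 1 + r ^ 2 ≤ (1 + r) ^ 2 := by nlinarith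
    have hb : (1 + r) ^ 7 ≤ 128 * (1 + r ^ 7) := by
      rcases le_total r 1 with h | h
      · calc (1 + r) ^ 7 ≤ (1 + 1) ^ 7 := by gcongr
          _ = 128 * (1 + 0) := by norm_num
          _ ≤ _ := by gcongr; positivity
      · calc (1 + r) ^ 7 ≤ (r + r) ^ 7 := by gcongr
          _ = 128 * r ^ 7 := by ring
          _ ≤ _ := by linarith
    calc _ ≤ ((1 + r) ^ 2) ^ 2 * (1 + r) ^ 3 := by gcongr
      _ = (1 + r) ^ 7 := by ring
      _ ≤ _ := hb
  calc _ ≤ 128 * (1 + r ^ 7) * Real.exp (-1 * r ^ 2) := by gcongr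
    _ = _ := by ring

lemma wt_mul_dualWt {r : ℝ} (hr : 0 < r) : wt r * dualWt r = (1 + r ^ 2) ^ 2 := by
  unfold wt dualWt; field_simp

lemma IsProfile.aestronglyMeasurable {R : ℝ≥0∞} (hR : 0 < R) {u H : ℝ → ℝ} (h : IsProfile R u H) :
    AEStronglyMeasurable (fun v : V => u ‖v‖) (volume.restrict (cball R)) := by
  rw [Measure.restrict_congr_set (cball_ae_eq_oball R)]
  exact (h.hasWeakGradOn hR).locallyIntegrable.aestronglyMeasurable

lemma ae_ne_zero : ∀ᵐ v : V, v ≠ 0 := by simp [ae_iff]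

lemma integrableOn_sq_of_energy {R : ℝ≥0∞} (hR : 0 < R) {u H : ℝ → ℝ} (h : IsProfile R u H)
    (hE : energy R u H < ∞) :
    IntegrableOn (fun v => lam R v * u ‖v‖ ^ 2 * maxwellian v) (cball R) := by
  have hu := h.aestronglyMeasurable hR
  refine ⟨?_, ?_⟩
  · exact ((measurable_lam R).aestronglyMeasurable.mul (hu.pow 2)).mul
      measurable_maxwellian.aestronglyMeasurable
  · refine lt_of_le_of_lt (lintegral_mono fun v => ?_) hE
    have hm := (maxwellian_pos v).le
    have hl := lam_nonneg R v
    rw [Real.enorm_eq_ofReal (by positivity)]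
    apply ENNReal.ofReal_le_ofReal
    refine mul_le_mul_of_nonneg_right (mul_le_mul_of_nonneg_left ?_ hl) hm
    nlinarith [sq_nonneg (H ‖v‖ - u ‖v‖)]

/-- Finite energy alone makes the pairings with kernel functions converge: |u φ| is split by the
arithmetic-geometric mean inequality into `lam` times u² and a multiple of the integrable `dualWt`.
-/
lemma IsProfile.integrableOn_mul {R : ℝ≥0∞} (hR : 1 ≤ R) {u H : ℝ → ℝ} (h : IsProfile R u H)
    (hE : energy R u H < ∞) {φ : V → ℝ} (hφ : Measurable φ) {C : ℝ}
    (hC : ∀ v, |φ v| ≤ C * (1 + ‖v‖ ^ 2)) :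
    IntegrableOn (fun v => u ‖v‖ * φ v * maxwellian v) (cball R) := by
  have hR0 : 0 < R := lt_of_lt_of_le one_pos hR
  have hu := h.aestronglyMeasurable hR0
  obtain ⟨c, hc, hcl⟩ := exists_le_lam
  have i1 := integrableOn_sq_of_energy hR0 h hE
  have i2 : IntegrableOn (fun v : V => C ^ 2 / c * (dualWt ‖v‖ * maxwellian v)) (cball R) :=
    (integrable_dualWt.const_mul _).integrableOn
  refine Integrable.mono' (i1.add i2) ((hu.mul hφ.aestronglyMeasurable).mul
    measurable_maxwellian.aestronglyMeasurable) ?_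
  filter_upwards [ae_restrict_of_ae ae_ne_zero] with v hv
  have hr : 0 < ‖v‖ := norm_pos_iff.2 hv
  have hm := (maxwellian_pos v).le
  have hwd := wt_mul_dualWt hr
  have hl := hcl R hR v
  have hd : 0 ≤ dualWt ‖v‖ := by unfold dualWt; positivity
  have h1 : |u ‖v‖ * φ v| ≤ lam R v * u ‖v‖ ^ 2 + C ^ 2 / c * dualWt ‖v‖ := by
    have hsq : (u ‖v‖ * φ v) ^ 2 ≤ (c * wt ‖v‖ * u ‖v‖ ^ 2) * (C ^ 2 / c * dualWt ‖v‖) := by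
      have e : (c * wt ‖v‖ * u ‖v‖ ^ 2) * (C ^ 2 / c * dualWt ‖v‖)
          = u ‖v‖ ^ 2 * (C * (1 + ‖v‖ ^ 2)) ^ 2 := by
        rw [mul_pow C, ← hwd]; field_simp
      rw [e, mul_pow]
      exact mul_le_mul_of_nonneg_left (sq_le_sq' (by linarith [abs_le.1 (hC v)]) (abs_le.1 (hC v)).2)
        (sq_nonneg _)
    have hx : 0 ≤ c * wt ‖v‖ * u ‖v‖ ^ 2 := by
      have := wt_nonneg hr.le
      positivity
    have hy : 0 ≤ C ^ 2 / c * dualWt ‖v‖ := by positivity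
    have h2 : |u ‖v‖ * φ v| ≤ c * wt ‖v‖ * u ‖v‖ ^ 2 + C ^ 2 / c * dualWt ‖v‖ := by
      apply abs_le_of_sq_le_sq _ (by positivity)
      nlinarith
    have h3 : c * wt ‖v‖ * u ‖v‖ ^ 2 ≤ lam R v * u ‖v‖ ^ 2 := by gcongr
    linarith
  rw [Real.norm_eq_abs, abs_mul, abs_of_nonneg hm, Pi.add_apply]
  calc _ ≤ (lam R v * u ‖v‖ ^ 2 + C ^ 2 / c * dualWt ‖v‖) * maxwellian v := by gcongr
    _ = _ := by ring

lemma abs_kernel_poly_le (a : ℝ) (b : V) (c : ℝ) (v : V) :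
    |a + inner ℝ b v + c * ‖v‖ ^ 2| ≤ (|a| + ‖b‖ + |c|) * (1 + ‖v‖ ^ 2) := by
  have h1 := abs_real_inner_le_norm b v
  have h2 : ‖b‖ * ‖v‖ ≤ ‖b‖ * (1 + ‖v‖ ^ 2) := by
    gcongr; nlinarith [sq_nonneg (‖v‖ - 1)]
  have h3 : |c * ‖v‖ ^ 2| = |c| * ‖v‖ ^ 2 := by rw [abs_mul, abs_of_nonneg (sq_nonneg ‖v‖)]
  have h4 := abs_add_three a (inner ℝ b v) (c * ‖v‖ ^ 2)
  nlinarith [mul_nonneg (abs_nonneg a) (sq_nonneg ‖v‖), abs_nonneg c]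

lemma integrable_poly_mul {φ : V → ℝ} (hφ : Measurable φ) {C : ℝ}
    (hC : ∀ v, |φ v| ≤ C * (1 + ‖v‖ ^ 2) ^ 2) : Integrable fun v => φ v * maxwellian v := by
  have i : Integrable fun v : V => C * (‖v‖ ^ 0 * maxwellian v + 2 * (‖v‖ ^ 2 * maxwellian v)
      + ‖v‖ ^ 4 * maxwellian v) :=
    (((integrable_pow_mul_maxwellian 0).add ((integrable_pow_mul_maxwellian 2).const_mul 2)).add
      (integrable_pow_mul_maxwellian 4)).const_mul C
  refine i.mono' (hφ.mul measurable_maxwellian).aestronglyMeasurable (ae_of_all _ fun v => ?_)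
  rw [Real.norm_eq_abs, abs_mul, abs_of_pos (maxwellian_pos v)]
  calc _ ≤ C * (1 + ‖v‖ ^ 2) ^ 2 * maxwellian v :=
        mul_le_mul_of_nonneg_right (hC v) (maxwellian_pos v).le
    _ = _ := by ring

lemma setIntegral_odd {R : ℝ≥0∞} {φ : V → ℝ} (hφ : ∀ v, φ (-v) = -φ v) :
    ∫ v in cball R, φ v = 0 := by
  have h : ∫ v, (cball R).indicator φ (-v) = ∫ v, (cball R).indicator φ v :=
    integral_neg_eq_self _ _
  have e : ∀ v, (cball R).indicator φ (-v) = -(cball R).indicator φ v := by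
    intro v
    have hm : -v ∈ cball R ↔ v ∈ cball R := by simp [cball]
    by_cases hv : v ∈ cball R
    · rw [Set.indicator_of_mem hv, Set.indicator_of_mem (hm.2 hv), hφ]
    · rw [Set.indicator_of_notMem hv, Set.indicator_of_notMem (fun h => hv (hm.1 h)), neg_zero]
  simp_rw [e] at h
  rw [integral_neg] at h
  rw [← integral_indicator (measurableSet_cball R)]
  linarith

/-- Orthonormality and the span of e imply that p minus its projection is orthogonal to all of
`kernelSpan R`, whichever basis is used. Parity then removes the linear part of the projection. -/
lemma exists_proj_radial {R : ℝ≥0∞} (hR : 1 ≤ R) {e : Fin 5 → V → ℝ} (he : IsKernelBasis R e)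
    {u H : ℝ → ℝ} (h : IsProfile R u H) (hE : energy R u H < ∞) {p : V → ℝ}
    (hp : ∀ᵐ v ∂(volume.restrict (oball R)), p v = u ‖v‖ * maxwellian v ^ (1 / 2 : ℝ)) :
    ∃ a c : ℝ, (∀ᵐ v ∂(volume.restrict (oball R)),
        (p - proj R e p) v = (u ‖v‖ - (a + c * ‖v‖ ^ 2)) * maxwellian v ^ (1 / 2 : ℝ)) ∧
      ∀ α β : ℝ, ∫ v in cball R,
        (u ‖v‖ - (a + c * ‖v‖ ^ 2)) * (α + β * ‖v‖ ^ 2) * maxwellian v = 0 := by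
  have hp' := ae_restrict_cball_iff.2 hp
  have hker : ∀ a b c v, v ∈ cball R → kerFn R a b c v
      = (a + inner ℝ b v + c * ‖v‖ ^ 2) * maxwellian v ^ (1 / 2 : ℝ) := fun a b c v hv => by
    rw [kerFn, Set.indicator_of_mem hv]
  have hpk : ∀ a b c, IntegrableOn (fun v => p v * kerFn R a b c v) (cball R) := by
    intro a b c
    have h1 := h.integrableOn_mul hR hE (φ := fun v => a + inner ℝ b v + c * ‖v‖ ^ 2) (by fun_prop)
      (abs_kernel_poly_le a b c)
    refine h1.congr ?_
    filter_upwards [hp', ae_restrict_mem (measurableSet_cball R)] with v hv hvR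
    rw [hv, hker _ _ _ _ hvR]
    nth_rewrite 1 [← maxwellian_half_mul_self v]
    ring
  have hkk : ∀ a b c a' b' c',
      IntegrableOn (fun v => kerFn R a b c v * kerFn R a' b' c' v) (cball R) := by
    intro a b c a' b' c'
    have h1 := (integrable_poly_mul (φ := fun v => (a + inner ℝ b v + c * ‖v‖ ^ 2) *
      (a' + inner ℝ b' v + c' * ‖v‖ ^ 2)) (by fun_prop)
      (C := (|a| + ‖b‖ + |c|) * (|a'| + ‖b'‖ + |c'|)) (fun v => by
        rw [abs_mul]
        calc _ ≤ ((|a| + ‖b‖ + |c|) * (1 + ‖v‖ ^ 2)) * ((|a'| + ‖b'‖ + |c'|) * (1 + ‖v‖ ^ 2)) := by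
              gcongr
              · exact abs_kernel_poly_le a b c v
              · exact abs_kernel_poly_le a' b' c' v
          _ = _ := by ring)).integrableOn (s := cball R)
    refine h1.congr_fun (fun v hv => ?_) (measurableSet_cball R)
    simp only
    rw [hker _ _ _ _ hv, hker _ _ _ _ hv]
    nth_rewrite 1 [← maxwellian_half_mul_self v]
    ring
  have hmem : ∀ j, e j ∈ kernelSpan R := fun j => by
    rw [← he.span_eq]; exact Submodule.subset_span ⟨j, rfl⟩
  set P := proj R e p with hP
  have hPmem : P ∈ kernelSpan R := by
    have : P = ∑ j, (∫ w in cball R, p w * e j w) • e j := by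
      ext v; simp [hP, proj, mul_comm]
    rw [this]
    exact Submodule.sum_mem _ fun j _ => Submodule.smul_mem _ _ (hmem j)
  have hpi : ∀ k ∈ kernelSpan R, IntegrableOn (fun v => p v * k v) (cball R) := fun k hk => by
    obtain ⟨a, b, c, rfl⟩ := exists_kerFn hk
    exact hpk a b c
  have hki : ∀ k ∈ kernelSpan R, ∀ l ∈ kernelSpan R, IntegrableOn (fun v => k v * l v) (cball R) :=
    fun k hk l hl => by
    obtain ⟨a, b, c, rfl⟩ := exists_kerFn hk
    obtain ⟨a', b', c', rfl⟩ := exists_kerFn hl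
    exact hkk a b c a' b' c'
  have horth_e : ∀ j, ∫ v in cball R, (p v - P v) * e j v = 0 := by
    intro j
    have e1 : ∀ v, (p v - P v) * e j v = p v * e j v - ∑ l, (∫ w in cball R, p w * e l w) * (e l v * e j v) := by
      intro v
      simp only [hP, proj]
      rw [sub_mul, Finset.sum_mul]
      congr 1
      exact Finset.sum_congr rfl fun l _ => by ring
    simp_rw [e1]
    rw [integral_sub (hpi _ (hmem j))
      (integrable_finsetSum _ fun l _ => (hki _ (hmem l) _ (hmem j)).const_mul _),
      integral_finsetSum _ fun l _ => (hki _ (hmem l) _ (hmem j)).const_mul _]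
    simp_rw [integral_const_mul, he.orthonormal]
    simp
  have horth : ∀ k ∈ kernelSpan R, ∫ v in cball R, (p v - P v) * k v = 0 := by
    intro k hk
    rw [← he.span_eq] at hk
    obtain ⟨d, rfl⟩ := (Submodule.mem_span_range_iff_exists_fun ℝ).1 hk
    have e1 : ∀ v, (p v - P v) * (∑ j, d j • e j) v = ∑ j, d j * ((p v - P v) * e j v) := by
      intro v
      simp only [Finset.sum_apply, Pi.smul_apply, smul_eq_mul, Finset.mul_sum]
      exact Finset.sum_congr rfl fun l _ => by ring
    simp_rw [e1]
    rw [integral_finsetSum _ fun j _ => ?_]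
    · simp_rw [integral_const_mul, horth_e]; simp
    · have : IntegrableOn (fun v => (p v - P v) * e j v) (cball R) :=
        ((hpi _ (hmem j)).sub (hki _ hPmem _ (hmem j))).congr_fun
          (fun v _ => (sub_mul _ _ _).symm) (measurableSet_cball R)
      exact this.const_mul _
  obtain ⟨a, b, c, hPk⟩ := exists_kerFn hPmem
  have hrad : ∀ a' b' c', ∫ v in cball R,
      (u ‖v‖ - (a + inner ℝ b v + c * ‖v‖ ^ 2)) * (a' + inner ℝ b' v + c' * ‖v‖ ^ 2) * maxwellian v = 0 := by
    intro a' b' c'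
    rw [← horth _ (kerFn_mem R a' b' c')]
    refine integral_congr_ae ?_
    filter_upwards [hp', ae_restrict_mem (measurableSet_cball R)] with v hv hvR
    rw [hv, hPk, hker _ _ _ _ hvR, hker _ _ _ _ hvR]
    nth_rewrite 1 [← maxwellian_half_mul_self v]
    ring
  -- Test the orthogonality with the linear part b·v itself. Its products with radial functions are
  -- odd and integrate to zero, which leaves ∫ (b·v)² μ = 0.
  have hb0 : ∀ᵐ v ∂(volume.restrict (cball R)), inner ℝ b v = 0 := by
    have h1 := hrad 0 b 0
    have i1 : IntegrableOn (fun v => (u ‖v‖ - (a + c * ‖v‖ ^ 2)) * inner ℝ b v * maxwellian v) (cball R) := by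
      have j1 := h.integrableOn_mul hR hE (φ := fun v => 0 + inner ℝ b v + 0 * ‖v‖ ^ 2) (by fun_prop)
        (abs_kernel_poly_le 0 b 0)
      have j2 := (integrable_poly_mul (φ := fun v => (a + inner ℝ (0 : V) v + c * ‖v‖ ^ 2) *
        (0 + inner ℝ b v + 0 * ‖v‖ ^ 2)) (by fun_prop)
        (C := (|a| + ‖(0 : V)‖ + |c|) * (|0| + ‖b‖ + |0|)) (fun v => by
          rw [abs_mul]
          calc _ ≤ ((|a| + ‖(0 : V)‖ + |c|) * (1 + ‖v‖ ^ 2)) * ((|0| + ‖b‖ + |0|) * (1 + ‖v‖ ^ 2)) := by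
                gcongr
                · exact abs_kernel_poly_le a 0 c v
                · exact abs_kernel_poly_le 0 b 0 v
            _ = _ := by ring)).integrableOn (s := cball R)
      refine (j1.sub j2).congr_fun (fun v _ => ?_) (measurableSet_cball R)
      simp
      ring
    have i2 : IntegrableOn (fun v => inner ℝ b v ^ 2 * maxwellian v) (cball R) := by
      refine (integrable_poly_mul (φ := fun v => inner ℝ b v ^ 2) (by fun_prop) (C := ‖b‖ ^ 2)
        (fun v => ?_)).integrableOn
      have h1 := abs_real_inner_le_norm b v
      rw [abs_of_nonneg (sq_nonneg _)]
      calc inner ℝ b v ^ 2 = |inner ℝ b v| ^ 2 := (sq_abs _).symm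
        _ ≤ (‖b‖ * ‖v‖) ^ 2 := by gcongr
        _ = ‖b‖ ^ 2 * ‖v‖ ^ 2 := by ring
        _ ≤ ‖b‖ ^ 2 * (1 + ‖v‖ ^ 2) ^ 2 := by
          gcongr
          nlinarith [sq_nonneg ‖v‖, sq_nonneg (‖v‖ ^ 2)]
    have h2 : ∫ v in cball R, (u ‖v‖ - (a + c * ‖v‖ ^ 2)) * inner ℝ b v * maxwellian v = 0 := by
      apply setIntegral_odd
      intro v
      rw [norm_neg, inner_neg_right, maxwellian, maxwellian, norm_neg]
      ring
    have h3 : ∫ v in cball R, inner ℝ b v ^ 2 * maxwellian v = 0 := by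
      have e1 : ∫ v in cball R, (u ‖v‖ - (a + inner ℝ b v + c * ‖v‖ ^ 2)) *
            (0 + inner ℝ b v + 0 * ‖v‖ ^ 2) * maxwellian v
          = (∫ v in cball R, (u ‖v‖ - (a + c * ‖v‖ ^ 2)) * inner ℝ b v * maxwellian v)
            - ∫ v in cball R, inner ℝ b v ^ 2 * maxwellian v := by
        rw [← integral_sub i1 i2]
        congr 1; ext v; ring
      linarith
    rw [setIntegral_eq_zero_iff_of_nonneg_ae
      (ae_of_all _ fun v => mul_nonneg (sq_nonneg _) (maxwellian_pos v).le) i2] at h3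
    filter_upwards [h3] with v hv
    simpa [(maxwellian_pos v).ne'] using hv
  refine ⟨a, c, ?_, fun α β => ?_⟩
  · rw [← ae_restrict_cball_iff]
    filter_upwards [hp', hb0, ae_restrict_mem (measurableSet_cball R)] with v hv hbv hvR
    rw [Pi.sub_apply, hv, hPk, hker _ _ _ _ hvR, hbv]
    ring
  · rw [← hrad α 0 β]
    refine integral_congr_ae ?_
    filter_upwards [hb0] with v hbv
    rw [hbv]; simp

/-! ### Perturbation of profiles by radial kernel functions -/

lemma IsProfile.intervalIntegrable {R : ℝ≥0∞} {u H : ℝ → ℝ} (h : IsProfile R u H) {r s : ℝ}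
    (hr : 0 < r) (hrs : r ≤ s) (hs : s ∈ radii R) :
    IntervalIntegrable (fun t => t * H t) volume r s := by
  rw [intervalIntegrable_iff_integrableOn_Icc_of_le hrs]
  have h1 : IntegrableOn (fun t => t ^ 3 * H t) (Set.Icc r s) :=
    (h.integrable s hs).mono_set fun x hx => ⟨hr.trans_le hx.1, hx.2⟩
  have h3 : ContinuousOn (fun t : ℝ => (t ^ 2)⁻¹) (Set.Icc r s) := fun x hx =>
    ((continuousAt_id.pow 2).inv₀ (pow_ne_zero 2 (hr.trans_le hx.1).ne')).continuousWithinAt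
  refine (h1.continuousOn_mul h3 isCompact_Icc).congr_fun (fun t ht => ?_) measurableSet_Icc
  have := (hr.trans_le ht.1).ne'
  simp only
  field_simp

/-- The derivative of a + c r² is r · 2c, so kernel functions shift H by a constant, which the
quadratic form does not see. -/
lemma IsProfile.sub_kernel {R : ℝ≥0∞} {u H : ℝ → ℝ} (h : IsProfile R u H) (a c : ℝ) :
    IsProfile R (fun r => u r - (a + c * r ^ 2)) (fun r => H r - 2 * c) := by
  refine ⟨h.measurable.sub_const _, fun b hb => ?_, fun r s hr hrs hs => ?_⟩
  · have h1 : IntegrableOn (fun s : ℝ => s ^ 3 * (2 * c)) (Set.Ioc 0 b) :=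
      (by fun_prop : Continuous fun s : ℝ => s ^ 3 * (2 * c)).integrableOn_Ioc
    exact ((h.integrable b hb).sub h1).congr_fun (fun s _ => (mul_sub _ _ _).symm) measurableSet_Ioc
  · have h1 : ∫ t in r..s, t * (H t - 2 * c) = (∫ t in r..s, t * H t) - ∫ t in r..s, 2 * c * t := by
      rw [← intervalIntegral.integral_sub (h.intervalIntegrable hr hrs hs)
        ((by fun_prop : Continuous fun t : ℝ => 2 * c * t).intervalIntegrable _ _)]
      congr 1; ext t; ring
    rw [h1, ← h.ftc r s hr hrs hs, intervalIntegral.integral_const_mul, integral_id]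
    ring

lemma qform_sub_const (R : ℝ≥0∞) (H : ℝ → ℝ) (c : ℝ) : qform R (fun r => H r - c) = qform R H := by
  simp only [qform, sub_sub_sub_cancel_right]

/-- The parameter η is kept free: η = 1 is enough for the uniform bounds, while η → 0 keeps the
leading constant sharp in the transfer. -/
lemma energy_add_le {R : ℝ≥0∞} (u H : ℝ → ℝ) {u' H' : ℝ → ℝ} (hu' : Measurable u')
    (hH' : Measurable H') {η : ℝ} (hη : 0 < η) :
    energy R (fun r => u r + u' r) (fun r => H r + H' r)
      ≤ ENNReal.ofReal (1 + η) * energy R u H + ENNReal.ofReal (1 + 1 / η) * energy R u' H' := by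
  simp only [energy]
  rw [← lintegral_const_mul' _ _ ENNReal.ofReal_ne_top, ← lintegral_const_mul' _ _ ENNReal.ofReal_ne_top,
    ← lintegral_add_right _ (by fun_prop)]
  refine lintegral_mono fun v => ?_
  have hl := lam_nonneg R v
  have hm := (maxwellian_pos v).le
  rw [← ENNReal.ofReal_mul (by positivity), ← ENNReal.ofReal_mul (by positivity),
    ← ENNReal.ofReal_add (by positivity) (by positivity)]
  apply ENNReal.ofReal_le_ofReal
  have key : ∀ x y : ℝ, (x + y) ^ 2 ≤ (1 + η) * x ^ 2 + (1 + 1 / η) * y ^ 2 := by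
    intro x y
    have : (1 + η) * x ^ 2 + (1 + 1 / η) * y ^ 2 - (x + y) ^ 2 = (η * x - y) ^ 2 / η := by
      field_simp; ring
    have h2 : 0 ≤ (η * x - y) ^ 2 / η := by positivity
    linarith
  have k1 := key (H ‖v‖ - u ‖v‖) (H' ‖v‖ - u' ‖v‖)
  have k2 := key (u ‖v‖) (u' ‖v‖)
  have e : (H ‖v‖ + H' ‖v‖ - (u ‖v‖ + u' ‖v‖)) = (H ‖v‖ - u ‖v‖) + (H' ‖v‖ - u' ‖v‖) := by ring
  rw [e]
  calc lam R v * ((H ‖v‖ - u ‖v‖ + (H' ‖v‖ - u' ‖v‖)) ^ 2 + (u ‖v‖ + u' ‖v‖) ^ 2) * maxwellian v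
      ≤ lam R v * (((1 + η) * (H ‖v‖ - u ‖v‖) ^ 2 + (1 + 1 / η) * (H' ‖v‖ - u' ‖v‖) ^ 2)
        + ((1 + η) * u ‖v‖ ^ 2 + (1 + 1 / η) * u' ‖v‖ ^ 2)) * maxwellian v := by gcongr
    _ = _ := by ring

lemma exists_energy_kernel_le : ∃ C : ℝ, 0 < C ∧ ∀ (R : ℝ≥0∞) (a c : ℝ),
    energy R (fun r => a + c * r ^ 2) (fun _ => 2 * c) ≤ ENNReal.ofReal (C * (a ^ 2 + c ^ 2)) := by
  obtain ⟨C, hC, hl⟩ := exists_lam_le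
  have hi : Integrable fun v : V => (1 + ‖v‖ ^ 2) ^ 2 * maxwellian v :=
    integrable_poly_mul (φ := fun v => (1 + ‖v‖ ^ 2) ^ 2) (by fun_prop) (C := 1)
      (fun v => by rw [abs_of_nonneg (by positivity)]; linarith)
  have hI : 0 ≤ ∫ v : V, (1 + ‖v‖ ^ 2) ^ 2 * maxwellian v :=
    integral_nonneg fun v => mul_nonneg (by positivity) (maxwellian_pos v).le
  set I := ∫ v : V, (1 + ‖v‖ ^ 2) ^ 2 * maxwellian v with hIdef
  -- The integrand is at most 8 c² + 3 (a + c t)² with t = |v|², hence at most 11 (a² + c²)(1 + t)²;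
  -- 14 leaves room, and the added 1 ensures positivity.
  refine ⟨14 * C * I + 1, by positivity, fun R a c => ?_⟩
  have h1 : ∀ v : V, lam R v * ((2 * c - (a + c * ‖v‖ ^ 2)) ^ 2 + (a + c * ‖v‖ ^ 2) ^ 2) * maxwellian v
      ≤ 14 * C * (a ^ 2 + c ^ 2) * ((1 + ‖v‖ ^ 2) ^ 2 * maxwellian v) := by
    intro v
    have hw : wt ‖v‖ ≤ 1 := by
      unfold wt
      rw [div_le_one (by positivity)]
      nlinarith [norm_nonneg v, sq_nonneg ‖v‖, pow_nonneg (norm_nonneg v) 3]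
    have hlv : lam R v ≤ C := (hl R v).trans (by nlinarith)
    have hm := (maxwellian_pos v).le
    have hp : (2 * c - (a + c * ‖v‖ ^ 2)) ^ 2 + (a + c * ‖v‖ ^ 2) ^ 2
        ≤ 14 * (a ^ 2 + c ^ 2) * (1 + ‖v‖ ^ 2) ^ 2 := by
      have ht : 0 ≤ ‖v‖ ^ 2 := sq_nonneg _
      generalize ‖v‖ ^ 2 = t at ht
      have h2 : (a + c * t) ^ 2 ≤ (a ^ 2 + c ^ 2) * (1 + t ^ 2) := by nlinarith [sq_nonneg (a * t - c)]
      have h3 : 1 + t ^ 2 ≤ (1 + t) ^ 2 := by nlinarith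
      have h4 : (a + c * t) ^ 2 ≤ (a ^ 2 + c ^ 2) * (1 + t) ^ 2 :=
        h2.trans (mul_le_mul_of_nonneg_left h3 (by positivity))
      have h5 : (2 * c - (a + c * t)) ^ 2 ≤ 8 * c ^ 2 + 2 * (a + c * t) ^ 2 := by
        nlinarith [sq_nonneg (2 * c + (a + c * t))]
      have h6 : c ^ 2 ≤ (a ^ 2 + c ^ 2) * (1 + t) ^ 2 := by
        have : 1 ≤ (1 + t) ^ 2 := by nlinarith
        nlinarith [sq_nonneg a, sq_nonneg c]
      nlinarith
    calc _ ≤ C * (14 * (a ^ 2 + c ^ 2) * (1 + ‖v‖ ^ 2) ^ 2) * maxwellian v := by gcongr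
      _ = _ := by ring
  calc energy R (fun r => a + c * r ^ 2) (fun _ => 2 * c)
      ≤ ∫⁻ v in cball R, ENNReal.ofReal (14 * C * (a ^ 2 + c ^ 2) * ((1 + ‖v‖ ^ 2) ^ 2 * maxwellian v)) :=
        lintegral_mono fun v => ENNReal.ofReal_le_ofReal (h1 v)
    _ ≤ ∫⁻ v : V, ENNReal.ofReal (14 * C * (a ^ 2 + c ^ 2) * ((1 + ‖v‖ ^ 2) ^ 2 * maxwellian v)) :=
        setLIntegral_le_lintegral _ _
    _ = ENNReal.ofReal (14 * C * (a ^ 2 + c ^ 2) * I) := by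
        rw [← ofReal_integral_eq_lintegral_ofReal (hi.const_mul _)
          (ae_of_all _ fun v => mul_nonneg (by positivity)
            (mul_nonneg (by positivity) (maxwellian_pos v).le)), integral_const_mul]
    _ ≤ _ := ENNReal.ofReal_le_ofReal (by nlinarith [sq_nonneg a, sq_nonneg c])

lemma integrable_kernel_sq (a c : ℝ) :
    Integrable fun v : V => (a + c * ‖v‖ ^ 2) ^ 2 * maxwellian v := by
  refine integrable_poly_mul (φ := fun v => (a + c * ‖v‖ ^ 2) ^ 2) (by fun_prop)
    (C := (|a| + ‖(0 : V)‖ + |c|) ^ 2) fun v => ?_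
  have := abs_kernel_poly_le a 0 c v
  rw [inner_zero_left, add_zero] at this
  rw [abs_pow, ← mul_pow]
  gcongr

lemma volume_cball_one_pos : 0 < (volume : Measure V) (cball 1) := by
  refine lt_of_lt_of_le (Metric.measure_ball_pos volume (0 : V) one_pos) (measure_mono fun v hv => ?_)
  rw [mem_cball_iff, ← ENNReal.ofReal_one]
  exact ENNReal.ofReal_le_ofReal (mem_ball_zero_iff.1 hv).le

/-- The `L²(μ)` norm is a norm on the radial kernel functions, uniformly in the radius. -/
lemma exists_le_integral_kernel_sq : ∃ c₀ : ℝ, 0 < c₀ ∧ ∀ R : ℝ≥0∞, 1 ≤ R → ∀ a c : ℝ,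
    c₀ * (a ^ 2 + c ^ 2) ≤ ∫ v in cball R, (a + c * ‖v‖ ^ 2) ^ 2 * maxwellian v := by
  have hmono : ∀ R : ℝ≥0∞, 1 ≤ R → ∀ a c : ℝ, ∫ v in cball 1, (a + c * ‖v‖ ^ 2) ^ 2 * maxwellian v
      ≤ ∫ v in cball R, (a + c * ‖v‖ ^ 2) ^ 2 * maxwellian v := fun R hR a c =>
    setIntegral_mono_set (integrable_kernel_sq a c).integrableOn
      (ae_of_all _ fun v => mul_nonneg (sq_nonneg _) (maxwellian_pos v).le)
      (Eventually.of_forall fun _ hw => le_trans hw hR)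
  set m0 := ∫ v in cball 1, ‖v‖ ^ 0 * maxwellian v with hm0
  set m2 := ∫ v in cball 1, ‖v‖ ^ 2 * maxwellian v with hm2
  set m4 := ∫ v in cball 1, ‖v‖ ^ 4 * maxwellian v with hm4
  have hexp : ∀ a c : ℝ, ∫ v in cball 1, (a + c * ‖v‖ ^ 2) ^ 2 * maxwellian v
      = a ^ 2 * m0 + 2 * a * c * m2 + c ^ 2 * m4 := by
    intro a c
    have i0 := ((integrable_pow_mul_maxwellian 0).const_mul (a ^ 2)).integrableOn (s := cball 1)
    have i2 := ((integrable_pow_mul_maxwellian 2).const_mul (2 * a * c)).integrableOn (s := cball 1)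
    have i4 := ((integrable_pow_mul_maxwellian 4).const_mul (c ^ 2)).integrableOn (s := cball 1)
    have i02 : IntegrableOn (fun v : V => a ^ 2 * (‖v‖ ^ 0 * maxwellian v)
        + 2 * a * c * (‖v‖ ^ 2 * maxwellian v)) (cball 1) := i0.add i2
    rw [hm0, hm2, hm4, ← integral_const_mul, ← integral_const_mul, ← integral_const_mul,
      ← integral_add i0 i2, ← integral_add i02 i4]
    congr 1; ext v; ring
  have hpos : ∀ a c : ℝ, (a ≠ 0 ∨ c ≠ 0) → 0 < ∫ v in cball 1, (a + c * ‖v‖ ^ 2) ^ 2 * maxwellian v := by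
    intro a c hac
    rw [setIntegral_pos_iff_support_of_nonneg_ae
      (ae_of_all _ fun v => mul_nonneg (sq_nonneg _) (maxwellian_pos v).le)
      (integrable_kernel_sq a c).integrableOn]
    have hnull : volume {v : V | a + c * ‖v‖ ^ 2 = 0} = 0 := by
      by_cases hc : c = 0
      · have ha : a ≠ 0 := by tauto
        simp [hc, ha]
      · refine measure_mono_null (t := Metric.sphere (0 : V) (Real.sqrt (-a / c))) (fun v hv => ?_)
          (Measure.addHaar_sphere _ _ _)
        have hv' : a + c * ‖v‖ ^ 2 = 0 := hv
        have : ‖v‖ ^ 2 = -a / c := by field_simp; linarith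
        rw [mem_sphere_zero_iff_norm, ← this, Real.sqrt_sq (norm_nonneg v)]
    have hsup : cball 1 \ {v : V | a + c * ‖v‖ ^ 2 = 0} ⊆
        Function.support (fun v : V => (a + c * ‖v‖ ^ 2) ^ 2 * maxwellian v) ∩ cball 1 :=
      fun v hv => ⟨mul_ne_zero (pow_ne_zero 2 hv.2) (maxwellian_pos v).ne', hv.1⟩
    refine lt_of_lt_of_le ?_ (measure_mono hsup)
    rw [measure_sdiff_null hnull]
    exact volume_cball_one_pos
  have p0 : 0 < m0 := by
    have := hpos 1 0 (Or.inl one_ne_zero)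
    rw [hexp] at this
    linarith
  have p4 : 0 < m4 := by
    have := hpos 0 1 (Or.inr one_ne_zero)
    rw [hexp] at this
    linarith
  -- The Gram determinant of 1 and |v|² is positive: for (a, c) = (-m2, m0) the quadratic form
  -- equals m0 times the determinant.
  have pd : 0 < m0 * m4 - m2 ^ 2 := by
    have := hpos (-m2) m0 (Or.inr p0.ne')
    rw [hexp] at this
    have h2 : 0 < m0 * (m0 * m4 - m2 ^ 2) := by nlinarith
    exact (mul_pos_iff_of_pos_left p0).1 h2
  set D := m0 * m4 - m2 ^ 2 with hD
  -- Determinant over trace is a lower bound for the smallest eigenvalue of the Gram matrix.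
  refine ⟨D / (m0 + m4), by positivity, fun R hR a c => le_trans ?_ (hmono R hR a c)⟩
  rw [hexp, div_mul_eq_mul_div, div_le_iff₀ (by positivity)]
  have e : (a ^ 2 * m0 + 2 * a * c * m2 + c ^ 2 * m4) * (m0 + m4) - D * (a ^ 2 + c ^ 2)
      = (a * m0 + c * m2) ^ 2 + (a * m2 + c * m4) ^ 2 := by rw [hD]; ring
  nlinarith [sq_nonneg (a * m0 + c * m2), sq_nonneg (a * m2 + c * m4)]

lemma energy_sub_kernel_lt_top {R : ℝ≥0∞} {u H : ℝ → ℝ} (hE : energy R u H < ∞) (a c : ℝ) :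
    energy R (fun r => u r - (a + c * r ^ 2)) (fun r => H r - 2 * c) < ∞ := by
  obtain ⟨C, -, hC⟩ := exists_energy_kernel_le
  have h1 := energy_add_le (R := R) u H (u' := fun r => -a + -c * r ^ 2) (H' := fun _ => 2 * -c)
    (by fun_prop) (by fun_prop) one_pos
  have h2 := hC R (-a) (-c)
  have e1 : (fun r => u r - (a + c * r ^ 2)) = fun r => u r + (-a + -c * r ^ 2) := by ext r; ring
  have e2 : (fun r => H r - 2 * c) = fun r => H r + 2 * -c := by ext r; ring
  rw [e1, e2]
  exact h1.trans_lt (ENNReal.add_lt_top.2 ⟨ENNReal.mul_lt_top ENNReal.ofReal_lt_top hE,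
    ENNReal.mul_lt_top ENNReal.ofReal_lt_top (h2.trans_lt ENNReal.ofReal_lt_top)⟩)

/-- Reduction of the coercive estimate to profiles orthogonal to the radial kernel functions. -/
lemma coerciveAt_of_profile {R : ℝ≥0∞} (hR : 1 ≤ R) {δ : ℝ}
    (h : ∀ u H : ℝ → ℝ, IsProfile R u H → energy R u H < ∞ →
      (∀ α β : ℝ, ∫ v in cball R, u ‖v‖ * (α + β * ‖v‖ ^ 2) * maxwellian v = 0) →
      ENNReal.ofReal δ * energy R u H ≤ qform R H) : CoerciveAt R δ := by
  intro e he f hf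
  have hR0 : 0 < R := lt_of_lt_of_le one_pos hR
  obtain ⟨u, H, hp, hfu, hpu, hE⟩ := hf.exists_profile hR0
  obtain ⟨a, c, hac, horth⟩ := exists_proj_radial hR he hp hE hpu
  have hp' := hp.sub_kernel a c
  rw [quadForm_eq_qform hR0 hp hfu, ← qform_sub_const R H (2 * c), sigmaNormSq_eq_energy hR0 hp' hac]
  exact h _ _ hp' (energy_sub_kernel_lt_top hE a c) horth

/-! ### A Poincaré inequality for the kernel form -/

/-- The shell `{1/2 ≤ |v| ≤ 1}`. -/
def shell : Set V := {w | ‖w‖ ∈ Set.Icc (1 / 2 : ℝ) 1}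

lemma measurableSet_shell : MeasurableSet shell := measurable_norm measurableSet_Icc

lemma volume_shell_ne_zero : (volume : Measure V) shell ≠ 0 := by
  refine (lt_of_lt_of_le (Metric.measure_ball_pos volume
    (EuclideanSpace.single 0 (3 / 4) : V) (by norm_num : (0 : ℝ) < 1 / 4))
    (measure_mono fun w hw => ?_)).ne'
  rw [mem_ball_iff_norm] at hw
  have h1 : ‖(EuclideanSpace.single 0 (3 / 4) : V)‖ = 3 / 4 := by simp
  have h2 := norm_sub_norm_le (EuclideanSpace.single 0 (3 / 4) : V) w
  have h3 := norm_sub_norm_le w (EuclideanSpace.single 0 (3 / 4) : V)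
  rw [norm_sub_rev] at h2
  exact ⟨by linarith, by linarith⟩

lemma shell_subset_cball {R : ℝ≥0∞} (hR : 1 ≤ R) : shell ⊆ cball R := fun _ hw =>
  mem_cball_iff.2 ((ENNReal.ofReal_le_one.2 hw.2).trans hR)

lemma volume_shell_ne_top : (volume : Measure V) shell ≠ ∞ := by
  refine ((measure_mono (t := Metric.closedBall (0 : V) 1) fun w hw => ?_).trans_lt
    measure_closedBall_lt_top).ne
  exact mem_closedBall_zero_iff.2 hw.2

/-- For fixed v the difference of H depends on w only through |w|, so κ may be averaged over spheres
and bounded below by wt. The constant is 12π from that average, times 4 from |w| ≥ 1/2, times e from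
μ ≥ 1/e on the shell. -/
lemma lintegral_shell_le {R : ℝ≥0∞} (hR : 1 ≤ R) {H : ℝ → ℝ} (hH : Measurable H) (v : V) :
    ∫⁻ w in shell, ENNReal.ofReal (wt ‖v‖ * (H ‖v‖ - H ‖w‖) ^ 2 * maxwellian v)
      ≤ ENNReal.ofReal (48 * Real.exp 1 * Real.pi) * ∫⁻ w in cball R,
        ENNReal.ofReal (maxwellian v * maxwellian w * (kappa v w * (H ‖v‖ - H ‖w‖) ^ 2)) := by
  have hp := Real.pi_pos
  have hm := maxwellian_pos v
  have hw0 := wt_nonneg (norm_nonneg v)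
  set ρ : ℝ → ℝ≥0∞ := (Set.Icc (1 / 2 : ℝ) 1).indicator
    (fun r => ENNReal.ofReal (Real.exp (-r ^ 2) * (H ‖v‖ - H r) ^ 2)) with hρ
  have hρm : Measurable ρ := Measurable.indicator (by fun_prop) measurableSet_Icc
  have h := lintegral_kappa_ge ρ hρm
    (fun r hr => Set.indicator_of_notMem (fun h => by linarith [h.2]) _) v
  have h1 : ∀ w ∈ shell, ρ ‖w‖ = ENNReal.ofReal (maxwellian w * (H ‖v‖ - H ‖w‖) ^ 2) := fun w hw =>
    Set.indicator_of_mem (show ‖w‖ ∈ Set.Icc (1 / 2 : ℝ) 1 from hw) _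
  have h2 : ∀ w ∉ shell, ρ ‖w‖ = 0 := fun w hw =>
    Set.indicator_of_notMem (show ‖w‖ ∉ Set.Icc (1 / 2 : ℝ) 1 from hw) _
  calc ∫⁻ w in shell, ENNReal.ofReal (wt ‖v‖ * (H ‖v‖ - H ‖w‖) ^ 2 * maxwellian v)
      ≤ ∫⁻ w in shell, ENNReal.ofReal (48 * Real.exp 1 * Real.pi * maxwellian v) *
          (ENNReal.ofReal (wt ‖v‖ / (12 * Real.pi)) * (ENNReal.ofReal (‖w‖ ^ 2) * ρ ‖w‖)) := by
        refine setLIntegral_mono' measurableSet_shell fun w hw => ?_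
        have hmw := maxwellian_pos w
        rw [h1 w hw, ← ENNReal.ofReal_mul (by positivity), ← ENNReal.ofReal_mul (by positivity),
          ← ENNReal.ofReal_mul (by positivity)]
        apply ENNReal.ofReal_le_ofReal
        have e1 : 48 * Real.exp 1 * Real.pi * maxwellian v * (wt ‖v‖ / (12 * Real.pi) *
            (‖w‖ ^ 2 * (maxwellian w * (H ‖v‖ - H ‖w‖) ^ 2)))
            = wt ‖v‖ * (H ‖v‖ - H ‖w‖) ^ 2 * maxwellian v *
              (4 * ‖w‖ ^ 2 * (Real.exp 1 * maxwellian w)) := by field_simp; ring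
        rw [e1]
        refine le_mul_of_one_le_right (by positivity) ?_
        have h3 : 1 ≤ Real.exp 1 * maxwellian w := by
          rw [maxwellian, ← Real.exp_add]
          apply Real.one_le_exp
          nlinarith [hw.2, norm_nonneg w]
        have h4 : 1 ≤ 4 * ‖w‖ ^ 2 := by nlinarith [hw.1]
        nlinarith
    _ ≤ ∫⁻ w, ENNReal.ofReal (48 * Real.exp 1 * Real.pi * maxwellian v) *
          (ENNReal.ofReal (wt ‖v‖ / (12 * Real.pi)) * (ENNReal.ofReal (‖w‖ ^ 2) * ρ ‖w‖)) :=
        setLIntegral_le_lintegral _ _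
    _ = ENNReal.ofReal (48 * Real.exp 1 * Real.pi * maxwellian v) *
          (ENNReal.ofReal (wt ‖v‖ / (12 * Real.pi)) * ∫⁻ w : V, ENNReal.ofReal (‖w‖ ^ 2) * ρ ‖w‖) := by
        rw [lintegral_const_mul' _ _ ENNReal.ofReal_ne_top,
          lintegral_const_mul' _ _ ENNReal.ofReal_ne_top]
    _ ≤ ENNReal.ofReal (48 * Real.exp 1 * Real.pi * maxwellian v) *
          ∫⁻ w : V, ENNReal.ofReal (kappa v w) * ρ ‖w‖ := by gcongr
    _ = ENNReal.ofReal (48 * Real.exp 1 * Real.pi) *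
          ∫⁻ w : V, ENNReal.ofReal (maxwellian v) * (ENNReal.ofReal (kappa v w) * ρ ‖w‖) := by
        rw [lintegral_const_mul' _ _ ENNReal.ofReal_ne_top, ← mul_assoc,
          ← ENNReal.ofReal_mul (by positivity)]
    _ ≤ _ := by
        refine mul_le_mul' le_rfl ?_
        rw [← lintegral_indicator (measurableSet_cball R)]
        refine lintegral_mono fun w => ?_
        have hk := kappa_nonneg v w
        by_cases hw : w ∈ shell
        · rw [h1 w hw, Set.indicator_of_mem (shell_subset_cball hR hw), ← ENNReal.ofReal_mul hk,
            ← ENNReal.ofReal_mul hm.le]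
          apply le_of_eq; congr 1; ring
        · simp [h2 w hw]

lemma measurable_kappa_radial {H : ℝ → ℝ} (hH : Measurable H) :
    Measurable fun p : V × V => ENNReal.ofReal
      (maxwellian p.1 * maxwellian p.2 * (kappa p.1 p.2 * (H ‖p.1‖ - H ‖p.2‖) ^ 2)) := by
  have := measurable_kappa
  have := measurable_maxwellian
  fun_prop

/-- A Poincaré inequality for the form `qform`, with the value at one good radius subtracted. -/
lemma exists_poincare : ∃ C : ℝ, 0 < C ∧ ∀ (R : ℝ≥0∞) (H : ℝ → ℝ), 1 ≤ R → Measurable H →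
    ∃ s, ∫⁻ v in cball R, ENNReal.ofReal (wt ‖v‖ * (H ‖v‖ - H s) ^ 2 * maxwellian v)
      ≤ ENNReal.ofReal C * qform R H := by
  have hp := Real.pi_pos
  have hvol : 0 < (volume : Measure V).real shell :=
    ENNReal.toReal_pos volume_shell_ne_zero volume_shell_ne_top
  refine ⟨96 * Real.exp 1 * Real.pi / (volume : Measure V).real shell, by positivity,
    fun R H hR hH => ?_⟩
  have hmeas : Measurable fun p : V × V =>
      ENNReal.ofReal (wt ‖p.2‖ * (H ‖p.2‖ - H ‖p.1‖) ^ 2 * maxwellian p.2) := by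
    have := measurable_maxwellian
    fun_prop
  -- Some point of the shell does no worse than the average over the shell; its norm is the good
  -- radius. The constant 96 = 2 · 48 absorbs the factor ½ of the form.
  obtain ⟨x, hx, hle⟩ := exists_le_setLAverage volume_shell_ne_zero volume_shell_ne_top
    (f := fun w : V => ∫⁻ v in cball R, ENNReal.ofReal (wt ‖v‖ * (H ‖v‖ - H ‖w‖) ^ 2 * maxwellian v))
    hmeas.lintegral_prod_right'.aemeasurable
  refine ⟨‖x‖, hle.trans ?_⟩
  rw [setLAverage_eq, lintegral_lintegral_swap hmeas.aemeasurable]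
  have h1 : ∫⁻ v in cball R, ∫⁻ w in shell,
      ENNReal.ofReal (wt ‖v‖ * (H ‖v‖ - H ‖w‖) ^ 2 * maxwellian v)
      ≤ ENNReal.ofReal (96 * Real.exp 1 * Real.pi) * qform R H := by
    calc _ ≤ ∫⁻ v in cball R, ENNReal.ofReal (48 * Real.exp 1 * Real.pi) * ∫⁻ w in cball R,
          ENNReal.ofReal (maxwellian v * maxwellian w * (kappa v w * (H ‖v‖ - H ‖w‖) ^ 2)) :=
          lintegral_mono fun v => lintegral_shell_le hR hH v
      _ = _ := by
        have e : (96 * Real.exp 1 * Real.pi : ℝ) = 48 * Real.exp 1 * Real.pi * 2 := by ring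
        rw [lintegral_const_mul' _ _ ENNReal.ofReal_ne_top, qform, e,
          ENNReal.ofReal_mul (p := 48 * Real.exp 1 * Real.pi) (by positivity),
          ENNReal.ofReal_ofNat, mul_assoc (ENNReal.ofReal _) 2, ← mul_assoc 2, ENNReal.mul_inv_cancel (by norm_num) (by norm_num), one_mul]
  rw [ENNReal.ofReal_div_of_pos hvol, Measure.real, ENNReal.ofReal_toReal volume_shell_ne_top,
    ENNReal.div_eq_inv_mul, ENNReal.div_eq_inv_mul, mul_assoc]
  gcongr

/-! ### A Hardy inequality -/

/-- The Cauchy–Schwarz inequality for √α and |f|/√α, in [0, ∞] so that f need not be integrable. -/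
lemma ofReal_sq_integral_le {X : Type*} [MeasurableSpace X] {μ : Measure X} {f α : X → ℝ}
    (hf : AEMeasurable f μ) (hα : AEMeasurable α μ) (hpos : ∀ᵐ x ∂μ, 0 < α x) :
    ENNReal.ofReal ((∫ x, f x ∂μ) ^ 2)
      ≤ (∫⁻ x, ENNReal.ofReal (α x) ∂μ) * ∫⁻ x, ENNReal.ofReal (f x ^ 2 / α x) ∂μ := by
  have h1 : ENNReal.ofReal |∫ x, f x ∂μ| ≤ ∫⁻ x, ENNReal.ofReal (Real.sqrt (α x)) *
      ENNReal.ofReal (|f x| / Real.sqrt (α x)) ∂μ := by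
    rw [← Real.norm_eq_abs, ofReal_norm]
    refine (enorm_integral_le_lintegral_enorm _).trans (lintegral_mono_ae ?_)
    filter_upwards [hpos] with x hx
    have := Real.sqrt_pos.2 hx
    rw [← ENNReal.ofReal_mul (Real.sqrt_nonneg _), mul_div_cancel₀ _ this.ne', Real.enorm_eq_ofReal_abs]
  have h2 := ENNReal.lintegral_mul_le_Lp_mul_Lq μ (Real.HolderConjugate.two_two)
    (f := fun x => ENNReal.ofReal (Real.sqrt (α x)))
    (g := fun x => ENNReal.ofReal (|f x| / Real.sqrt (α x)))
    (by fun_prop) (by fun_prop)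
  have h3 := h1.trans h2
  have e1 : ∫⁻ x, ENNReal.ofReal (Real.sqrt (α x)) ^ (2 : ℝ) ∂μ = ∫⁻ x, ENNReal.ofReal (α x) ∂μ := by
    refine lintegral_congr_ae ?_
    filter_upwards [hpos] with x hx
    rw [ENNReal.rpow_two, ← ENNReal.ofReal_pow (Real.sqrt_nonneg _), Real.sq_sqrt hx.le]
  have e2 : ∫⁻ x, ENNReal.ofReal (|f x| / Real.sqrt (α x)) ^ (2 : ℝ) ∂μ
      = ∫⁻ x, ENNReal.ofReal (f x ^ 2 / α x) ∂μ := by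
    refine lintegral_congr_ae ?_
    filter_upwards [hpos] with x hx
    rw [ENNReal.rpow_two, ← ENNReal.ofReal_pow (by positivity), div_pow, Real.sq_sqrt hx.le, sq_abs]
  rw [e1, e2] at h3
  have h4 := pow_le_pow_left₀ (zero_le : (0 : ℝ≥0∞) ≤ _) h3 2
  rw [← ENNReal.ofReal_pow (abs_nonneg _), sq_abs, mul_pow, ← ENNReal.rpow_two, ← ENNReal.rpow_two,
    ← ENNReal.rpow_mul, ← ENNReal.rpow_mul] at h4
  norm_num at h4
  exact h4

lemma lintegral_indicator_swap {E : Set (ℝ × ℝ)} (hE : MeasurableSet E) {a b : ℝ → ℝ≥0∞}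
    (ha : Measurable a) (hb : Measurable b) :
    ∫⁻ r, a r * ∫⁻ t, E.indicator (fun p => b p.2) (r, t)
      = ∫⁻ t, b t * ∫⁻ r, E.indicator (fun p => a p.1) (r, t) := by
  have hm1 : Measurable (E.indicator fun p : ℝ × ℝ => b p.2) := Measurable.indicator (by fun_prop) hE
  have hm2 : Measurable (E.indicator fun p : ℝ × ℝ => a p.1) := Measurable.indicator (by fun_prop) hE
  have h1 : ∀ r, a r * ∫⁻ t, E.indicator (fun p => b p.2) (r, t)
      = ∫⁻ t, a r * E.indicator (fun p => b p.2) (r, t) := fun r =>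
    (lintegral_const_mul _ (by fun_prop)).symm
  have h2 : ∀ t, b t * ∫⁻ r, E.indicator (fun p => a p.1) (r, t)
      = ∫⁻ r, b t * E.indicator (fun p => a p.1) (r, t) := fun t =>
    (lintegral_const_mul _ (by fun_prop)).symm
  simp_rw [h1, h2]
  rw [lintegral_lintegral_swap (by fun_prop)]
  refine lintegral_congr fun t => lintegral_congr fun r => ?_
  by_cases h : (r, t) ∈ E
  · rw [Set.indicator_of_mem h, Set.indicator_of_mem h, mul_comm]
  · rw [Set.indicator_of_notMem h, Set.indicator_of_notMem h, mul_zero, mul_zero]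

lemma lintegral_Ioc_deriv_le {g g' : ℝ → ℝ} {a b : ℝ} (hab : a ≤ b)
    (hd : ∀ x ∈ Set.Icc a b, HasDerivAt g (g' x) x) (hc : ContinuousOn g' (Set.Icc a b))
    (h0 : ∀ x ∈ Set.Icc a b, 0 ≤ g' x) :
    ∫⁻ x in Set.Ioc a b, ENNReal.ofReal (g' x) = ENNReal.ofReal (g b - g a) := by
  have hi : IntervalIntegrable g' volume a b := hc.intervalIntegrable_of_Icc hab
  rw [← intervalIntegral.integral_eq_sub_of_hasDerivAt (by rwa [Set.uIcc_of_le hab]) hi,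
    intervalIntegral.integral_of_le hab, ofReal_integral_eq_lintegral_ofReal
    ((intervalIntegrable_iff_integrableOn_Ioc_of_le hab).1 hi)
    ((ae_restrict_iff' measurableSet_Ioc).2 (ae_of_all _ fun x hx => h0 x ⟨hx.1.le, hx.2⟩))]

lemma lintegral_Ici_gauss {t : ℝ} (ht : 0 ≤ t) :
    ∫⁻ r in Set.Ici t, ENNReal.ofReal (r * Real.exp (-r ^ 2 / 2)) = ENNReal.ofReal (Real.exp (-t ^ 2 / 2)) := by
  have hd : ∀ x : ℝ, HasDerivAt (fun r : ℝ => -Real.exp (-r ^ 2 / 2)) (x * Real.exp (-x ^ 2 / 2)) x := by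
    intro x
    have := ((((hasDerivAt_pow 2 x).neg).div_const 2).exp).neg
    refine this.congr_deriv ?_
    simp; ring
  have hl : Tendsto (fun r : ℝ => -Real.exp (-r ^ 2 / 2)) atTop (𝓝 (-0)) := by
    refine (Real.tendsto_exp_atBot.comp ?_).neg
    have : Tendsto (fun r : ℝ => r ^ 2 / 2) atTop atTop :=
      (tendsto_pow_atTop two_ne_zero).atTop_div_const two_pos
    refine (tendsto_neg_atTop_atBot.comp this).congr fun r => ?_
    simp only [Function.comp_apply]; ring
  have hpos : ∀ x ∈ Set.Ioi t, 0 ≤ x * Real.exp (-x ^ 2 / 2) := fun x hx =>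
    mul_nonneg (ht.trans (le_of_lt hx)) (Real.exp_pos _).le
  have hi := integrableOn_Ioi_deriv_of_nonneg' (fun x _ => hd x) hpos hl
  rw [setLIntegral_congr Ioi_ae_eq_Ici.symm, ← ofReal_integral_eq_lintegral_ofReal hi
    ((ae_restrict_iff' measurableSet_Ioi).2 (ae_of_all _ hpos)),
    integral_Ioi_of_hasDerivAt_of_nonneg' (fun x _ => hd x) hpos hl]
  congr 1; ring

/-- The weight t e^{t²/2} is the derivative of e^{t²/2}. It spends only half of the Gaussian, so a
factor e^{-r²/2} remains to integrate in r. -/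
lemma IsProfile.ofReal_sq_le_of_half_le {R : ℝ≥0∞} {u H : ℝ → ℝ} (h : IsProfile R u H)
    (h0 : u (1 / 2) = 0) {r : ℝ} (hr : r ∈ radii R) (h1 : 1 / 2 ≤ r) :
    ENNReal.ofReal (u r ^ 2) ≤ ENNReal.ofReal (Real.exp (r ^ 2 / 2)) *
      ∫⁻ t in Set.Ioc (1 / 2) r, ENNReal.ofReal (t * Real.exp (-t ^ 2 / 2) * H t ^ 2) := by
  have hH := h.measurable
  have e : u r = ∫ t in Set.Ioc (1 / 2) r, t * H t := by
    rw [← intervalIntegral.integral_of_le h1, ← h.ftc _ _ (by norm_num) h1 hr, h0, sub_zero]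
  rw [e]
  refine (ofReal_sq_integral_le (α := fun t => t * Real.exp (t ^ 2 / 2)) (by fun_prop) (by fun_prop)
    ?_).trans ?_
  · filter_upwards [ae_restrict_mem measurableSet_Ioc] with t ht
    have : 0 < t := by linarith [ht.1]
    positivity
  · refine mul_le_mul' ?_ (le_of_eq ?_)
    · rw [lintegral_Ioc_deriv_le (g := fun t => Real.exp (t ^ 2 / 2)) h1 (fun x _ => ?_)
        (by fun_prop) (fun x hx => ?_)]
      · exact ENNReal.ofReal_le_ofReal (by linarith [Real.exp_pos ((1 / 2 : ℝ) ^ 2 / 2)])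
      · have := (((hasDerivAt_pow 2 x).div_const 2).exp)
        refine this.congr_deriv ?_
        ring_nf
      · have : 0 < x := by linarith [hx.1]
        positivity
    · refine setLIntegral_congr_fun measurableSet_Ioc fun t ht => ?_
      have : 0 < t := by linarith [ht.1]
      have e2 : Real.exp (-t ^ 2 / 2) = (Real.exp (t ^ 2 / 2))⁻¹ := by rw [← Real.exp_neg]; ring_nf
      rw [e2]
      congr 1
      field_simp

/-- The weight t⁻² has integral 1/r - 2 ≤ 1/r over (r, 1/2]. -/
lemma IsProfile.ofReal_sq_le_of_le_half {R : ℝ≥0∞} (hR : 1 ≤ R) {u H : ℝ → ℝ} (h : IsProfile R u H)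
    (h0 : u (1 / 2) = 0) {r : ℝ} (hr : 0 < r) (h1 : r ≤ 1 / 2) :
    ENNReal.ofReal (u r ^ 2) ≤ ENNReal.ofReal (1 / r) *
      ∫⁻ t in Set.Ioc r (1 / 2), ENNReal.ofReal (t ^ 4 * H t ^ 2) := by
  have hH := h.measurable
  have hhalf : (1 / 2 : ℝ) ∈ radii R := ⟨by norm_num, lt_of_lt_of_le (by
    rw [ENNReal.ofReal_lt_one]; norm_num) hR⟩
  have e : u r ^ 2 = (∫ t in Set.Ioc r (1 / 2), t * H t) ^ 2 := by
    rw [← intervalIntegral.integral_of_le h1, ← h.ftc _ _ hr h1 hhalf, h0]; ring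
  rw [e]
  refine (ofReal_sq_integral_le (α := fun t => (t ^ 2)⁻¹) (by fun_prop) (by fun_prop) ?_).trans ?_
  · filter_upwards [ae_restrict_mem measurableSet_Ioc] with t ht
    have : 0 < t := hr.trans ht.1
    positivity
  · refine mul_le_mul' ?_ (le_of_eq ?_)
    · rw [lintegral_Ioc_deriv_le (g := fun t => -t⁻¹) h1 (fun x hx => ?_) (fun x hx => ?_)
        (fun x hx => by positivity)]
      · apply ENNReal.ofReal_le_ofReal; norm_num
      · have := (hasDerivAt_inv (hr.trans_le hx.1).ne').neg
        exact this.congr_deriv (neg_neg _)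
      · have := (hr.trans_le hx.1).ne'
        exact ((continuousAt_id.pow 2).inv₀ (pow_ne_zero 2 this)).continuousWithinAt
    · refine setLIntegral_congr_fun measurableSet_Ioc fun t ht => ?_
      have : 0 < t := hr.trans ht.1
      congr 1
      field_simp

lemma mem_oball_iff_norm_mem_radii {R : ℝ≥0∞} {v : V} (hv : v ≠ 0) : v ∈ oball R ↔ ‖v‖ ∈ radii R := by
  rw [mem_oball_iff]
  exact ⟨fun h => ⟨norm_pos_iff.2 hv, h⟩, fun h => h.2⟩

lemma lintegral_wt_polar (R : ℝ≥0∞) {H : ℝ → ℝ} (hH : Measurable H) :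
    ∫⁻ v in cball R, ENNReal.ofReal (wt ‖v‖ * H ‖v‖ ^ 2 * maxwellian v)
      = ENNReal.ofReal area * ∫⁻ r in Set.Ioi 0, ENNReal.ofReal (r ^ 2) * (radii R).indicator
        (fun r => ENNReal.ofReal (wt r * H r ^ 2 * Real.exp (-r ^ 2))) r := by
  rw [← lintegral_norm _ (Measurable.indicator (by fun_prop) (isOpen_radii R).measurableSet),
    Measure.restrict_congr_set (cball_ae_eq_oball R),
    ← lintegral_indicator (isOpen_oball R).measurableSet]
  refine lintegral_congr_ae ?_
  filter_upwards [ae_ne_zero] with v hv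
  by_cases hvR : v ∈ oball R
  · rw [Set.indicator_of_mem hvR, Set.indicator_of_mem ((mem_oball_iff_norm_mem_radii hv).1 hvR),
      maxwellian]
  · rw [Set.indicator_of_notMem hvR,
      Set.indicator_of_notMem (fun h => hvR ((mem_oball_iff_norm_mem_radii hv).2 h))]

/-- A Hardy inequality, uniform in the radius. -/
lemma IsProfile.hardy {R : ℝ≥0∞} (hR : 1 ≤ R) {u H : ℝ → ℝ} (h : IsProfile R u H) (h0 : u (1 / 2) = 0) :
    ∫⁻ v in cball R, ENNReal.ofReal (wt ‖v‖ * u ‖v‖ ^ 2 * maxwellian v)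
      ≤ ENNReal.ofReal 54 * ∫⁻ v in cball R, ENNReal.ofReal (wt ‖v‖ * H ‖v‖ ^ 2 * maxwellian v) := by
  have hH := h.measurable
  have hro : MeasurableSet (radii R) := (isOpen_radii R).measurableSet
  have ha := area_pos
  set E₁ : Set (ℝ × ℝ) := {p | (1 / 2 < p.2 ∧ p.2 ≤ p.1) ∧ p.1 ∈ radii R} with hE₁
  set E₂ : Set (ℝ × ℝ) := {p | (0 < p.1 ∧ p.1 < p.2) ∧ p.2 ≤ 1 / 2} with hE₂
  have mE₁ : MeasurableSet E₁ :=
    ((measurableSet_lt measurable_const measurable_snd).inter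
      (measurableSet_le measurable_snd measurable_fst)).inter (measurable_fst hro)
  have mE₂ : MeasurableSet E₂ :=
    ((measurableSet_lt measurable_const measurable_fst).inter
      (measurableSet_lt measurable_fst measurable_snd)).inter
      (measurableSet_le measurable_snd measurable_const)
  set b₁ : ℝ → ℝ≥0∞ := fun t => ENNReal.ofReal (t * Real.exp (-t ^ 2 / 2) * H t ^ 2) with hb₁
  set b₂ : ℝ → ℝ≥0∞ := fun t => ENNReal.ofReal (t ^ 4 * H t ^ 2) with hb₂
  have mb₁ : Measurable b₁ := by fun_prop
  have mb₂ : Measurable b₂ := by fun_prop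
  have mi₁ : Measurable fun r => ∫⁻ t, E₁.indicator (fun p => b₁ p.2) (r, t) :=
    Measurable.lintegral_prod_right' (f := E₁.indicator fun p => b₁ p.2)
      (Measurable.indicator (by fun_prop) mE₁)
  have mi₂ : Measurable fun r => ∫⁻ t, E₂.indicator (fun p => b₂ p.2) (r, t) :=
    Measurable.lintegral_prod_right' (f := E₂.indicator fun p => b₂ p.2)
      (Measurable.indicator (by fun_prop) mE₂)
  set G₁ : ℝ → ℝ≥0∞ := fun r => ENNReal.ofReal (wt r * Real.exp (-r ^ 2 / 2)) *
    ∫⁻ t, E₁.indicator (fun p => b₁ p.2) (r, t) with hG₁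
  set G₂ : ℝ → ℝ≥0∞ := fun r => ENNReal.ofReal (wt r * (1 / r)) *
    ∫⁻ t, E₂.indicator (fun p => b₂ p.2) (r, t) with hG₂
  set K : ℝ → ℝ≥0∞ := (radii R).indicator
    (fun r => ENNReal.ofReal (wt r * H r ^ 2 * Real.exp (-r ^ 2))) with hK
  have mK : Measurable K := Measurable.indicator (by fun_prop) hro
  have hhalf : (1 / 2 : ℝ) ∈ radii R := ⟨by norm_num, lt_of_lt_of_le (by
    rw [ENNReal.ofReal_lt_one]; norm_num) hR⟩
  -- The two pointwise Cauchy–Schwarz bounds, outside and inside radius 1/2; each is then integrated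
  -- in r first, by Tonelli.
  have hle : ∀ r ∈ radii R, ENNReal.ofReal (wt r * u r ^ 2 * Real.exp (-r ^ 2)) ≤ G₁ r + G₂ r := by
    intro r hr
    have hw := wt_nonneg hr.1.le
    rcases le_total (1 / 2) r with h1 | h1
    · refine le_trans ?_ le_self_add
      have e1 : wt r * u r ^ 2 * Real.exp (-r ^ 2)
          = (wt r * Real.exp (-r ^ 2 / 2) * Real.exp (-r ^ 2 / 2)) * u r ^ 2 := by
        rw [mul_assoc (wt r) (Real.exp _), ← Real.exp_add]; ring_nf
      rw [e1, ENNReal.ofReal_mul (by positivity)]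
      refine (mul_le_mul' le_rfl (h.ofReal_sq_le_of_half_le h0 hr h1)).trans (le_of_eq ?_)
      rw [← mul_assoc, ← ENNReal.ofReal_mul (by positivity), mul_assoc _ (Real.exp _) (Real.exp _),
        ← Real.exp_add, ← lintegral_indicator measurableSet_Ioc, hG₁]
      have e2 : -r ^ 2 / 2 + r ^ 2 / 2 = 0 := by ring
      rw [e2, Real.exp_zero, mul_one]
      refine congrArg _ (lintegral_congr fun t => ?_)
      by_cases ht : t ∈ Set.Ioc (1 / 2) r
      · rw [Set.indicator_of_mem ht, Set.indicator_of_mem (show (r, t) ∈ E₁ from ⟨ht, hr⟩)]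
      · rw [Set.indicator_of_notMem ht, Set.indicator_of_notMem (fun h : (r, t) ∈ E₁ => ht h.1)]
    · refine le_trans ?_ le_add_self
      have e1 : wt r * u r ^ 2 * Real.exp (-r ^ 2) ≤ wt r * u r ^ 2 :=
        mul_le_of_le_one_right (by positivity) (Real.exp_le_one_iff.2 (by nlinarith [sq_nonneg r]))
      refine (ENNReal.ofReal_le_ofReal e1).trans ?_
      rw [ENNReal.ofReal_mul hw]
      refine (mul_le_mul' le_rfl (h.ofReal_sq_le_of_le_half hR h0 hr.1 h1)).trans (le_of_eq ?_)
      rw [← mul_assoc, ← ENNReal.ofReal_mul hw, ← lintegral_indicator measurableSet_Ioc, hG₂]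
      refine congrArg _ (lintegral_congr fun t => ?_)
      by_cases ht : t ∈ Set.Ioc r (1 / 2)
      · rw [Set.indicator_of_mem ht, Set.indicator_of_mem (show (r, t) ∈ E₂ from ⟨⟨hr.1, ht.1⟩, ht.2⟩)]
      · rw [Set.indicator_of_notMem ht,
          Set.indicator_of_notMem (fun h : (r, t) ∈ E₂ => ht ⟨h.1.2, h.2⟩)]
  have hKint : ∫⁻ v in cball R, ENNReal.ofReal (wt ‖v‖ * H ‖v‖ ^ 2 * maxwellian v)
      = ENNReal.ofReal area * ∫⁻ r in Set.Ioi 0, ENNReal.ofReal (r ^ 2) * K r :=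
    lintegral_wt_polar R hH
  -- Since r² wt(r) ≤ r, the integral over r ≥ t is at most e^{-t²/2}. The constant 27 comes from 1
  -- + t ≤ 3t for t > 1/2.
  have hone : ∫⁻ r in Set.Ioi 0, ENNReal.ofReal (r ^ 2) * G₁ r
      ≤ ENNReal.ofReal 27 * ∫⁻ r in Set.Ioi 0, ENNReal.ofReal (r ^ 2) * K r := by
    calc _ ≤ ∫⁻ r, ENNReal.ofReal (r ^ 2) * G₁ r := setLIntegral_le_lintegral _ _
      _ = ∫⁻ r, ENNReal.ofReal (r ^ 2 * (wt r * Real.exp (-r ^ 2 / 2))) *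
            ∫⁻ t, E₁.indicator (fun p => b₁ p.2) (r, t) := by
          refine lintegral_congr fun r => ?_
          rw [hG₁, ENNReal.ofReal_mul (sq_nonneg r), mul_assoc]
      _ = ∫⁻ t, b₁ t * ∫⁻ r, E₁.indicator
            (fun p => ENNReal.ofReal (p.1 ^ 2 * (wt p.1 * Real.exp (-p.1 ^ 2 / 2)))) (r, t) :=
          lintegral_indicator_swap mE₁
            (a := fun r => ENNReal.ofReal (r ^ 2 * (wt r * Real.exp (-r ^ 2 / 2)))) (by fun_prop) mb₁
      _ ≤ ∫⁻ t, ENNReal.ofReal 27 *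
            (Set.Ioi 0).indicator (fun t => ENNReal.ofReal (t ^ 2) * K t) t := by
          refine lintegral_mono fun t => ?_
          by_cases ht : t ∈ radii R ∧ 1 / 2 < t
          · have ht0 : 0 < t := ht.1.1
            have h1 : ∫⁻ r, E₁.indicator
                (fun p => ENNReal.ofReal (p.1 ^ 2 * (wt p.1 * Real.exp (-p.1 ^ 2 / 2)))) (r, t)
                ≤ ENNReal.ofReal (Real.exp (-t ^ 2 / 2)) := by
              rw [← lintegral_Ici_gauss ht0.le, ← lintegral_indicator measurableSet_Ici]
              refine lintegral_mono fun r => ?_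
              by_cases hr : (r, t) ∈ E₁
              · rw [Set.indicator_of_mem hr, Set.indicator_of_mem (show r ∈ Set.Ici t from hr.1.2)]
                apply ENNReal.ofReal_le_ofReal
                have hr0 : 0 < r := hr.2.1
                rw [← mul_assoc]
                gcongr
                unfold wt
                rw [mul_div_assoc', div_le_iff₀ (by positivity)]
                nlinarith [pow_pos hr0 2, pow_pos hr0 3]
              · rw [Set.indicator_of_notMem hr]; exact zero_le
            rw [Set.indicator_of_mem (show t ∈ Set.Ioi 0 from ht0), hK, Set.indicator_of_mem ht.1]
            refine (mul_le_mul' le_rfl h1).trans ?_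
            have hw := wt_nonneg ht0.le
            rw [hb₁, ← ENNReal.ofReal_mul (by positivity), ← ENNReal.ofReal_mul (by positivity),
              ← ENNReal.ofReal_mul (by positivity)]
            apply ENNReal.ofReal_le_ofReal
            have e1 : t * Real.exp (-t ^ 2 / 2) * H t ^ 2 * Real.exp (-t ^ 2 / 2)
                = t * (H t ^ 2 * Real.exp (-t ^ 2)) := by
              have : Real.exp (-t ^ 2) = Real.exp (-t ^ 2 / 2) * Real.exp (-t ^ 2 / 2) := by
                rw [← Real.exp_add]; ring_nf
              rw [this]; ring
            have h2 : t ≤ 27 * (t ^ 2 * wt t) := by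
              unfold wt
              rw [mul_div_assoc', mul_div_assoc', le_div_iff₀ (by positivity)]
              have h3 : (1 + t) ^ 3 ≤ (3 * t) ^ 3 := by gcongr; linarith [ht.2]
              nlinarith
            rw [e1]
            calc _ ≤ 27 * (t ^ 2 * wt t) * (H t ^ 2 * Real.exp (-t ^ 2)) := by gcongr
              _ = _ := by ring
          · have h1 : ∀ r, E₁.indicator
                (fun p => ENNReal.ofReal (p.1 ^ 2 * (wt p.1 * Real.exp (-p.1 ^ 2 / 2)))) (r, t) = 0 :=
              fun r => Set.indicator_of_notMem (fun hr : (r, t) ∈ E₁ =>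
                ht ⟨radii_of_le hr.2 (by linarith [hr.1.1]) hr.1.2, hr.1.1⟩) _
            simp only [h1, lintegral_zero, mul_zero, zero_le]
      _ = _ := by rw [lintegral_const_mul' _ _ ENNReal.ofReal_ne_top, lintegral_indicator measurableSet_Ioi]
  -- Here r² wt(r)/r ≤ 1, and for t ≤ 1/2 the bounds (1 + t)³ ≤ 8 and e^{-t²} ≥ 1/2 give the
  -- constant 16 ≤ 27.
  have htwo : ∫⁻ r in Set.Ioi 0, ENNReal.ofReal (r ^ 2) * G₂ r
      ≤ ENNReal.ofReal 27 * ∫⁻ r in Set.Ioi 0, ENNReal.ofReal (r ^ 2) * K r := by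
    calc _ ≤ ∫⁻ r, ENNReal.ofReal (r ^ 2) * G₂ r := setLIntegral_le_lintegral _ _
      _ = ∫⁻ r, ENNReal.ofReal (r ^ 2 * (wt r * (1 / r))) *
            ∫⁻ t, E₂.indicator (fun p => b₂ p.2) (r, t) := by
          refine lintegral_congr fun r => ?_
          rw [hG₂, ENNReal.ofReal_mul (sq_nonneg r), mul_assoc]
      _ = ∫⁻ t, b₂ t * ∫⁻ r, E₂.indicator
            (fun p => ENNReal.ofReal (p.1 ^ 2 * (wt p.1 * (1 / p.1)))) (r, t) :=
          lintegral_indicator_swap mE₂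
            (a := fun r => ENNReal.ofReal (r ^ 2 * (wt r * (1 / r)))) (by fun_prop) mb₂
      _ ≤ ∫⁻ t, ENNReal.ofReal 27 *
            (Set.Ioi 0).indicator (fun t => ENNReal.ofReal (t ^ 2) * K t) t := by
          refine lintegral_mono fun t => ?_
          by_cases ht : 0 < t ∧ t ≤ 1 / 2
          · have ht0 : 0 < t := ht.1
            have htR : t ∈ radii R := radii_of_le hhalf ht.1 ht.2
            have h1 : ∫⁻ r, E₂.indicator
                (fun p => ENNReal.ofReal (p.1 ^ 2 * (wt p.1 * (1 / p.1)))) (r, t) ≤ 1 := by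
              calc _ ≤ ∫⁻ r, (Set.Ioo (0 : ℝ) 1).indicator (fun _ => (1 : ℝ≥0∞)) r := by
                    refine lintegral_mono fun r => ?_
                    by_cases hr : (r, t) ∈ E₂
                    · have hr0 : 0 < r := hr.1.1
                      have hr1 : r < 1 := by
                        have h1 : r < t := hr.1.2
                        linarith [ht.2]
                      rw [Set.indicator_of_mem hr, Set.indicator_of_mem (show r ∈ Set.Ioo (0 : ℝ) 1 from ⟨hr0, hr1⟩)]
                      rw [ENNReal.ofReal_le_one]
                      unfold wt
                      have e1 : r ^ 2 * (r ^ 2 / (1 + r) ^ 3 * (1 / r)) = r ^ 3 / (1 + r) ^ 3 := by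
                        field_simp
                      simp only
                      rw [e1, div_le_one (by positivity)]
                      gcongr; linarith
                    · rw [Set.indicator_of_notMem hr]; exact zero_le
                _ = 1 := by rw [lintegral_indicator measurableSet_Ioo]; simp
            rw [Set.indicator_of_mem (show t ∈ Set.Ioi 0 from ht0), hK, Set.indicator_of_mem htR]
            refine (mul_le_mul' le_rfl h1).trans ?_
            have hw := wt_nonneg ht0.le
            rw [mul_one, hb₂, ← ENNReal.ofReal_mul (by positivity), ← ENNReal.ofReal_mul (by positivity)]
            apply ENNReal.ofReal_le_ofReal
            have h2 : t ^ 4 ≤ 27 * (t ^ 2 * wt t * Real.exp (-t ^ 2)) := by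
              have h3 : 1 / 2 ≤ Real.exp (-t ^ 2) := by
                have := Real.add_one_le_exp (-t ^ 2)
                nlinarith [ht.2]
              have h4 : t ^ 4 ≤ 8 * (t ^ 2 * wt t) := by
                unfold wt
                rw [mul_div_assoc', mul_div_assoc', le_div_iff₀ (by positivity)]
                have h3 : (1 + t) ^ 3 ≤ 2 ^ 3 := by gcongr; linarith [ht.2]
                nlinarith [pow_pos ht0 4]
              have h5 : 0 ≤ t ^ 2 * wt t := by positivity
              nlinarith
            calc _ ≤ 27 * (t ^ 2 * wt t * Real.exp (-t ^ 2)) * H t ^ 2 := by gcongr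
              _ = _ := by ring
          · have h1 : ∀ r, E₂.indicator
                (fun p => ENNReal.ofReal (p.1 ^ 2 * (wt p.1 * (1 / p.1)))) (r, t) = 0 :=
              fun r => Set.indicator_of_notMem (fun hr : (r, t) ∈ E₂ =>
                ht ⟨hr.1.1.trans hr.1.2, hr.2⟩) _
            simp only [h1, lintegral_zero, mul_zero, zero_le]
      _ = _ := by rw [lintegral_const_mul' _ _ ENNReal.ofReal_ne_top, lintegral_indicator measurableSet_Ioi]
  have mG₁ : Measurable G₁ := by fun_prop
  have mG₂ : Measurable G₂ := by fun_prop
  rw [hKint]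
  calc _ ≤ ∫⁻ v : V, (G₁ ‖v‖ + G₂ ‖v‖) := by
        rw [Measure.restrict_congr_set (cball_ae_eq_oball R),
          ← lintegral_indicator (isOpen_oball R).measurableSet]
        refine lintegral_mono_ae ?_
        filter_upwards [ae_ne_zero] with v hv
        by_cases hvR : v ∈ oball R
        · rw [Set.indicator_of_mem hvR]
          exact hle _ ((mem_oball_iff_norm_mem_radii hv).1 hvR)
        · rw [Set.indicator_of_notMem hvR]; exact zero_le
    _ = ENNReal.ofReal area * ((∫⁻ r in Set.Ioi 0, ENNReal.ofReal (r ^ 2) * G₁ r)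
          + ∫⁻ r in Set.Ioi 0, ENNReal.ofReal (r ^ 2) * G₂ r) := by
        rw [lintegral_norm (fun r => G₁ r + G₂ r) (by fun_prop), ← lintegral_add_left (by fun_prop)]
        simp_rw [mul_add]
    _ ≤ ENNReal.ofReal area * (ENNReal.ofReal 27 * (∫⁻ r in Set.Ioi 0, ENNReal.ofReal (r ^ 2) * K r)
          + ENNReal.ofReal 27 * ∫⁻ r in Set.Ioi 0, ENNReal.ofReal (r ^ 2) * K r) := by gcongr
    _ = _ := by
        rw [← add_mul, ← ENNReal.ofReal_add (by norm_num) (by norm_num)]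
        norm_num
        ring

/-! ### Coercivity with a constant uniform in the radius -/

lemma kernel_sq_le (a c t : ℝ) (ht : 0 ≤ t) : (a + c * t) ^ 2 ≤ (a ^ 2 + c ^ 2) * (1 + t) ^ 2 := by
  have h2 : (a + c * t) ^ 2 ≤ (a ^ 2 + c ^ 2) * (1 + t ^ 2) := by nlinarith [sq_nonneg (a * t - c)]
  have h3 : 1 + t ^ 2 ≤ (1 + t) ^ 2 := by nlinarith
  exact h2.trans (mul_le_mul_of_nonneg_left h3 (by positivity))

lemma energy_le_wt {R : ℝ≥0∞} {u H : ℝ → ℝ} (hH : Measurable H) {C : ℝ} (hC : 0 < C)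
    (hl : ∀ v, lam R v ≤ C * wt ‖v‖) :
    energy R u H ≤ ENNReal.ofReal (2 * C) * (∫⁻ v in cball R, ENNReal.ofReal (wt ‖v‖ * H ‖v‖ ^ 2 * maxwellian v))
      + ENNReal.ofReal (3 * C) * ∫⁻ v in cball R, ENNReal.ofReal (wt ‖v‖ * u ‖v‖ ^ 2 * maxwellian v) := by
  have := measurable_maxwellian
  rw [← lintegral_const_mul' _ _ ENNReal.ofReal_ne_top, ← lintegral_const_mul' _ _ ENNReal.ofReal_ne_top,
    ← lintegral_add_left (by fun_prop)]
  refine lintegral_mono fun v => ?_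
  have hm := (maxwellian_pos v).le
  have hw := wt_nonneg (norm_nonneg v)
  rw [← ENNReal.ofReal_mul (by positivity), ← ENNReal.ofReal_mul (by positivity),
    ← ENNReal.ofReal_add (by positivity) (by positivity)]
  apply ENNReal.ofReal_le_ofReal
  have h1 : (H ‖v‖ - u ‖v‖) ^ 2 + u ‖v‖ ^ 2 ≤ 2 * H ‖v‖ ^ 2 + 3 * u ‖v‖ ^ 2 := by
    nlinarith [sq_nonneg (H ‖v‖ + u ‖v‖)]
  calc _ ≤ C * wt ‖v‖ * (2 * H ‖v‖ ^ 2 + 3 * u ‖v‖ ^ 2) * maxwellian v := by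
        gcongr
        exact hl v
    _ = _ := by ring

/-- Cauchy–Schwarz with weight `dualWt`, which multiplies wt to (1 + r²)². The set s is arbitrary:
the first factor becomes small when s is the exterior of a large ball. -/
lemma ofReal_sq_integral_mul_kernel_le {s : Set V} {u : ℝ → ℝ}
    (hu : AEMeasurable (fun v : V => u ‖v‖) (volume.restrict s)) (a c : ℝ) :
    ENNReal.ofReal ((∫ v in s, u ‖v‖ * (a + c * ‖v‖ ^ 2) * maxwellian v) ^ 2)
      ≤ ENNReal.ofReal (∫ v in s, dualWt ‖v‖ * maxwellian v) * (ENNReal.ofReal (a ^ 2 + c ^ 2) *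
        ∫⁻ v in s, ENNReal.ofReal (wt ‖v‖ * u ‖v‖ ^ 2 * maxwellian v)) := by
  have hmm := measurable_maxwellian
  have hd : ∀ v : V, 0 ≤ dualWt ‖v‖ := fun v => by unfold dualWt; positivity
  have hdm : Measurable dualWt := by unfold dualWt; fun_prop
  refine (ofReal_sq_integral_le (α := fun v : V => dualWt ‖v‖ * maxwellian v)
    ((hu.mul (by fun_prop)).mul (by fun_prop)) (by fun_prop) ?_).trans (mul_le_mul' ?_ ?_)
  · filter_upwards [ae_restrict_of_ae ae_ne_zero] with v hv
    have := norm_pos_iff.2 hv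
    have := maxwellian_pos v
    unfold dualWt; positivity
  · rw [ofReal_integral_eq_lintegral_ofReal integrable_dualWt.integrableOn
      (ae_of_all _ fun v => mul_nonneg (hd v) (maxwellian_pos v).le)]
  · rw [← lintegral_const_mul' _ _ ENNReal.ofReal_ne_top]
    refine lintegral_mono_ae ?_
    filter_upwards [ae_restrict_of_ae ae_ne_zero] with v hv
    have hr := norm_pos_iff.2 hv
    have hm := maxwellian_pos v
    have hdp : 0 < dualWt ‖v‖ := by unfold dualWt; positivity
    rw [← ENNReal.ofReal_mul (by positivity)]
    apply ENNReal.ofReal_le_ofReal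
    rw [div_le_iff₀ (by positivity)]
    have e : (a ^ 2 + c ^ 2) * (wt ‖v‖ * u ‖v‖ ^ 2 * maxwellian v) * (dualWt ‖v‖ * maxwellian v)
        = u ‖v‖ ^ 2 * ((a ^ 2 + c ^ 2) * (1 + ‖v‖ ^ 2) ^ 2) * maxwellian v ^ 2 := by
      rw [← wt_mul_dualWt hr]; ring
    rw [e]
    simp only [Pi.mul_apply, mul_pow]
    gcongr
    exact kernel_sq_le _ _ _ (sq_nonneg _)

/-- Cancels one factor N; here N = a² + c² measures a kernel function whose squared L² norm has been
bounded below by a multiple of N. -/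
lemma ofReal_le_of_sq_le {c N J : ℝ} {W : ℝ≥0∞} (hc : 0 < c) (hN : 0 ≤ N)
    (h : ENNReal.ofReal ((c * N) ^ 2) ≤ ENNReal.ofReal J * (ENNReal.ofReal N * W)) :
    ENNReal.ofReal N ≤ ENNReal.ofReal (J / c ^ 2) * W := by
  rcases hN.eq_or_lt with h0 | hpos
  · rw [← h0]; simp
  have h3 : ENNReal.ofReal N * (ENNReal.ofReal (c ^ 2) * ENNReal.ofReal N)
      ≤ ENNReal.ofReal N * (ENNReal.ofReal J * W) := by
    calc _ = ENNReal.ofReal ((c * N) ^ 2) := by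
          rw [← ENNReal.ofReal_mul (by positivity), ← ENNReal.ofReal_mul (by positivity)]
          congr 1; ring
      _ ≤ _ := h
      _ = _ := by ring
  rw [ENNReal.mul_le_mul_iff_right (ENNReal.ofReal_pos.2 hpos).ne' ENNReal.ofReal_ne_top] at h3
  have e : ENNReal.ofReal (J / c ^ 2) * W = (ENNReal.ofReal J * W) / ENNReal.ofReal (c ^ 2) := by
    rw [ENNReal.ofReal_div_of_pos (by positivity), div_eq_mul_inv, div_eq_mul_inv]
    ring
  rw [e, ENNReal.le_div_iff_mul_le (Or.inl (ENNReal.ofReal_pos.2 (by positivity)).ne')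
    (Or.inl ENNReal.ofReal_ne_top), mul_comm]
  exact h3

/-- The coercive estimate for orthogonal profiles, uniformly in the radius. -/
lemma exists_energy_le_qform : ∃ K : ℝ, 0 < K ∧ ∀ (R : ℝ≥0∞) (u H : ℝ → ℝ), 1 ≤ R → IsProfile R u H →
    energy R u H < ∞ → (∀ α β : ℝ, ∫ v in cball R, u ‖v‖ * (α + β * ‖v‖ ^ 2) * maxwellian v = 0) →
    energy R u H ≤ ENNReal.ofReal K * qform R H := by
  obtain ⟨C, hC, hl⟩ := exists_lam_le
  obtain ⟨C₁, hC₁, hpoin⟩ := exists_poincare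
  obtain ⟨C₂, hC₂, hker⟩ := exists_energy_kernel_le
  obtain ⟨c₀, hc₀, hlow⟩ := exists_le_integral_kernel_sq
  set J := ∫ v : V, dualWt ‖v‖ * maxwellian v with hJ
  have hJ0 : 0 ≤ J := integral_nonneg fun v =>
    mul_nonneg (by unfold dualWt; positivity) (maxwellian_pos v).le
  refine ⟨2 * (164 * C * C₁) + 2 * (C₂ * (J * 54 / c₀ ^ 2) * C₁), by positivity,
    fun R u H hR h hE horth => ?_⟩
  have hR0 : 0 < R := lt_of_lt_of_le one_pos hR
  obtain ⟨s, hs⟩ := hpoin R H hR h.measurable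
  -- The choice of b turns H into H - H(s), and that of a makes the remainder w vanish at 1/2, as
  -- the Hardy inequality requires.
  set b := H s / 2 with hb
  set a := u (1 / 2) - b / 4 with ha
  have hw := h.sub_kernel a b
  have hw0 : (fun r => u r - (a + b * r ^ 2)) (1 / 2) = 0 := by simp only [ha]; ring
  have hwE := energy_sub_kernel_lt_top hE a b
  have hhar := hw.hardy hR hw0
  set w : ℝ → ℝ := fun r => u r - (a + b * r ^ 2) with hwdef
  set H' : ℝ → ℝ := fun r => H r - 2 * b with hH'def
  set P := ∫⁻ v in cball R, ENNReal.ofReal (wt ‖v‖ * H' ‖v‖ ^ 2 * maxwellian v) with hP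
  set W := ∫⁻ v in cball R, ENNReal.ofReal (wt ‖v‖ * w ‖v‖ ^ 2 * maxwellian v) with hW
  have hPQ : P ≤ ENNReal.ofReal C₁ * qform R H := by
    have e : 2 * b = H s := by rw [hb]; ring
    simp only [hP, hH'def, e]
    exact hs
  -- The constant is 164 = 2 + 3 · 54.
  have hEw : energy R w H' ≤ ENNReal.ofReal (164 * C) * P := by
    calc energy R w H' ≤ ENNReal.ofReal (2 * C) * P + ENNReal.ofReal (3 * C) * W :=
          energy_le_wt hw.measurable hC (hl R)
      _ ≤ ENNReal.ofReal (2 * C) * P + ENNReal.ofReal (3 * C) * (ENNReal.ofReal 54 * P) := by gcongr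
      _ = ENNReal.ofReal (164 * C) * P := by
          rw [← mul_assoc, ← add_mul, ← ENNReal.ofReal_mul (by positivity),
            ← ENNReal.ofReal_add (by positivity) (by positivity)]
          congr 2; ring
  -- Since u = w + (a + b r²) is orthogonal to a + b r², the size of the kernel part is read off
  -- from w alone.
  have hA : ∫ v in cball R, w ‖v‖ * (a + b * ‖v‖ ^ 2) * maxwellian v
      = -∫ v in cball R, (a + b * ‖v‖ ^ 2) ^ 2 * maxwellian v := by
    have i1 := hw.integrableOn_mul hR hwE (φ := fun v => a + inner ℝ (0 : V) v + b * ‖v‖ ^ 2)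
      (by fun_prop) (abs_kernel_poly_le a 0 b)
    simp only [inner_zero_left, add_zero] at i1
    have i2 := (integrable_kernel_sq a b).integrableOn (s := cball R)
    rw [eq_neg_iff_add_eq_zero, ← integral_add i1 i2, ← horth a b]
    congr 1; ext v
    simp only [hwdef]; ring
  have hN : ENNReal.ofReal (a ^ 2 + b ^ 2) ≤ ENNReal.ofReal (J * 54 / c₀ ^ 2) * P := by
    have h1 := ofReal_sq_integral_mul_kernel_le (hw.aestronglyMeasurable hR0).aemeasurable a b
    rw [hA, neg_sq] at h1
    have h2 : (c₀ * (a ^ 2 + b ^ 2)) ^ 2 ≤ (∫ v in cball R, (a + b * ‖v‖ ^ 2) ^ 2 * maxwellian v) ^ 2 :=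
      pow_le_pow_left₀ (by positivity) (hlow R hR a b) 2
    have h3 : ∫ v in cball R, dualWt ‖v‖ * maxwellian v ≤ J :=
      setIntegral_le_integral integrable_dualWt (ae_of_all _ fun v =>
        mul_nonneg (by unfold dualWt; positivity) (maxwellian_pos v).le)
    have h4 := ofReal_le_of_sq_le hc₀ (by positivity) (((ENNReal.ofReal_le_ofReal h2).trans h1).trans
      (mul_le_mul' (ENNReal.ofReal_le_ofReal h3) le_rfl))
    refine (h4.trans (mul_le_mul' le_rfl hhar)).trans (le_of_eq ?_)
    rw [← mul_assoc, ← ENNReal.ofReal_mul (by positivity)]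
    congr 2; ring
  have hEk : energy R (fun r => a + b * r ^ 2) (fun _ => 2 * b)
      ≤ ENNReal.ofReal (C₂ * (J * 54 / c₀ ^ 2)) * P := by
    refine (hker R a b).trans ?_
    rw [ENNReal.ofReal_mul hC₂.le, ENNReal.ofReal_mul hC₂.le, mul_assoc]
    gcongr
  have hsum := energy_add_le (R := R) w H' (u' := fun r => a + b * r ^ 2) (H' := fun _ => 2 * b)
    (by fun_prop) (by fun_prop) one_pos
  have e1 : (fun r => w r + (a + b * r ^ 2)) = u := by ext r; simp only [hwdef]; ring
  have e2 : (fun r => H' r + 2 * b) = H := by ext r; simp only [hH'def]; ring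
  have e3 : (1 : ℝ) + 1 = 2 := by norm_num
  have e4 : (1 : ℝ) + 1 / 1 = 2 := by norm_num
  rw [e1, e2, e3, e4] at hsum
  calc energy R u H ≤ _ := hsum
    _ ≤ ENNReal.ofReal 2 * (ENNReal.ofReal (164 * C) * (ENNReal.ofReal C₁ * qform R H))
        + ENNReal.ofReal 2 * (ENNReal.ofReal (C₂ * (J * 54 / c₀ ^ 2)) *
          (ENNReal.ofReal C₁ * qform R H)) := by
        gcongr
        · exact hEw.trans (by gcongr)
        · exact hEk.trans (by gcongr)
    _ = _ := by
        have hq : 0 ≤ C₂ * (J * 54 / c₀ ^ 2) := by positivity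
        rw [ENNReal.ofReal_add (by positivity) (by positivity),
          ENNReal.ofReal_mul (p := 2) (q := 164 * C * C₁) (by norm_num),
          ENNReal.ofReal_mul (p := 164 * C) (q := C₁) (by positivity),
          ENNReal.ofReal_mul (p := 2) (q := C₂ * (J * 54 / c₀ ^ 2) * C₁) (by norm_num),
          ENNReal.ofReal_mul (p := C₂ * (J * 54 / c₀ ^ 2)) (q := C₁) hq]
        ring

/-- The coercive estimate holds with a constant that does not depend on the radius. -/
lemma exists_coerciveAt : ∃ δ : ℝ, 0 < δ ∧ ∀ R : ℝ≥0∞, 1 ≤ R → CoerciveAt R δ := by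
  obtain ⟨K, hK, h⟩ := exists_energy_le_qform
  refine ⟨K⁻¹, inv_pos.2 hK, fun R hR => coerciveAt_of_profile hR fun u H hp hE ho => ?_⟩
  refine (mul_le_mul' le_rfl (h R u H hR hp hE ho)).trans (le_of_eq ?_)
  rw [← mul_assoc, ← ENNReal.ofReal_mul (inv_nonneg.2 hK.le), inv_mul_cancel₀ hK.ne', ENNReal.ofReal_one,
    one_mul]

/-! ### An orthonormal basis of the kernel in the whole space -/

lemma cball_top : cball ∞ = Set.univ := by ext v; simp [cball]

/-- The moments of the Maxwellian. -/
def moment (k : ℕ) : ℝ := ∫ v : V, ‖v‖ ^ k * maxwellian v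

lemma abs_coord_mul_le (i j : Fin 3) (v : V) : |v i * v j| ≤ 1 * (1 + ‖v‖ ^ 2) ^ 2 := by
  have h1 : |v i| ≤ ‖v‖ := PiLp.norm_apply_le v i
  have h2 : |v j| ≤ ‖v‖ := PiLp.norm_apply_le v j
  rw [abs_mul]
  have h3 : |v i| * |v j| ≤ ‖v‖ * ‖v‖ := mul_le_mul h1 h2 (abs_nonneg _) (norm_nonneg _)
  nlinarith [sq_nonneg ‖v‖, sq_nonneg (‖v‖ ^ 2)]

lemma integrable_coord_mul (i j : Fin 3) : Integrable fun v : V => v i * v j * maxwellian v :=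
  integrable_poly_mul (by fun_prop) (abs_coord_mul_le i j)

lemma integral_coord_mul_of_ne {i j : Fin 3} (hij : i ≠ j) :
    ∫ v : V, v i * v j * maxwellian v = 0 := by
  have h := integral_comp_iso (signIso i) (fun v => v i * v j * maxwellian v)
  simp only [signIso_apply, maxwellian, LinearIsometryEquiv.norm_map, hij.symm, if_true, if_false] at h
  have e : ∀ v : V, -v i * v j * Real.exp (-‖v‖ ^ 2) = -(v i * v j * Real.exp (-‖v‖ ^ 2)) := fun v => by ring
  simp_rw [e] at h
  rw [integral_neg] at h
  simp only [maxwellian]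
  linarith

lemma integral_coord_sq (i : Fin 3) : ∫ v : V, v i * v i * maxwellian v = moment 2 / 3 := by
  have h : ∀ i j : Fin 3, ∫ v : V, v i * v i * maxwellian v = ∫ v : V, v j * v j * maxwellian v := by
    intro i j
    rw [← integral_comp_iso (permIso (Equiv.swap i j)) (fun v => v i * v i * maxwellian v)]
    simp [maxwellian]
  have hs : moment 2 = (∫ v : V, v 0 * v 0 * maxwellian v) + (∫ v : V, v 1 * v 1 * maxwellian v)
      + ∫ v : V, v 2 * v 2 * maxwellian v := by
    have i01 : Integrable fun v : V => v 0 * v 0 * maxwellian v + v 1 * v 1 * maxwellian v :=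
      (integrable_coord_mul 0 0).add (integrable_coord_mul 1 1)
    rw [← integral_add (integrable_coord_mul 0 0) (integrable_coord_mul 1 1),
      ← integral_add i01 (integrable_coord_mul 2 2), moment]
    congr 1; ext v; rw [norm_sq_eq_coords]; ring
  rw [h 0 i, h 1 i, h 2 i] at hs
  linarith

lemma integral_inner_mul (b b' : V) :
    ∫ v : V, inner ℝ b v * inner ℝ b' v * maxwellian v = inner ℝ b b' * (moment 2 / 3) := by
  have e : ∀ v : V, inner ℝ b v * inner ℝ b' v * maxwellian v
      = ∑ i, ∑ j, b i * b' j * (v i * v j * maxwellian v) := by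
    intro v
    rw [inner_eq_coords, inner_eq_coords]
    simp [Fin.sum_univ_three]; ring
  simp_rw [e]
  have hi : ∀ i j : Fin 3, Integrable fun v : V => b i * b' j * (v i * v j * maxwellian v) :=
    fun i j => (integrable_coord_mul i j).const_mul _
  rw [integral_finsetSum _ fun i _ => integrable_finsetSum _ fun j _ => hi i j]
  have h2 : ∀ i, ∫ v : V, ∑ j, b i * b' j * (v i * v j * maxwellian v) = b i * b' i * (moment 2 / 3) := by
    intro i
    rw [integral_finsetSum _ fun j _ => hi i j, Finset.sum_eq_single i]
    · rw [integral_const_mul, integral_coord_sq]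
    · intro j _ hj
      rw [integral_const_mul, integral_coord_mul_of_ne hj.symm, mul_zero]
    · simp
  simp_rw [h2]
  rw [inner_eq_coords, Fin.sum_univ_three]; ring

/-- Products of a linear and a radial factor are odd and drop out; the linear factors pair through
the isotropic second moment. -/
lemma integral_kerFn_mul (a : ℝ) (b : V) (c a' : ℝ) (b' : V) (c' : ℝ) :
    ∫ v in cball ∞, kerFn ∞ a b c v * kerFn ∞ a' b' c' v
      = a * a' * moment 0 + (a * c' + a' * c) * moment 2 + c * c' * moment 4
        + inner ℝ b b' * (moment 2 / 3) := by
  have i0 := (integrable_pow_mul_maxwellian 0).const_mul (a * a')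
  have i2 := (integrable_pow_mul_maxwellian 2).const_mul (a * c' + a' * c)
  have i4 := (integrable_pow_mul_maxwellian 4).const_mul (c * c')
  have ib : Integrable fun v : V => inner ℝ b v * inner ℝ b' v * maxwellian v := by
    refine integrable_poly_mul (by fun_prop) (C := ‖b‖ * ‖b'‖) fun v => ?_
    rw [abs_mul]
    calc |inner ℝ b v| * |inner ℝ b' v| ≤ (‖b‖ * ‖v‖) * (‖b'‖ * ‖v‖) :=
          mul_le_mul (abs_real_inner_le_norm _ _) (abs_real_inner_le_norm _ _) (abs_nonneg _)
            (by positivity)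
      _ = ‖b‖ * ‖b'‖ * ‖v‖ ^ 2 := by ring
      _ ≤ _ := by
        gcongr
        nlinarith [sq_nonneg ‖v‖, sq_nonneg (‖v‖ ^ 2)]
  have io : Integrable fun v : V => ((a + c * ‖v‖ ^ 2) * inner ℝ b' v
      + (a' + c' * ‖v‖ ^ 2) * inner ℝ b v) * maxwellian v := by
    have key : ∀ (a : ℝ) (c : ℝ) (b : V) (v : V), |(a + c * ‖v‖ ^ 2) * inner ℝ b v|
        ≤ (|a| + |c|) * ‖b‖ * (1 + ‖v‖ ^ 2) ^ 2 := by
      intro a c b v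
      have h1 := abs_kernel_poly_le a 0 c v
      have h2 := abs_kernel_poly_le 0 b 0 v
      simp only [inner_zero_left, add_zero, norm_zero, zero_add, abs_zero, zero_mul] at h1 h2
      rw [abs_mul]
      calc _ ≤ ((|a| + |c|) * (1 + ‖v‖ ^ 2)) * (‖b‖ * (1 + ‖v‖ ^ 2)) := by gcongr
        _ = _ := by ring
    refine integrable_poly_mul (by fun_prop)
      (C := (|a| + |c|) * ‖b'‖ + (|a'| + |c'|) * ‖b‖) fun v => ?_
    exact ((abs_add_le _ _).trans (add_le_add (key a c b' v) (key a' c' b v))).trans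
      (le_of_eq (by ring))
  have ho : ∫ v : V, ((a + c * ‖v‖ ^ 2) * inner ℝ b' v
      + (a' + c' * ‖v‖ ^ 2) * inner ℝ b v) * maxwellian v = 0 := by
    have := setIntegral_odd (R := ∞) (φ := fun v : V => ((a + c * ‖v‖ ^ 2) * inner ℝ b' v
      + (a' + c' * ‖v‖ ^ 2) * inner ℝ b v) * maxwellian v) (fun v => by
        simp only [norm_neg, inner_neg_right, maxwellian]; ring)
    simpa [cball_top] using this
  have e : ∀ v, kerFn ∞ a b c v * kerFn ∞ a' b' c' v
      = a * a' * (‖v‖ ^ 0 * maxwellian v) + (a * c' + a' * c) * (‖v‖ ^ 2 * maxwellian v)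
        + c * c' * (‖v‖ ^ 4 * maxwellian v) + inner ℝ b v * inner ℝ b' v * maxwellian v
        + ((a + c * ‖v‖ ^ 2) * inner ℝ b' v + (a' + c' * ‖v‖ ^ 2) * inner ℝ b v) * maxwellian v := by
    intro v
    simp only [kerFn, cball_top, Set.indicator_univ]
    have hm := maxwellian_half_mul_self v
    generalize maxwellian v ^ (1 / 2 : ℝ) = y at hm
    rw [← hm]
    ring
  simp_rw [e]
  rw [cball_top, Measure.restrict_univ, integral_add ?_ io, integral_add ?_ ib, integral_add ?_ i4,
    integral_add i0 i2, ho, integral_inner_mul, integral_const_mul, integral_const_mul,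
    integral_const_mul, add_zero]
  · rfl
  · exact i0.add i2
  · exact (i0.add i2).add i4
  · exact ((i0.add i2).add i4).add ib

/-- The coercive estimate is quantified over orthonormal bases, so an assumed estimate at R = ∞ can
be used only once a basis exists. Finite radii need none, since there the estimate is only proved.
-/
lemma exists_isKernelBasis_top : ∃ e, IsKernelBasis ∞ e := by
  have hform : ∀ a c : ℝ, ∫ v in cball ∞, (a + c * ‖v‖ ^ 2) ^ 2 * maxwellian v
      = a * a * moment 0 + (a * c + a * c) * moment 2 + c * c * moment 4 := by
    intro a c
    have h := integral_kerFn_mul a 0 c a 0 c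
    rw [inner_zero_left, zero_mul, add_zero] at h
    rw [← h]
    simp only [kerFn, cball_top, Set.indicator_univ, inner_zero_left, add_zero]
    congr 1; ext v
    have hm := maxwellian_half_mul_self v
    generalize maxwellian v ^ (1 / 2 : ℝ) = y at hm
    rw [← hm]; ring
  obtain ⟨c₀, hc₀, hlow⟩ := exists_le_integral_kernel_sq
  have hpos : ∀ a c : ℝ, (a ≠ 0 ∨ c ≠ 0) →
      0 < a * a * moment 0 + (a * c + a * c) * moment 2 + c * c * moment 4 := by
    intro a c hac
    rw [← hform]
    refine lt_of_lt_of_le (mul_pos hc₀ ?_) (hlow ∞ le_top a c)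
    rcases hac with h | h <;> positivity
  have p0 : 0 < moment 0 := by simpa using hpos 1 0 (Or.inl one_ne_zero)
  have p2 : 0 < moment 2 := by
    have h : (0 : ℝ) < ∫ v : V, ‖v‖ ^ 2 * maxwellian v := by
      rw [integral_pos_iff_support_of_nonneg
        (fun v => mul_nonneg (by positivity) (maxwellian_pos v).le) (integrable_pow_mul_maxwellian 2)]
      have : ({0}ᶜ : Set V) ⊆ Function.support fun v : V => ‖v‖ ^ 2 * maxwellian v := fun v hv =>
        mul_ne_zero (pow_ne_zero 2 (norm_ne_zero_iff.2 hv)) (maxwellian_pos v).ne'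
      refine lt_of_lt_of_le ?_ (measure_mono this)
      rw [measure_compl (measurableSet_singleton _) (by simp)]
      simp
    exact h
  -- Gram–Schmidt: |v|² - κ is orthogonal to 1 in L²(μ), and the linear functions are orthogonal to
  -- both by parity.
  set κ := moment 2 / moment 0 with hκ
  have pd : 0 < κ * κ * moment 0 - 2 * κ * moment 2 + moment 4 := by
    have := hpos (-κ) 1 (Or.inr one_ne_zero)
    linarith
  have hsq : ∀ x : ℝ, 0 < x → (Real.sqrt x)⁻¹ * (Real.sqrt x)⁻¹ * x = 1 := by
    intro x hx
    have := Real.mul_self_sqrt hx.le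
    have h2 := (Real.sqrt_pos.2 hx).ne'
    rw [← mul_inv, this, inv_mul_cancel₀ hx.ne']
  set x₀ := (Real.sqrt (moment 0))⁻¹ with hx₀
  set x₁ := (Real.sqrt (moment 2 / 3))⁻¹ with hx₁
  set x₂ := (Real.sqrt (κ * κ * moment 0 - 2 * κ * moment 2 + moment 4))⁻¹ with hx₂
  have s₀ := hsq _ p0
  have s₁ := hsq (moment 2 / 3) (by positivity)
  have s₂ := hsq _ pd
  rw [← hx₀] at s₀
  rw [← hx₁] at s₁
  rw [← hx₂] at s₂
  have n₀ : x₀ ≠ 0 := by intro h; rw [h] at s₀; simp at s₀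
  have n₁ : x₁ ≠ 0 := by intro h; rw [h] at s₁; simp at s₁
  have n₂ : x₂ ≠ 0 := by intro h; rw [h] at s₂; simp at s₂
  have hκ0 : κ * moment 0 = moment 2 := by rw [hκ]; field_simp
  set e : Fin 5 → V → ℝ := fun j => kerFn ∞ (![x₀, 0, 0, 0, -(x₂ * κ)] j)
    (![0, EuclideanSpace.single 0 x₁, EuclideanSpace.single 1 x₁, EuclideanSpace.single 2 x₁, 0] j)
    (![0, 0, 0, 0, x₂] j) with he
  refine ⟨e, fun j k => ?_, le_antisymm ?_ ?_⟩
  · simp only [he]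
    rw [integral_kerFn_mul]
    fin_cases j <;> fin_cases k <;> simp [inner_eq_coords] <;>
      first
        | linear_combination s₀
        | linear_combination s₁
        | linear_combination s₂
        | linear_combination (-x₀ * x₂) * hκ0
  · rw [Submodule.span_le]
    rintro _ ⟨j, rfl⟩
    exact kerFn_mem _ _ _ _
  · intro k hk
    obtain ⟨a, b, c, rfl⟩ := exists_kerFn hk
    have hm : ∀ j, e j ∈ Submodule.span ℝ (Set.range e) := fun j => Submodule.subset_span ⟨j, rfl⟩
    have hk : kerFn ∞ a b c = ((a + κ * c) / x₀) • e 0 + (b 0 / x₁) • e 1 + (b 1 / x₁) • e 2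
        + (b 2 / x₁) • e 3 + (c / x₂) • e 4 := by
      ext v
      simp [he, kerFn, inner_eq_coords, cball_top]
      field_simp
      ring
    rw [hk]
    exact add_mem (add_mem (add_mem (add_mem (Submodule.smul_mem _ _ (hm 0)) (Submodule.smul_mem _ _ (hm 1)))
      (Submodule.smul_mem _ _ (hm 2))) (Submodule.smul_mem _ _ (hm 3))) (Submodule.smul_mem _ _ (hm 4))

/-! ### Extension of a profile to the whole space -/

/-- The coercive estimate in terms of profiles. -/
lemma CoerciveAt.exists_of_profile {R : ℝ≥0∞} (hR : 1 ≤ R) (hb : ∃ e, IsKernelBasis R e) {δ : ℝ}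
    (hδ : CoerciveAt R δ) {u H : ℝ → ℝ} (h : IsProfile R u H) (hE : energy R u H < ∞) :
    ∃ a c : ℝ, (∀ α β : ℝ, ∫ v in cball R,
        (u ‖v‖ - (a + c * ‖v‖ ^ 2)) * (α + β * ‖v‖ ^ 2) * maxwellian v = 0) ∧
      ENNReal.ofReal δ * energy R (fun r => u r - (a + c * r ^ 2)) (fun r => H r - 2 * c) ≤ qform R H := by
  obtain ⟨e, he⟩ := hb
  have hR0 : 0 < R := lt_of_lt_of_le one_pos hR
  set f : V → ℝ := fun v => u ‖v‖ * maxwellian v with hf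
  have hp : ∀ v, divSqrtMaxwellian f v = u ‖v‖ * maxwellian v ^ (1 / 2 : ℝ) := by
    intro v
    rw [divSqrtMaxwellian, hf, mul_assoc]
    congr 1
    nth_rewrite 1 [← Real.rpow_one (maxwellian v)]
    rw [← Real.rpow_add (maxwellian_pos v)]; norm_num
  have hp' := ae_of_all (volume.restrict (oball R)) hp
  have hfin : RadialFiniteEnergy R f := by
    refine ⟨⟨fun r => u r * Real.exp (-r ^ 2), fun v => rfl⟩,
      ⟨_, HasWeakGradOn.congr (isOpen_oball R).measurableSet
        ((h.hasWeakGradOn hR0).mul_exp (isOpen_oball R) (-1)) ?_ (ae_of_all _ fun _ => rfl)⟩, ?_⟩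
    · refine ae_of_all _ fun v => ?_
      simp [hf, maxwellian]
    · rwa [sigmaNormSq_eq_energy hR0 h hp']
  obtain ⟨a, c, hac, horth⟩ := exists_proj_radial hR he h hE hp'
  refine ⟨a, c, horth, ?_⟩
  have := hδ e he f hfin
  rwa [quadForm_eq_qform hR0 h (ae_of_all _ fun _ => rfl),
    sigmaNormSq_eq_energy hR0 (h.sub_kernel a c) hac] at this

lemma energy_congr {R : ℝ≥0∞} {u u' H H' : ℝ → ℝ} (hu : ∀ r ∈ radii R, u r = u' r)
    (hH : ∀ r ∈ radii R, H r = H' r) : energy R u H = energy R u' H' := by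
  refine lintegral_congr_ae (ae_restrict_cball_iff.2 ?_)
  filter_upwards [ae_restrict_mem (isOpen_oball R).measurableSet, ae_restrict_of_ae ae_ne_zero] with v hv h0
  have := (mem_oball_iff_norm_mem_radii h0).1 hv
  rw [hu _ this, hH _ this]

lemma qform_congr {R : ℝ≥0∞} {H H' : ℝ → ℝ} (hH : ∀ r ∈ radii R, H r = H' r) :
    qform R H = qform R H' := by
  have h : ∀ᵐ v ∂(volume.restrict (cball R)), H ‖v‖ = H' ‖v‖ := by
    refine ae_restrict_cball_iff.2 ?_
    filter_upwards [ae_restrict_mem (isOpen_oball R).measurableSet, ae_restrict_of_ae ae_ne_zero] with v hv h0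
    exact hH _ ((mem_oball_iff_norm_mem_radii h0).1 hv)
  simp only [qform]
  congr 1
  refine lintegral_congr_ae ?_
  filter_upwards [h] with v hv
  refine lintegral_congr_ae ?_
  filter_upwards [h] with w hw
  rw [hv, hw]

lemma energy_mono {R R' : ℝ≥0∞} (hR : R ≤ R') (u H : ℝ → ℝ) : energy R u H ≤ energy R' u H := by
  have hsub : cball R ⊆ cball R' := fun _ hw => le_trans hw hR
  refine (lintegral_mono fun v => ENNReal.ofReal_le_ofReal ?_).trans (lintegral_mono_set hsub)
  have := lam_mono hR v
  have := (maxwellian_pos v).le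
  gcongr

/-- The energy contains H - u and u; the factor 2 recovers H from them. -/
lemma exists_wt_le_energy : ∃ C : ℝ, 0 < C ∧ ∀ (R : ℝ≥0∞) (u H : ℝ → ℝ), 1 ≤ R →
    ∫⁻ v in cball R, ENNReal.ofReal (wt ‖v‖ * H ‖v‖ ^ 2 * maxwellian v) ≤ ENNReal.ofReal C * energy R u H ∧
    ∫⁻ v in cball R, ENNReal.ofReal (wt ‖v‖ * u ‖v‖ ^ 2 * maxwellian v) ≤ ENNReal.ofReal C * energy R u H := by
  obtain ⟨c, hc, hl⟩ := exists_le_lam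
  refine ⟨2 / c, by positivity, fun R u H hR => ?_⟩
  have key : ∀ (x : ℝ) (v : V), x ^ 2 ≤ 2 * ((H ‖v‖ - u ‖v‖) ^ 2 + u ‖v‖ ^ 2) →
      ENNReal.ofReal (wt ‖v‖ * x ^ 2 * maxwellian v) ≤ ENNReal.ofReal (2 / c) *
        ENNReal.ofReal (lam R v * ((H ‖v‖ - u ‖v‖) ^ 2 + u ‖v‖ ^ 2) * maxwellian v) := by
    intro x v hx
    have hm := (maxwellian_pos v).le
    have hw := wt_nonneg (norm_nonneg v)
    rw [← ENNReal.ofReal_mul (by positivity)]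
    apply ENNReal.ofReal_le_ofReal
    calc wt ‖v‖ * x ^ 2 * maxwellian v
        ≤ wt ‖v‖ * (2 * ((H ‖v‖ - u ‖v‖) ^ 2 + u ‖v‖ ^ 2)) * maxwellian v := by gcongr
      _ = 2 / c * ((c * wt ‖v‖) * ((H ‖v‖ - u ‖v‖) ^ 2 + u ‖v‖ ^ 2) * maxwellian v) := by field_simp
      _ ≤ _ := by
        gcongr
        exact hl R hR v
  constructor
  · rw [energy, ← lintegral_const_mul' _ _ ENNReal.ofReal_ne_top]
    exact lintegral_mono fun v => key _ _ (by nlinarith [sq_nonneg (H ‖v‖ - 2 * u ‖v‖)])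
  · rw [energy, ← lintegral_const_mul' _ _ ENNReal.ofReal_ne_top]
    exact lintegral_mono fun v => key _ _ (by nlinarith [sq_nonneg (H ‖v‖ - u ‖v‖)])

lemma half_mem_radii {R : ℝ≥0∞} (hR : 1 ≤ R) : (1 / 2 : ℝ) ∈ radii R :=
  ⟨by norm_num, lt_of_lt_of_le (by rw [ENNReal.ofReal_lt_one]; norm_num) hR⟩

lemma mem_radii_top {r : ℝ} : r ∈ radii ∞ ↔ 0 < r := by simp [radii]

/-- The extension by zero of `H` beyond the radius `R`. -/
def extGrad (R : ℝ≥0∞) (H : ℝ → ℝ) : ℝ → ℝ := (radii R).indicator H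

/-- The extension of `u` that is constant beyond the radius `R`. -/
def extProfile (R : ℝ≥0∞) (u H : ℝ → ℝ) (r : ℝ) : ℝ := u (1 / 2) + ∫ t in (1 / 2)..r, t * extGrad R H t

lemma extGrad_of_mem {R : ℝ≥0∞} {H : ℝ → ℝ} {r : ℝ} (hr : r ∈ radii R) : extGrad R H r = H r :=
  Set.indicator_of_mem hr _

lemma measurable_extGrad {R : ℝ≥0∞} {H : ℝ → ℝ} (hH : Measurable H) : Measurable (extGrad R H) :=
  hH.indicator (isOpen_radii R).measurableSet

lemma extGrad_wt (R : ℝ≥0∞) {H : ℝ → ℝ} (hH : Measurable H) :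
    ∫⁻ v in cball ∞, ENNReal.ofReal (wt ‖v‖ * extGrad R H ‖v‖ ^ 2 * maxwellian v)
      = ∫⁻ v in cball R, ENNReal.ofReal (wt ‖v‖ * H ‖v‖ ^ 2 * maxwellian v) := by
  rw [lintegral_wt_polar ∞ (measurable_extGrad hH), lintegral_wt_polar R hH]
  congr 1
  refine setLIntegral_congr_fun measurableSet_Ioi fun r hr => ?_
  rw [Set.indicator_of_mem (mem_radii_top.2 hr)]
  by_cases h : r ∈ radii R
  · rw [Set.indicator_of_mem h, extGrad_of_mem h]
  · rw [Set.indicator_of_notMem h, extGrad, Set.indicator_of_notMem h]; simp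

/-- A profile alone could blow up at the boundary radius. Finite energy prevents this, because its
weight is bounded below on compact subintervals of (0, ∞), the radius R included. -/
lemma IsProfile.integrableOn_extGrad {R : ℝ≥0∞} (hR : 1 ≤ R) {u H : ℝ → ℝ} (h : IsProfile R u H)
    (hE : energy R u H < ∞) {b : ℝ} (hb : 1 / 2 ≤ b) :
    IntegrableOn (fun t => t * extGrad R H t) (Set.Ioc (1 / 2) b) := by
  have hH := h.measurable
  have hG := measurable_extGrad (R := R) hH
  obtain ⟨C, -, hC⟩ := exists_wt_le_energy
  have h1 : ∫⁻ r in Set.Ioi 0, ENNReal.ofReal (r ^ 2) * (radii R).indicator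
        (fun r => ENNReal.ofReal (wt r * H r ^ 2 * Real.exp (-r ^ 2))) r < ∞ := by
    have h2 := ((hC R u H hR).1).trans_lt (ENNReal.mul_lt_top ENNReal.ofReal_lt_top hE)
    rw [lintegral_wt_polar R hH] at h2
    exact (ENNReal.mul_lt_top_iff.1 h2).elim (fun h => h.2) fun h => h.elim
      (fun h => absurd h (ENNReal.ofReal_pos.2 area_pos).ne') (fun h => by rw [h]; exact ENNReal.zero_lt_top)
  -- On (1/2, b] the weight wt(t) e^{-t²} is at least 1/M.
  set M : ℝ := 4 * (1 + b) ^ 3 * Real.exp (b ^ 2) with hM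
  have hM0 : 0 ≤ M := by positivity
  refine ⟨(by fun_prop : Measurable fun t => t * extGrad R H t).aestronglyMeasurable, ?_⟩
  calc ∫⁻ t in Set.Ioc (1 / 2) b, ‖t * extGrad R H t‖ₑ
      ≤ ∫⁻ t in Set.Ioc (1 / 2) b, (1 + ENNReal.ofReal M * (ENNReal.ofReal (t ^ 2) * (radii R).indicator
        (fun r => ENNReal.ofReal (wt r * H r ^ 2 * Real.exp (-r ^ 2))) t)) := by
        refine setLIntegral_mono' measurableSet_Ioc fun t ht => ?_
        have ht0 : 0 < t := by linarith [ht.1]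
        by_cases hR : t ∈ radii R
        · rw [Set.indicator_of_mem hR, extGrad_of_mem hR, Real.enorm_eq_ofReal_abs, ← ENNReal.ofReal_one,
            ← ENNReal.ofReal_mul (by positivity), ← ENNReal.ofReal_mul hM0]
          have hw := wt_nonneg ht0.le
          rw [← ENNReal.ofReal_add (by norm_num) (by positivity)]
          apply ENNReal.ofReal_le_ofReal
          have h3 : |t * H t| ≤ 1 + t ^ 2 * H t ^ 2 := by
            rw [abs_le]; constructor <;> nlinarith [sq_nonneg (t * H t - 1), sq_nonneg (t * H t + 1)]
          have h4 : 1 ≤ M * (wt t * Real.exp (-t ^ 2)) := by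
            have h5 : 1 ≤ Real.exp (b ^ 2) * Real.exp (-t ^ 2) := by
              rw [← Real.exp_add]
              apply Real.one_le_exp
              nlinarith [ht.2]
            have h6 : 1 ≤ 4 * (1 + b) ^ 3 * wt t := by
              unfold wt
              rw [mul_div_assoc', le_div_iff₀ (by positivity)]
              have h7 : (1 + t) ^ 3 ≤ (1 + b) ^ 3 := by gcongr; exact ht.2
              have h8 : 1 ≤ 4 * t ^ 2 := by nlinarith [ht.1]
              have h9 : 0 ≤ (1 + b) ^ 3 := by positivity
              nlinarith
            have e : M * (wt t * Real.exp (-t ^ 2))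
                = (4 * (1 + b) ^ 3 * wt t) * (Real.exp (b ^ 2) * Real.exp (-t ^ 2)) := by rw [hM]; ring
            rw [e]; nlinarith
          calc _ ≤ 1 + t ^ 2 * H t ^ 2 * 1 := by linarith
            _ ≤ 1 + t ^ 2 * H t ^ 2 * (M * (wt t * Real.exp (-t ^ 2))) := by gcongr
            _ = _ := by ring
        · rw [extGrad, Set.indicator_of_notMem hR]; simp
    _ ≤ (∫⁻ t in Set.Ioc (1 / 2) b, 1) + ENNReal.ofReal M * ∫⁻ r in Set.Ioi 0, ENNReal.ofReal (r ^ 2) *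
        (radii R).indicator (fun r => ENNReal.ofReal (wt r * H r ^ 2 * Real.exp (-r ^ 2))) r := by
        rw [lintegral_add_left measurable_const, lintegral_const_mul' _ _ ENNReal.ofReal_ne_top]
        refine add_le_add le_rfl (mul_le_mul' le_rfl (lintegral_mono_set fun t ht => ?_))
        exact lt_trans (by norm_num : (0 : ℝ) < 1 / 2) ht.1
    _ < ∞ := by
        refine ENNReal.add_lt_top.2 ⟨by simp, ENNReal.mul_lt_top ENNReal.ofReal_lt_top h1⟩

lemma IsProfile.intervalIntegrable_extGrad {R : ℝ≥0∞} (hR : 1 ≤ R) {u H : ℝ → ℝ} (h : IsProfile R u H)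
    (hE : energy R u H < ∞) {r : ℝ} (hr : 0 < r) :
    IntervalIntegrable (fun t => t * extGrad R H t) volume (1 / 2) r := by
  rcases le_total (1 / 2) r with h1 | h1
  · exact (intervalIntegrable_iff_integrableOn_Ioc_of_le h1).2 (h.integrableOn_extGrad hR hE h1)
  · refine ((h.intervalIntegrable hr h1 (half_mem_radii hR)).congr fun t ht => ?_).symm
    rw [Set.uIoc_of_le h1] at ht
    rw [extGrad_of_mem (radii_of_le (half_mem_radii hR) (hr.trans ht.1) ht.2)]

lemma IsProfile.extProfile_eq {R : ℝ≥0∞} (hR : 1 ≤ R) {u H : ℝ → ℝ} (h : IsProfile R u H) {r : ℝ}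
    (hr : r ∈ radii R) : extProfile R u H r = u r := by
  have e : ∫ t in (1 / 2)..r, t * extGrad R H t = ∫ t in (1 / 2)..r, t * H t := by
    refine intervalIntegral.integral_congr fun t ht => ?_
    rw [extGrad_of_mem]
    rcases le_total (1 / 2) r with h1 | h1
    · rw [Set.uIcc_of_le h1] at ht
      exact radii_of_le hr (by linarith [ht.1]) ht.2
    · rw [Set.uIcc_of_ge h1] at ht
      exact radii_of_le (half_mem_radii hR) (hr.1.trans_le ht.1) ht.2
  rw [extProfile, e]
  rcases le_total (1 / 2) r with h1 | h1
  · rw [← h.ftc _ _ (by norm_num) h1 hr]; ring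
  · rw [intervalIntegral.integral_symm, ← h.ftc _ _ hr.1 h1 (half_mem_radii hR)]; ring

lemma IsProfile.extend {R : ℝ≥0∞} (hR : 1 ≤ R) {u H : ℝ → ℝ} (h : IsProfile R u H)
    (hE : energy R u H < ∞) : IsProfile ∞ (extProfile R u H) (extGrad R H) := by
  refine ⟨measurable_extGrad h.measurable, fun b _ => ?_, fun r s hr hrs _ => ?_⟩
  · have h1 : IntegrableOn (fun s => s ^ 3 * extGrad R H s) (Set.Ioc 0 (1 / 2)) := by
      refine (h.integrable _ (half_mem_radii hR)).congr_fun (fun t ht => ?_) measurableSet_Ioc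
      simp only
      rw [extGrad_of_mem (radii_of_le (half_mem_radii hR) ht.1 ht.2)]
    have h2 : IntegrableOn (fun s => s ^ 3 * extGrad R H s) (Set.Icc (1 / 2) (max (1 / 2) b)) := by
      have h3 := (integrableOn_Icc_iff_integrableOn_Ioc enorm_ne_top).2 (h.integrableOn_extGrad hR hE (le_max_left (1 / 2) b))
      refine (h3.continuousOn_mul (g := fun s => s ^ 2) (by fun_prop) isCompact_Icc).congr_fun
        (fun t _ => ?_) measurableSet_Icc
      simp only
      ring
    refine (h1.union h2).mono_set fun t ht => ?_
    rcases le_total t (1 / 2) with h | h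
    · exact Or.inl ⟨ht.1, h⟩
    · exact Or.inr ⟨h, ht.2.trans (le_max_right _ _)⟩
  · rw [extProfile, extProfile, add_sub_add_left_eq_sub, intervalIntegral.integral_interval_sub_left
      (h.intervalIntegrable_extGrad hR hE (hr.trans_le hrs)) (h.intervalIntegrable_extGrad hR hE hr)]

lemma lintegral_wt_mul_const (s : Set V) (k : ℝ) :
    ∫⁻ v in s, ENNReal.ofReal (wt ‖v‖ * k ^ 2 * maxwellian v)
      = ENNReal.ofReal (k ^ 2) * ∫⁻ v in s, ENNReal.ofReal (wt ‖v‖ * maxwellian v) := by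
  rw [← lintegral_const_mul' _ _ ENNReal.ofReal_ne_top]
  refine lintegral_congr fun v => ?_
  rw [← ENNReal.ofReal_mul (sq_nonneg _)]
  congr 1; ring

lemma lintegral_wt_add_le {s : Set V} {f g h : ℝ → ℝ}
    (hg : AEMeasurable (fun v : V => g ‖v‖) (volume.restrict s))
    (hle : ∀ r, f r = g r + h r) :
    ∫⁻ v in s, ENNReal.ofReal (wt ‖v‖ * f ‖v‖ ^ 2 * maxwellian v)
      ≤ 2 * (∫⁻ v in s, ENNReal.ofReal (wt ‖v‖ * g ‖v‖ ^ 2 * maxwellian v))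
        + 2 * ∫⁻ v in s, ENNReal.ofReal (wt ‖v‖ * h ‖v‖ ^ 2 * maxwellian v) := by
  have := measurable_maxwellian
  have hwm : AEMeasurable (fun v : V => wt ‖v‖) (volume.restrict s) :=
    (measurable_wt.comp measurable_norm).aemeasurable
  have hgm : AEMeasurable (fun v : V => 2 * ENNReal.ofReal (wt ‖v‖ * g ‖v‖ ^ 2 * maxwellian v))
      (volume.restrict s) :=
    ((hwm.mul (hg.pow_const 2)).mul this.aemeasurable).ennreal_ofReal.const_mul 2
  have two : ∀ x : ℝ≥0∞, 2 * x = ENNReal.ofReal 2 * x := fun x => by simp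
  rw [← lintegral_const_mul' _ _ (by norm_num), ← lintegral_const_mul' _ _ (by norm_num),
    ← lintegral_add_left' hgm]
  refine lintegral_mono fun v => ?_
  have hm := (maxwellian_pos v).le
  have hw := wt_nonneg (norm_nonneg v)
  rw [two (ENNReal.ofReal _), two (ENNReal.ofReal _), ← ENNReal.ofReal_mul (by norm_num),
    ← ENNReal.ofReal_mul (by norm_num), ← ENNReal.ofReal_add (by positivity) (by positivity)]
  apply ENNReal.ofReal_le_ofReal
  rw [hle]
  calc _ ≤ wt ‖v‖ * (2 * g ‖v‖ ^ 2 + 2 * h ‖v‖ ^ 2) * maxwellian v := by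
        gcongr
        nlinarith [sq_nonneg (g ‖v‖ - h ‖v‖)]
    _ = _ := by ring

/-- A weighted `L²` bound on the whole space from the unit ball and the gradient. -/
lemma exists_wt_le_of_profile_top : ∃ K : ℝ≥0∞, K ≠ ∞ ∧ ∀ u H : ℝ → ℝ, IsProfile ∞ u H →
    ∫⁻ v in cball ∞, ENNReal.ofReal (wt ‖v‖ * u ‖v‖ ^ 2 * maxwellian v)
      ≤ K * ((∫⁻ v in cball 1, ENNReal.ofReal (wt ‖v‖ * u ‖v‖ ^ 2 * maxwellian v))
        + ∫⁻ v in cball ∞, ENNReal.ofReal (wt ‖v‖ * H ‖v‖ ^ 2 * maxwellian v)) := by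
  have hmm := measurable_maxwellian
  set J₁ := ∫⁻ v in cball 1, ENNReal.ofReal (wt ‖v‖ * maxwellian v) with hJ₁
  set J := ∫⁻ v in cball ∞, ENNReal.ofReal (wt ‖v‖ * maxwellian v) with hJ
  have hJtop : J ≠ ∞ := by
    have hi := integrable_pow_mul_maxwellian 0
    refine ((setLIntegral_le_lintegral _ _).trans_lt (lt_of_le_of_lt (lintegral_mono fun v => ?_)
      hi.hasFiniteIntegral)).ne
    have hm := (maxwellian_pos v).le
    rw [Real.enorm_eq_ofReal (by positivity)]
    apply ENNReal.ofReal_le_ofReal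
    have : wt ‖v‖ ≤ 1 := by
      unfold wt
      rw [div_le_one (by positivity)]
      nlinarith [norm_nonneg v, sq_nonneg ‖v‖, pow_nonneg (norm_nonneg v) 3]
    simp only [pow_zero, one_mul]
    exact mul_le_of_le_one_left hm this
  have hJ₁top : J₁ ≠ ∞ :=
    ((lintegral_mono_set fun v _ => by simp [cball_top]).trans_lt (lt_top_iff_ne_top.2 hJtop)).ne
  have hJ₁0 : J₁ ≠ 0 := by
    refine ((setLIntegral_pos_iff (by fun_prop)).2 ?_).ne'
    refine lt_of_lt_of_le volume_cball_one_pos ?_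
    rw [← measure_sdiff_null (measure_singleton (0 : V))]
    refine measure_mono fun v hv => ⟨?_, hv.1⟩
    have h0 : 0 < ‖v‖ := norm_pos_iff.2 hv.2
    have := maxwellian_pos v
    have hw : 0 < wt ‖v‖ := by unfold wt; positivity
    exact (ENNReal.ofReal_pos.2 (mul_pos hw this)).ne'
  refine ⟨108 + 216 * (J * J₁⁻¹), ENNReal.add_ne_top.2 ⟨by norm_num, ENNReal.mul_ne_top (by norm_num)
    (ENNReal.mul_ne_top hJtop (ENNReal.inv_ne_top.2 hJ₁0))⟩, fun u H h => ?_⟩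
  -- Hardy applies to u - k. The constant k is bounded through the unit ball, where both u and u - k
  -- are controlled.
  set k := u (1 / 2) with hk
  have hum : AEMeasurable (fun v : V => u ‖v‖) volume := by
    have := (h.aestronglyMeasurable ENNReal.zero_lt_top).aemeasurable
    rwa [cball_top, Measure.restrict_univ] at this
  set G := ∫⁻ v in cball ∞, ENNReal.ofReal (wt ‖v‖ * H ‖v‖ ^ 2 * maxwellian v) with hG
  set Y := ∫⁻ v in cball 1, ENNReal.ofReal (wt ‖v‖ * u ‖v‖ ^ 2 * maxwellian v) with hY
  have hX : ∫⁻ v in cball ∞, ENNReal.ofReal (wt ‖v‖ * (fun r => u r - k) ‖v‖ ^ 2 * maxwellian v)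
      ≤ 54 * G := by
    have h1 := (h.sub_kernel k 0).hardy le_top (by simp [hk])
    simpa using h1
  have hsub : ∫⁻ v in cball 1, ENNReal.ofReal (wt ‖v‖ * (fun r => u r - k) ‖v‖ ^ 2 * maxwellian v)
      ≤ 54 * G := (lintegral_mono_set fun v _ => by simp [cball_top]).trans hX
  have hkb : ENNReal.ofReal (k ^ 2) ≤ J₁⁻¹ * (2 * Y + 2 * (54 * G)) := by
    have h1 := lintegral_wt_add_le (s := cball 1) (f := fun _ => k) (g := u) (h := fun r => -(u r - k))
      hum.restrict (fun r => by ring)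
    simp only [neg_sq] at h1
    rw [lintegral_wt_mul_const] at h1
    have h2 := h1.trans (add_le_add le_rfl (mul_le_mul' le_rfl hsub))
    rw [mul_comm, ← div_eq_mul_inv]
    rw [ENNReal.le_div_iff_mul_le (Or.inl hJ₁0) (Or.inl hJ₁top)]
    exact h2
  have h1 := lintegral_wt_add_le (s := cball ∞) (f := u) (g := fun r => u r - k) (h := fun _ => k)
    (hum.restrict.sub_const _) (fun r => by ring)
  rw [lintegral_wt_mul_const] at h1
  calc _ ≤ 2 * (54 * G) + 2 * (J₁⁻¹ * (2 * Y + 2 * (54 * G)) * J) := h1.trans (by gcongr)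
    _ = 108 * G + (4 * (J * J₁⁻¹) * Y + 216 * (J * J₁⁻¹) * G) := by ring
    _ ≤ 108 * (Y + G) + (216 * (J * J₁⁻¹) * Y + 216 * (J * J₁⁻¹) * G) := by
        gcongr
        · exact le_add_self
        · norm_num
    _ = _ := by ring

/-! ### Comparison of the forms in a ball and in the whole space -/

lemma lintegral_kappa_compl (R : ℝ≥0∞) (v : V) :
    ∫⁻ w in (cball R)ᶜ, ENNReal.ofReal (kappa v w * maxwellian w) = ENNReal.ofReal (lam ∞ v - lam R v) := by
  have h := lintegral_add_compl (μ := volume) (fun w => ENNReal.ofReal (kappa v w * maxwellian w))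
    (measurableSet_cball R)
  have h2 := ofReal_lam ∞ v
  rw [cball_top, Measure.restrict_univ, ← h, ← ofReal_lam] at h2
  rw [ENNReal.ofReal_sub _ (lam_nonneg R v), h2, ENNReal.add_sub_cancel_left ENNReal.ofReal_ne_top]

/-- By symmetry the two mixed blocks are equal, and the block outside B vanishes. -/
lemma lintegral_lintegral_split {F : V → V → ℝ≥0∞} (hF : Measurable (Function.uncurry F))
    (hsymm : ∀ v w, F v w = F w v) {B : Set V} (hB : MeasurableSet B)
    (h0 : ∀ v ∈ Bᶜ, ∀ w ∈ Bᶜ, F v w = 0) :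
    ∫⁻ v, ∫⁻ w, F v w = (∫⁻ v in B, ∫⁻ w in B, F v w) + 2 * ∫⁻ v in B, ∫⁻ w in Bᶜ, F v w := by
  have m1 : Measurable fun v => ∫⁻ w in B, F v w := hF.lintegral_prod_right'
  have h3 : ∫⁻ v in Bᶜ, ∫⁻ w in B, F v w = ∫⁻ v in B, ∫⁻ w in Bᶜ, F v w := by
    rw [lintegral_lintegral_swap hF.aemeasurable]
    exact lintegral_congr fun v => lintegral_congr fun w => hsymm _ _
  have h4 : ∫⁻ v in Bᶜ, ∫⁻ w in Bᶜ, F v w = 0 := by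
    rw [setLIntegral_congr_fun hB.compl (g := fun _ => 0), lintegral_zero]
    intro v hv
    simp only
    rw [setLIntegral_congr_fun hB.compl (g := fun _ => 0), lintegral_zero]
    exact fun w hw => h0 v hv w hw
  have hsplit : ∀ v, ∫⁻ w, F v w = (∫⁻ w in B, F v w) + ∫⁻ w in Bᶜ, F v w := fun v =>
    (lintegral_add_compl _ hB).symm
  rw [← lintegral_add_compl _ hB]
  simp_rw [hsplit]
  rw [lintegral_add_left m1, lintegral_add_left m1, h3, h4]
  ring

/-- Outside the ball the extended H is zero, so pairs of outer points contribute nothing and a mixed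
pair contributes κ H(|v|)². Integrating out the outer point gives `lam ∞ v - lam R v`, and the two
mixed blocks cancel the factor ½. -/
lemma qform_top_extGrad_eq (R : ℝ≥0∞) {H : ℝ → ℝ} (hH : Measurable H) :
    qform ∞ (extGrad R H) = qform R H
      + ∫⁻ v in cball R, ENNReal.ofReal ((lam ∞ v - lam R v) * extGrad R H ‖v‖ ^ 2 * maxwellian v) := by
  have hzero : ∀ v ∈ (cball R)ᶜ, extGrad R H ‖v‖ = 0 := fun v hv =>
    Set.indicator_of_notMem (fun h : ‖v‖ ∈ radii R => hv (mem_cball_iff.2 h.2.le)) _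
  have h := lintegral_lintegral_split (F := fun v w => ENNReal.ofReal
      (maxwellian v * maxwellian w * (kappa v w * (extGrad R H ‖v‖ - extGrad R H ‖w‖) ^ 2)))
    (measurable_kappa_radial (measurable_extGrad hH))
    (fun v w => by rw [kappa_symm]; congr 1; ring) (measurableSet_cball R)
    (fun v hv w hw => by rw [hzero v hv, hzero w hw]; simp)
  have h2 : ∫⁻ v in cball R, ∫⁻ w in (cball R)ᶜ, ENNReal.ofReal
      (maxwellian v * maxwellian w * (kappa v w * (extGrad R H ‖v‖ - extGrad R H ‖w‖) ^ 2))
      = ∫⁻ v in cball R, ENNReal.ofReal ((lam ∞ v - lam R v) * extGrad R H ‖v‖ ^ 2 * maxwellian v) := by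
    refine lintegral_congr fun v => ?_
    have hp : 0 ≤ extGrad R H ‖v‖ ^ 2 * maxwellian v := mul_nonneg (sq_nonneg _) (maxwellian_pos v).le
    have e : (lam ∞ v - lam R v) * extGrad R H ‖v‖ ^ 2 * maxwellian v
        = extGrad R H ‖v‖ ^ 2 * maxwellian v * (lam ∞ v - lam R v) := by ring
    rw [e, ENNReal.ofReal_mul hp, ← lintegral_kappa_compl, ← lintegral_const_mul' _ _ ENNReal.ofReal_ne_top]
    refine setLIntegral_congr_fun (measurableSet_cball R).compl fun w hw => ?_
    rw [hzero w hw, ← ENNReal.ofReal_mul hp]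
    congr 1; ring
  rw [qform_congr (R := R) (H' := extGrad R H) fun r hr => (extGrad_of_mem hr).symm]
  simp only [qform, cball_top, Measure.restrict_univ]
  rw [h, h2, mul_add, ← mul_assoc 2⁻¹ 2, ENNReal.inv_mul_cancel (by norm_num) (by norm_num), one_mul]

lemma tendsto_pow_mul_exp_neg_sq :
    Tendsto (fun n : ℕ => (1 + (n : ℝ)) ^ 3 * Real.exp (-(n : ℝ) ^ 2 / 2)) atTop (𝓝 0) := by
  have h1 : Tendsto (fun n : ℕ => Real.exp (3 / 2) * ((1 + (n : ℝ)) ^ 3 * Real.exp (-(1 + (n : ℝ)))))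
      atTop (𝓝 (Real.exp (3 / 2) * 0)) :=
    ((Real.tendsto_pow_mul_exp_neg_atTop_nhds_zero 3).comp
      (tendsto_const_nhds.add_atTop tendsto_natCast_atTop_atTop)).const_mul _
  rw [mul_zero] at h1
  refine squeeze_zero (fun n => by positivity) (fun n => ?_) h1
  -- This is (n - 1)² ≥ 0 in the exponent.
  have : Real.exp (-(n : ℝ) ^ 2 / 2) ≤ Real.exp (3 / 2) * Real.exp (-(1 + (n : ℝ))) := by
    rw [← Real.exp_add]
    apply Real.exp_le_exp.2
    nlinarith [sq_nonneg ((n : ℝ) - 1)]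
  calc _ ≤ (1 + (n : ℝ)) ^ 3 * (Real.exp (3 / 2) * Real.exp (-(1 + (n : ℝ)))) := by gcongr
    _ = _ := by ring

/-- The defect of `lam` is at most C e^{-n²/2} |v|². In the ball of radius n, |v|² ≤ (1 + n)³
wt(|v|), so the relative loss is polynomial in n and the exponential wins. -/
lemma exists_lintegral_lam_sub_le : ∃ ε : ℕ → ℝ, Tendsto ε atTop (𝓝 0) ∧ (∀ n, 0 ≤ ε n) ∧
    ∀ n : ℕ, 1 ≤ n → ∀ u H : ℝ → ℝ,
      ∫⁻ v in cball n, ENNReal.ofReal ((lam ∞ v - lam n v) * H ‖v‖ ^ 2 * maxwellian v)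
        ≤ ENNReal.ofReal (ε n) * energy n u H := by
  obtain ⟨C, hC, hsub⟩ := exists_lam_top_sub_le
  obtain ⟨c, hc, hl⟩ := exists_le_lam
  refine ⟨fun n => 2 * C / c * ((1 + (n : ℝ)) ^ 3 * Real.exp (-(n : ℝ) ^ 2 / 2)), ?_,
    fun n => by positivity, fun n hn u H => ?_⟩
  · simpa using tendsto_pow_mul_exp_neg_sq.const_mul (2 * C / c)
  rw [energy, ← lintegral_const_mul' _ _ ENNReal.ofReal_ne_top]
  refine setLIntegral_mono' (measurableSet_cball _) fun v hv => ?_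
  rw [← ENNReal.ofReal_mul (by positivity)]
  apply ENNReal.ofReal_le_ofReal
  have hm := (maxwellian_pos v).le
  have hvn : ‖v‖ ≤ n := by
    rw [mem_cball_iff, ← ENNReal.ofReal_natCast] at hv
    exact (ENNReal.ofReal_le_ofReal_iff (Nat.cast_nonneg n)).1 hv
  have h1 := hsub n (Nat.cast_nonneg n) v
  rw [ENNReal.ofReal_natCast] at h1
  have h2 := hl n (by exact_mod_cast hn) v
  have h3 : ‖v‖ ^ 2 ≤ (1 + (n : ℝ)) ^ 3 * wt ‖v‖ := by
    unfold wt
    rw [mul_div_assoc', le_div_iff₀ (by positivity), mul_comm]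
    gcongr
  have h4 : H ‖v‖ ^ 2 ≤ 2 * ((H ‖v‖ - u ‖v‖) ^ 2 + u ‖v‖ ^ 2) := by
    nlinarith [sq_nonneg (H ‖v‖ - 2 * u ‖v‖)]
  have h0 : 0 ≤ lam ∞ v - lam n v := sub_nonneg.2 (lam_mono le_top v)
  have hw := wt_nonneg (norm_nonneg v)
  calc (lam ∞ v - lam n v) * H ‖v‖ ^ 2 * maxwellian v
      ≤ (C * Real.exp (-(n : ℝ) ^ 2 / 2) * ((1 + (n : ℝ)) ^ 3 * wt ‖v‖)) *
        (2 * ((H ‖v‖ - u ‖v‖) ^ 2 + u ‖v‖ ^ 2)) * maxwellian v := by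
        gcongr
        exact h1.trans (by gcongr)
    _ = 2 * C / c * ((1 + (n : ℝ)) ^ 3 * Real.exp (-(n : ℝ) ^ 2 / 2)) *
        ((c * wt ‖v‖) * ((H ‖v‖ - u ‖v‖) ^ 2 + u ‖v‖ ^ 2) * maxwellian v) := by field_simp
    _ ≤ _ := by gcongr

lemma tendsto_integral_dualWt_compl :
    Tendsto (fun n : ℕ => ∫ v in (cball n)ᶜ, dualWt ‖v‖ * maxwellian v) atTop (𝓝 0) := by
  have h := tendsto_setIntegral_of_antitone (μ := volume) (s := fun n : ℕ => (cball n)ᶜ)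
    (f := fun v : V => dualWt ‖v‖ * maxwellian v) (fun n => (measurableSet_cball _).compl)
    (fun m n hmn v hv hm => hv (le_trans (show ‖v‖ₑ ≤ (m : ℝ≥0∞) from hm) (Nat.cast_le.2 hmn))) ⟨0, integrable_dualWt.integrableOn⟩
  have e : ⋂ n : ℕ, (cball n)ᶜ = ∅ := by
    refine Set.eq_empty_of_forall_notMem fun v hv => ?_
    obtain ⟨n, hn⟩ := exists_nat_ge ‖v‖
    refine Set.mem_iInter.1 hv n (mem_cball_iff.2 ?_)
    rw [← ENNReal.ofReal_natCast]
    exact ENNReal.ofReal_le_ofReal hn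
  rw [e] at h
  simpa using h

/-! ### Transfer of the coercive estimate from the whole space to large balls -/

/-- The kernel component of the extension of an orthogonal profile is small. -/
lemma exists_extension_kernel_le : ∃ θ : ℕ → ℝ, Tendsto θ atTop (𝓝 0) ∧ (∀ n, 0 ≤ θ n) ∧
    ∀ (n : ℕ) (u H : ℝ → ℝ), 1 ≤ n → IsProfile n u H → energy n u H < ∞ →
      (∀ α β : ℝ, ∫ v in cball n, u ‖v‖ * (α + β * ‖v‖ ^ 2) * maxwellian v = 0) →
      energy ∞ (extProfile n u H) (extGrad n H) < ∞ ∧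
      ∀ a c : ℝ, (∀ α β : ℝ, ∫ v in cball ∞,
        (extProfile n u H ‖v‖ - (a + c * ‖v‖ ^ 2)) * (α + β * ‖v‖ ^ 2) * maxwellian v = 0) →
        energy n (fun r => a + c * r ^ 2) (fun _ => 2 * c) ≤ ENNReal.ofReal (θ n) * energy n u H := by
  obtain ⟨C, hC, hl⟩ := exists_lam_le
  obtain ⟨C₁, hC₁, hwe⟩ := exists_wt_le_energy
  obtain ⟨K, hK, hwt⟩ := exists_wt_le_of_profile_top
  obtain ⟨C₂, hC₂, hker⟩ := exists_energy_kernel_le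
  obtain ⟨c₀, hc₀, hlow⟩ := exists_le_integral_kernel_sq
  set T : ℕ → ℝ := fun n => ∫ v in (cball n)ᶜ, dualWt ‖v‖ * maxwellian v with hT
  have hT0 : ∀ n, 0 ≤ T n := fun n => integral_nonneg fun v =>
    mul_nonneg (by unfold dualWt; positivity) (maxwellian_pos v).le
  set M : ℝ := K.toReal * (2 * C₁) with hM
  have hM0 : 0 ≤ M := by positivity
  refine ⟨fun n => C₂ * (T n / c₀ ^ 2 * M), ?_, fun n => by have := hT0 n; positivity,
    fun n u H hn h hE horth => ?_⟩
  · simpa using ((tendsto_integral_dualWt_compl.div_const (c₀ ^ 2)).mul_const M).const_mul C₂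
  have hn' : (1 : ℝ≥0∞) ≤ n := by exact_mod_cast hn
  set U := extProfile n u H with hU
  set G := extGrad n H with hG
  have hext : IsProfile ∞ U G := h.extend hn' hE
  have hUm : AEMeasurable (fun v : V => U ‖v‖) volume := by
    have := (hext.aestronglyMeasurable ENNReal.zero_lt_top).aemeasurable
    rwa [cball_top, Measure.restrict_univ] at this
  set S := energy n u H with hS
  have hG2 : ∫⁻ v in cball ∞, ENNReal.ofReal (wt ‖v‖ * G ‖v‖ ^ 2 * maxwellian v) ≤ ENNReal.ofReal C₁ * S := by
    rw [hG, extGrad_wt _ h.measurable]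
    exact (hwe n u H hn').1
  have hae : ∀ᵐ v ∂(volume.restrict (cball n)), U ‖v‖ = u ‖v‖ := by
    refine ae_restrict_cball_iff.2 ?_
    filter_upwards [ae_restrict_mem (isOpen_oball n).measurableSet, ae_restrict_of_ae ae_ne_zero] with v hv h0
    exact h.extProfile_eq hn' ((mem_oball_iff_norm_mem_radii h0).1 hv)
  -- On the unit ball U is the original profile; with the bound on G this controls U on the whole
  -- space, uniformly in n.
  have hY : ∫⁻ v in cball 1, ENNReal.ofReal (wt ‖v‖ * U ‖v‖ ^ 2 * maxwellian v) ≤ ENNReal.ofReal C₁ * S := by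
    refine (lintegral_mono_set fun v hv => le_trans hv hn').trans (le_trans (le_of_eq ?_) (hwe n u H hn').2)
    refine lintegral_congr_ae ?_
    filter_upwards [hae] with v hv
    rw [hv]
  set W := ∫⁻ v in cball ∞, ENNReal.ofReal (wt ‖v‖ * U ‖v‖ ^ 2 * maxwellian v) with hW
  have hWS : W ≤ ENNReal.ofReal M * S := by
    calc W ≤ K * (ENNReal.ofReal C₁ * S + ENNReal.ofReal C₁ * S) := (hwt U G hext).trans (by gcongr)
      _ = _ := by
        rw [hM, ENNReal.ofReal_mul ENNReal.toReal_nonneg, ENNReal.ofReal_toReal hK,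
          ENNReal.ofReal_mul (by norm_num), ENNReal.ofReal_ofNat]
        ring
  have hEtop : energy ∞ U G < ∞ :=
    (energy_le_wt hext.measurable hC (hl ∞)).trans_lt (ENNReal.add_lt_top.2
      ⟨ENNReal.mul_lt_top ENNReal.ofReal_lt_top
        (hG2.trans_lt (ENNReal.mul_lt_top ENNReal.ofReal_lt_top hE)),
      ENNReal.mul_lt_top ENNReal.ofReal_lt_top
        (hWS.trans_lt (ENNReal.mul_lt_top ENNReal.ofReal_lt_top hE))⟩)
  refine ⟨hEtop, fun a c hac => ?_⟩
  have iU : Integrable fun v : V => U ‖v‖ * (a + c * ‖v‖ ^ 2) * maxwellian v := by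
    have i1 := hext.integrableOn_mul le_top hEtop (φ := fun v => a + inner ℝ (0 : V) v + c * ‖v‖ ^ 2)
      (by fun_prop) (abs_kernel_poly_le a 0 c)
    simpa [cball_top] using i1
  -- The kernel component of U is computed by pairing U with itself, and U is orthogonal to kernel
  -- functions inside the ball, so only the exterior contributes.
  have hA : ∫ v in cball ∞, (a + c * ‖v‖ ^ 2) ^ 2 * maxwellian v
      = ∫ v in (cball n)ᶜ, U ‖v‖ * (a + c * ‖v‖ ^ 2) * maxwellian v := by
    have h1 : ∫ v in cball n, U ‖v‖ * (a + c * ‖v‖ ^ 2) * maxwellian v = 0 := by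
      rw [← horth a c]
      refine integral_congr_ae ?_
      filter_upwards [hae] with v hv
      rw [hv]
    have h2 := integral_add_compl (measurableSet_cball n) iU
    rw [h1, zero_add] at h2
    rw [h2]
    have h3 := hac a c
    rw [cball_top, Measure.restrict_univ] at h3 ⊢
    have e : ∀ v : V, (U ‖v‖ - (a + c * ‖v‖ ^ 2)) * (a + c * ‖v‖ ^ 2) * maxwellian v
        = U ‖v‖ * (a + c * ‖v‖ ^ 2) * maxwellian v - (a + c * ‖v‖ ^ 2) ^ 2 * maxwellian v := fun v => by ring
    simp_rw [e] at h3
    rw [integral_sub iU (integrable_kernel_sq a c)] at h3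
    linarith
  have hN : ENNReal.ofReal (a ^ 2 + c ^ 2) ≤ ENNReal.ofReal (T n / c₀ ^ 2) * W := by
    refine ofReal_le_of_sq_le hc₀ (by positivity) ?_
    refine (ENNReal.ofReal_le_ofReal (pow_le_pow_left₀ (by positivity) (hlow ∞ le_top a c) 2)).trans ?_
    rw [hA]
    refine (ofReal_sq_integral_mul_kernel_le hUm.restrict a c).trans ?_
    gcongr
    exact lintegral_mono_set fun v _ => by simp [cball_top]
  calc _ ≤ ENNReal.ofReal (C₂ * (a ^ 2 + c ^ 2)) := hker n a c
    _ ≤ ENNReal.ofReal C₂ * (ENNReal.ofReal (T n / c₀ ^ 2) * (ENNReal.ofReal M * S)) := by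
        rw [ENNReal.ofReal_mul hC₂.le]
        gcongr
        exact hN.trans (by gcongr)
    _ = _ := by
        have := hT0 n
        rw [ENNReal.ofReal_mul hC₂.le, ENNReal.ofReal_mul (q := M) (by positivity)]
        ring

/-- Taking η above √θ makes θ/η at most √θ, so every error is small with ε, θ and η. As the final
constant is at most 1, division by 1 + η costs at most η. -/
lemma sub_mul_le_of_perturbed {δ ε θ η q s : ℝ} (hε : 0 ≤ ε) (hθ : 0 ≤ θ) (hη : Real.sqrt θ < η)
    (hδ : δ ≤ 1) (hs : 0 ≤ s)
    (h : δ * s ≤ (1 + η) * (q + ε * s) + (1 + 1 / η) * θ * s) :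
    (δ - ((1 + η) * ε + θ + Real.sqrt θ + η)) * s ≤ q := by
  have hr := Real.sqrt_nonneg θ
  have hη0 : 0 < η := hr.trans_lt hη
  have h1 : (1 + 1 / η) * θ ≤ θ + Real.sqrt θ := by
    have h2 : 1 / η * θ ≤ Real.sqrt θ := by
      rw [one_div_mul_eq_div, div_le_iff₀ hη0]
      nlinarith [Real.mul_self_sqrt hθ]
    linarith
  set D := δ - ((1 + η) * ε + θ + Real.sqrt θ + η) with hD
  have h3 : (D + η) * s ≤ (1 + η) * q := by
    have h4 : (1 + 1 / η) * θ * s ≤ (θ + Real.sqrt θ) * s := mul_le_mul_of_nonneg_right h1 hs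
    rw [hD]; linarith
  have h5 : D ≤ 1 := by
    have : 0 ≤ (1 + η) * ε := by positivity
    linarith
  have h6 : (1 + η) * (D * s) ≤ (1 + η) * q := by
    have : 0 ≤ η * s * (1 - D) := mul_nonneg (by positivity) (by linarith)
    linarith
  exact le_of_mul_le_mul_left h6 (by positivity)

/-- A constant `δ ≤ 1` valid in the whole space is almost valid in large balls. -/
lemma exists_transfer : ∃ τ : ℕ → ℝ, Tendsto τ atTop (𝓝 0) ∧ ∀ n : ℕ, 1 ≤ n → ∀ δ : ℝ, 0 < δ → δ ≤ 1 →
    CoerciveAt ∞ δ → CoerciveAt n (δ - τ n) := by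
  obtain ⟨ε, hε, hε0, hsub⟩ := exists_lintegral_lam_sub_le
  obtain ⟨θ, hθ, hθ0, hker⟩ := exists_extension_kernel_le
  -- The second term keeps η n strictly above √(θ n), even where θ n = 0.
  set η : ℕ → ℝ := fun n => Real.sqrt (θ n) + 1 / ((n : ℝ) + 1) with hη
  have hsq : Tendsto (fun n => Real.sqrt (θ n)) atTop (𝓝 0) := by
    have := hθ.sqrt
    rwa [Real.sqrt_zero] at this
  have hηl : Tendsto η atTop (𝓝 0) := by
    have := hsq.add (tendsto_one_div_add_atTop_nhds_zero_nat (𝕜 := ℝ))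
    rwa [add_zero] at this
  refine ⟨fun n => (1 + η n) * ε n + θ n + Real.sqrt (θ n) + η n, ?_, fun n hn δ hδ0 hδ1 hco => ?_⟩
  · simpa using ((((hηl.const_add 1).mul hε).add hθ).add hsq).add hηl
  have hn' : (1 : ℝ≥0∞) ≤ n := by exact_mod_cast hn
  refine coerciveAt_of_profile hn' fun u H h hE horth => ?_
  rcases le_or_gt (δ - ((1 + η n) * ε n + θ n + Real.sqrt (θ n) + η n)) 0 with h0 | h0
  · rw [ENNReal.ofReal_of_nonpos h0, zero_mul]; exact zero_le
  by_cases hQ : qform n H = ∞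
  · rw [hQ]; exact le_top
  obtain ⟨hEtop, hk⟩ := hker n u H hn h hE horth
  have hext := h.extend hn' hE
  obtain ⟨a, c, hac, hle⟩ := hco.exists_of_profile le_top exists_isKernelBasis_top hext hEtop
  have hk' := hk a c hac
  have hηn : Real.sqrt (θ n) < η n := by
    have : (0 : ℝ) < 1 / ((n : ℝ) + 1) := by positivity
    simp only [hη]; linarith
  have hη0 : 0 < η n := (Real.sqrt_nonneg _).trans_lt hηn
  set S := energy n u H with hS
  set Q := qform n H with hQdef
  have hQtop : qform ∞ (extGrad n H) ≤ Q + ENNReal.ofReal (ε n) * S := by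
    rw [qform_top_extGrad_eq _ h.measurable]
    gcongr
    refine (hsub n hn (extProfile n u H) (extGrad n H)).trans (le_of_eq ?_)
    rw [energy_congr (fun r hr => h.extProfile_eq hn' hr) (fun r hr => extGrad_of_mem hr)]
  -- In the ball the profile is the orthogonal part of the extension plus its small kernel part; the
  -- energy of the first only grows when passed to the whole space.
  have hsum : S ≤ ENNReal.ofReal (1 + η n) * energy ∞ (fun r => extProfile n u H r - (a + c * r ^ 2))
        (fun r => extGrad n H r - 2 * c)
      + ENNReal.ofReal (1 + 1 / η n) * (ENNReal.ofReal (θ n) * S) := by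
    have h1 := energy_add_le (R := n) (fun r => extProfile n u H r - (a + c * r ^ 2))
      (fun r => extGrad n H r - 2 * c) (u' := fun r => a + c * r ^ 2) (H' := fun _ => 2 * c)
      (by fun_prop) (by fun_prop) hη0
    simp only [sub_add_cancel] at h1
    rw [energy_congr (R := n) (u' := u) (H' := H) (fun r hr => h.extProfile_eq hn' hr)
      (fun r hr => extGrad_of_mem hr)] at h1
    exact h1.trans (add_le_add (mul_le_mul' le_rfl (energy_mono le_top _ _)) (mul_le_mul' le_rfl hk'))
  -- The bound δ ≤ 1 removes δ from the last error term, which keeps τ independent of δ.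
  have hmain : ENNReal.ofReal δ * S ≤ ENNReal.ofReal (1 + η n) * (Q + ENNReal.ofReal (ε n) * S)
      + ENNReal.ofReal (1 + 1 / η n) * (ENNReal.ofReal (θ n) * S) := by
    calc _ ≤ ENNReal.ofReal δ * (ENNReal.ofReal (1 + η n) * energy ∞
            (fun r => extProfile n u H r - (a + c * r ^ 2)) (fun r => extGrad n H r - 2 * c)
            + ENNReal.ofReal (1 + 1 / η n) * (ENNReal.ofReal (θ n) * S)) := by gcongr
      _ = ENNReal.ofReal (1 + η n) * (ENNReal.ofReal δ * energy ∞
            (fun r => extProfile n u H r - (a + c * r ^ 2)) (fun r => extGrad n H r - 2 * c))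
            + ENNReal.ofReal δ * (ENNReal.ofReal (1 + 1 / η n) * (ENNReal.ofReal (θ n) * S)) := by ring
      _ ≤ ENNReal.ofReal (1 + η n) * (Q + ENNReal.ofReal (ε n) * S)
            + 1 * (ENNReal.ofReal (1 + 1 / η n) * (ENNReal.ofReal (θ n) * S)) := by
          gcongr
          · exact hle.trans hQtop
          · exact ENNReal.ofReal_le_one.2 hδ1
      _ = _ := by rw [one_mul]
  have hSr : S = ENNReal.ofReal S.toReal := (ENNReal.ofReal_toReal hE.ne).symm
  have hQr : Q = ENNReal.ofReal Q.toReal := (ENNReal.ofReal_toReal hQ).symm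
  have hs0 : 0 ≤ S.toReal := ENNReal.toReal_nonneg
  have hq0 : 0 ≤ Q.toReal := ENNReal.toReal_nonneg
  have e1 := hε0 n
  have e2 := hθ0 n
  rw [hSr, hQr] at hmain ⊢
  rw [← ENNReal.ofReal_mul hδ0.le, ← ENNReal.ofReal_mul e1, ← ENNReal.ofReal_mul e2,
    ← ENNReal.ofReal_add hq0 (by positivity), ← ENNReal.ofReal_mul (by positivity),
    ← ENNReal.ofReal_mul (by positivity), ← ENNReal.ofReal_add (by positivity) (by positivity),
    ENNReal.ofReal_le_ofReal_iff (by positivity)] at hmain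
  rw [← ENNReal.ofReal_mul h0.le]
  exact ENNReal.ofReal_le_ofReal
    (sub_mul_le_of_perturbed e1 e2 hηn hδ1 hs0 (by rw [mul_assoc (1 + 1 / η n)]; exact hmain))

lemma CoerciveAt.mono {R : ℝ≥0∞} {δ δ' : ℝ} (h : CoerciveAt R δ) (hle : δ' ≤ δ) : CoerciveAt R δ' :=
  fun e he f hf => (mul_le_mul' (ENNReal.ofReal_le_ofReal hle) le_rfl).trans (h e he f hf)

end Landau

end

theorem lemma3p2 :
    ∃ δ : ℕ → ℝ,
      (∀ n : ℕ, 1 ≤ n → 0 < δ n ∧ Landau.CoerciveAt (n : ℝ≥0∞) (δ n)) ∧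
      (∃ δinf : ℝ, 0 < δinf ∧ Landau.CoerciveAt ∞ δinf) ∧
      (∀ δinf : ℝ, 0 < δinf → Landau.CoerciveAt ∞ δinf →
        ENNReal.ofReal (min 1 δinf) ≤ liminf (fun n : ℕ => ENNReal.ofReal (δ n)) atTop) ∧
      (∃ δstar : ℝ, 0 < δstar ∧ ∀ n : ℕ, 1 ≤ n → δstar ≤ δ n) := by
  obtain ⟨δ₀, hδ₀, hco⟩ := Landau.exists_coerciveAt
  obtain ⟨τ, hτ, htr⟩ := Landau.exists_transfer
  -- The constants δ_n must be fixed before δ_∞ is given, so they are built from the supremum of all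
  -- admissible constants capped at 1.
  set A : Set ℝ := {δ | (0 < δ ∧ δ ≤ 1) ∧ Landau.CoerciveAt ∞ δ} with hA
  have hbdd : BddAbove A := ⟨1, fun x hx => hx.1.2⟩
  have hmem : ∀ δ, 0 < δ → Landau.CoerciveAt ∞ δ → min 1 δ ∈ A := fun δ h0 h =>
    ⟨⟨lt_min one_pos h0, min_le_left _ _⟩, h.mono (min_le_right _ _)⟩
  have hne : A.Nonempty := ⟨_, hmem δ₀ hδ₀ (hco ∞ le_top)⟩
  set D := sSup A with hD
  -- The uniform constant δ₀ ensures positivity and the common lower bound; the other entry tends to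
  -- D. Subtracting 1/(n+1) avoids having to know that the supremum is attained.
  refine ⟨fun n => max δ₀ (D - τ n - 1 / ((n : ℝ) + 1)), fun n hn => ⟨lt_max_of_lt_left hδ₀, ?_⟩,
    ⟨δ₀, hδ₀, hco ∞ le_top⟩, fun δ h0 h => ?_, ⟨δ₀, hδ₀, fun n _ => le_max_left _ _⟩⟩
  · rcases max_choice δ₀ (D - τ n - 1 / ((n : ℝ) + 1)) with e | e
    · simp only [e]
      exact hco n (by exact_mod_cast hn)
    · simp only [e]
      have hlt : D - 1 / ((n : ℝ) + 1) < sSup A := by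
        have : (0 : ℝ) < 1 / ((n : ℝ) + 1) := by positivity
        linarith
      obtain ⟨δ, hδ, hδlt⟩ := exists_lt_of_lt_csSup hne hlt
      exact (htr n hn δ hδ.1.1 hδ.1.2 hδ.2).mono (by linarith)
  · have hle : min 1 δ ≤ D := le_csSup hbdd (hmem δ h0 h)
    have hlim : Tendsto (fun n : ℕ => ENNReal.ofReal (D - τ n - 1 / ((n : ℝ) + 1))) atTop
        (𝓝 (ENNReal.ofReal D)) := by
      refine ENNReal.tendsto_ofReal ?_
      simpa using (hτ.const_sub D).sub tendsto_one_div_add_atTop_nhds_zero_nat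
    calc ENNReal.ofReal (min 1 δ) ≤ ENNReal.ofReal D := ENNReal.ofReal_le_ofReal hle
      _ = liminf (fun n : ℕ => ENNReal.ofReal (D - τ n - 1 / ((n : ℝ) + 1))) atTop := hlim.liminf_eq.symm
      _ ≤ _ := liminf_le_liminf (Eventually.of_forall fun n =>
          ENNReal.ofReal_le_ofReal (le_max_right _ _))
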